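/- **Setting.** Fix integers $K,M\ge 1$, a regular planar lattice $\mathcal H\subset\mathbb R^2$, distinct locations $\mathfrak s_1,\mathfrak s_2,\dots\in\mathcal H$ whose sampling region becomes arbitrarily wide in every direction, a unit vector $\varrho\in\mathbb R^K$ and $\beta_0\in\mathbb R^K$. A *DGP* $f$ consists of $\beta\in\mathbb R^K$ with $\varrho^\top\beta=\varrho^\top\beta_0$, a strictly stationary random field over $\mathcal H$ with values $\alpha_i$ at $\mathfrak s_i$, a strictly stationary series $(\xi_t)$, and i.i.d. $\varepsilon_{it}$, the three blocks independent with uniform marginals on $[0,1]$, and measurable functions $f_{NT}$, which may vary with $(N,T)$, such that $(y_{it},X_{it},u_{it})=f_{NT}(\alpha_i,\xi_t,\varepsilon_{it})$ with $y_{it}=X_{it}\beta+u_{it}$, $y_{it},u_{it}\in\mathbb R^M$, $X_{it}\in\mathbb R^{M\times K}$. Let $P_{NT,f}$ be the law of the observed sample $\{(y_{it},X_{it})\}_{i\le N,t\le T}$ and $\widehat\beta=(X^\top X)^{-1}X^\top y$. Let $s_{it}=X_{it}^\top u_{it}$, $$a_i=E(s_{it}|\alpha_i)-E s_{it},\quad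 d_t=E(s_{it}|\xi_t)-E s_{it},\quad v_{it}=E(s_{it}|\alpha_i,\xi_t)-E(s_{it}|\alpha_i)-E(s_{it}|\xi_t)+E s_{it},\quad e_{it}=s_{it}-E(s_{it}|\alpha_i,\xi_t),$$ $$\sigma_a^2=\tfrac1N\sum_{i,j}E(a_ia_j^\top),\quad \sigma_d^2=\tfrac1T\sum_{t,t'}E(d_td_{t'}^\top),\quad \sigma_v^2=\tfrac1{NT}\sum_{i,i',t,t'}E(v_{it}v_{i't'}^\top),\quad \sigma_e^2=\tfrac1{NT}\sum_{i,i',t,t'}E(e_{it}e_{i't'}^\top),$$ all depending on $f$ and $(N,T)$; $\sigma^2_{ak}$ etc. are the $k$-th diagonal entries, $\Sigma_{NT}=T\sigma_a^2+N\sigma_d^2+\sigma_v^2+\sigma_e^2$, and $r_{NT,f}=\min\{\sqrt N/\sigma_{a1},\sqrt T/\sigma_{d1},\sqrt{NT}\}$ (a quotient by $0$ is $\infty$). A DGP is *regular* if: 1. $v_{it,k}=\sum_{l,l'}c_{ll',k}\,\phi_{l,k}(\alpha_i)\psi_{l',k}(\xi_t)$ in $L^2$ of the uniform law on $[0,1]^2$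 for every $k$, where $(\phi_{l,k})_l$ and $(\psi_{l',k})_{l'}$ are orthonormal in $L^2[0,1]$ with first three absolute moments uniformly bounded, and $|c_{ll',k}|\le\bar c_{ll'}$ for some $(\bar c_{ll'})$ that does not depend on $(N,T)$ and has $\sum\bar c_{ll'}^2<\infty$ ($c$, $\phi$, $\psi$ may vary with $(N,T)$). 2. For some $\zeta>1$, $\delta>0$: $E s_{it}=0$; the smallest eigenvalue of $E(X_{it}^\top X_{it})$ is bounded away from $0$; the moments of order $8(\zeta+\delta)$ of $\|X_{it}\|$, $\|u_{it}\|$, and of $a_{ik}/\sigma_{ak}$, $d_{tk}/\sigma_{dk}$, $e_{it,k}/\sigma_{ek}$, $v_{it,k}/\sigma_{vk}$ whenever the denominator is positive, are bounded uniformly in $(N,T)$; the smallest eigenvalue of $\Sigma_{NT}$ is eventually bounded away from $0$. 3. With the same $\zeta,\delta$: the strong mixing coefficients of $(\xi_t)$ are $O(s^{-\lambda})$ for some $\lambda>2\zeta/(\zeta-1)$, and those of $(\alpha_i)$ satisfy $\alpha_{\infty,\infty}(r)^{1-1/(2(\zeta+\delta)-1)}=o(r^{-4})$. 4. $\lambda_{\max}(\Sigma_{NT})/\lambda_{\min}(\Sigma_{NT})=O(1)$.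 All limits are joint limits as $N,T\to\infty$. $\mathcal B_1$ (I&N) is the class of regular DGPs such that for some $k$: $\max\{T\sigma_{ak}^2,N\sigma_{dk}^2\}$ converges to a limit in $(0,\infty)$ and $\sigma_{vk}^2$ is eventually bounded away from $0$. $\mathcal B_2$ (V&N) is the class of regular DGPs such that for all $k$: $T\sigma_{ak}^2\to0$, $N\sigma_{dk}^2\to0$ and $\sigma_{vk}^2$ is eventually bounded away from $0$. The target $\mathcal L_0(\nu_f,\{c_{ll',f}\})$ is the law on $\mathbb R^K$ of $A+D+E+\frac{r_{NT,f}}{\sqrt{NT}}\sum_{l,l'}c_{ll'}\odot Z_l^\phi\odot Z_{l'}^\psi$ (series in $L^2$), where $(A,(Z_l^\phi)_l)$, $(D,(Z_{l'}^\psi)_{l'})$ and $E$ are independent centred Gaussian families with the covariances of $\big(\frac{r_{NT,f}}N\sum_i a_i,(\frac1{\sqrt N}\sum_i\phi_l(\alpha_i))_l\big)$, of $\big(\frac{r_{NT,f}}T\sum_t d_t,(\frac1{\sqrt T}\sum_t\psi_{l'}(\xi_t))_{l'}\big)$ and $\frac{r_{NT,f}^2}{NT}\sigma_e^2$. Write $\|\cdot\|_\infty$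 for the Kolmogorov distance. **Proposition.** (a) There are $\varepsilon_1>0$ and a finite $F_1\subseteq\mathcal B_1$ such that for every class $\mathcal C_1$ with $F_1\subseteq\mathcal C_1\subseteq\mathcal B_1$ (in particular for $\mathcal C_1=\mathcal B_1$) $$\liminf_{N,T\to\infty}\ \inf_{\widehat D}\ \sup_{f\in\mathcal C_1}P_{NT,f}\big(\|\widehat D-\mathcal L_0(\nu_f,\{c_{ll',f}\})\|_\infty>\varepsilon_1\big)>0,$$ where $\widehat D$ ranges over all measurable maps from the observed sample to the probability laws on $\mathbb R^K$. (The supremum is over those $f\in\mathcal C_1$ for which the law $\mathcal L_0$ exists at $(N,T)$.) (b) Let $\widehat D$ range over all possibly randomized tests based on the observed sample. For a test $\widehat D$ and DGPs $f_1,f_2$ let $\pi_{NT}(\widehat D;f_1,f_2)$ be the probability that its decisions on two independent samples, one from $f_1$ and one from $f_2$, agree (with independent randomization), and let $\bar\pi_{NT}(\widehat D;f_1,f_2)$ be the largest probability of agreement over all joint laws of the two decisions with the given marginals, that is, one minus the absolute difference of the two rejection probabilities. Then $$\liminf_{N,T\to\infty}\inf_{\widehat D}\sup_{f_1\in\mathcal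 B_1,f_2\in\mathcal B_2}\bar\pi_{NT}(\widehat D;f_1,f_2)=1,\qquad \liminf_{N,T\to\infty}\inf_{\widehat D}\sup_{f_1\in\mathcal B_1,f_2\in\mathcal B_2}\pi_{NT}(\widehat D;f_1,f_2)=\tfrac12 .$$ Moreover, for every $\eta>0$ there are finite $F_1\subseteq\mathcal B_1$ and $F_2\subseteq\mathcal B_2$ such that, for all classes $\mathcal C_1,\mathcal C_2$ with $F_j\subseteq\mathcal C_j\subseteq\mathcal B_j$, the two quantities with $\mathcal B_j$ replaced by $\mathcal C_j$ are at least $1-\eta$ and $\tfrac12-\eta$. (c) Let $\alpha\in(0,1)$. A calibration rule $\widehat D_2$ maps, for each $(N,T)$, the observed sample measurably to a probability law on $\mathbb R$; it yields two confidence intervals for $\varrho^\top\beta_0$: the equal-tailed one, of all $b$ with $\varrho^\top\widehat\beta-b$ between the $\alpha/2$ and $1-\alpha/2$ quantiles of $\widehat D_2$, and the symmetric one, of all $b$ such that $|\varrho^\top\widehat\beta-b|$ is at most the $1-\alpha$ quantile of the law of $|x|$ under $x\sim\widehat D_2$. There are $\varepsilon_2>0$ and finite $F_1\subseteq\mathcal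 B_1$, $F_2\subseteq\mathcal B_2$ such that for all classes $\mathcal C_1,\mathcal C_2$ with $F_j\subseteq\mathcal C_j\subseteq\mathcal B_j$ and every nonempty set $\mathcal D_2$ of calibration rules that is uniformly asymptotically exact over $\mathcal C_2$, i.e. $$\sup_{\widehat D_2\in\mathcal D_2}\ \sup_{f\in\mathcal C_2}P_{NT,f}\big(\|\widehat D_2-P_{NT,f}(\varrho^\top(\widehat\beta-\beta_0)\in\cdot)\|_\infty>\eta\big)\to0\quad\text{for all }\eta>0,$$ one has, for either type of interval $CI_{NT}(\widehat D_2,\alpha)$, $$\liminf_{N,T\to\infty}\ \sup_{\widehat D_2\in\mathcal D_2}\ \inf_{f\in\mathcal C_1}P_{NT,f}\big(\varrho^\top\beta_0\in CI_{NT}(\widehat D_2,\alpha)\big)\le 1-\alpha-\varepsilon_2 .$$ -/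

import Mathlib

open MeasureTheory ProbabilityTheory Filter
open scoped Topology ENNReal unitInterval

noncomputable section

namespace TwoWay

/-! ### Sampling design and data-generating processes -/

/-- The point of the regular planar lattice with basis `b` that has integer coordinates `z`. -/
def latticePoint (b : Module.Basis (Fin 2) ℝ (EuclideanSpace ℝ (Fin 2))) (z : ℤ × ℤ) :
    EuclideanSpace ℝ (Fin 2) :=
  (z.1 : ℝ) • b 0 + (z.2 : ℝ) • b 1

/-- What is known and fixed: the lattice, the locations of the first-dimension clusters, the unit
vector `ϱ` and the value `β₀` of the null hypothesis `ϱᵀβ = ϱᵀβ₀`. -/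
structure Design (K : ℕ) where
  lattice : Module.Basis (Fin 2) ℝ (EuclideanSpace ℝ (Fin 2))
  site : ℕ → ℤ × ℤ
  site_injective : Function.Injective site
  /-- Increasing domain: the sampling region gets arbitrarily wide in every direction (so it
  expands in two non-opposing directions). -/
  expands : ∀ v : EuclideanSpace ℝ (Fin 2), v ≠ 0 → ∀ R : ℝ, ∃ i j : ℕ,
    R ≤ inner ℝ (latticePoint lattice (site i) - latticePoint lattice (site j)) v
  ϱ : Fin K → ℝ
  ϱ_unit : ∑ k, ϱ k ^ 2 = 1
  β₀ : Fin K → ℝ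

/-- Euclidean distance between the locations of clusters `i` and `j`. -/
def Design.dist {K : ℕ} (𝒮 : Design K) (i j : ℕ) : ℝ :=
  ‖latticePoint 𝒮.lattice (𝒮.site i) - latticePoint 𝒮.lattice (𝒮.site j)‖

/-- A data-generating process. The function `f N T` may vary with the sample size, so a DGP is a
whole array indexed by `(N, T)`. Only the types are fixed here; the requirements are in
`Regular`. -/
structure DGP (K M : ℕ) where
  /-- Joint law of the spatial common effects (a random field over the lattice). -/
  rowLaw : ProbabilityMeasure (ℤ × ℤ → I)
  /-- Joint law of the serial common effects. -/
  timeLaw : ProbabilityMeasure (ℤ → I)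
  /-- The regression coefficient. -/
  β : Fin K → ℝ
  /-- `(y, X, u) = f (α, ξ, ε)` at sample size `(N, T)`; a cell contains `M` observations. -/
  f : ℕ → ℕ → I × I × I → (Fin M → ℝ) × (Fin M → Fin K → ℝ) × (Fin M → ℝ)
  /-- Spectral coefficients `c_{l l' f, k}` and the two systems `φ_{l,k}`, `ψ_{l',k}`. -/
  coef : ℕ → ℕ → ℕ → ℕ → Fin K → ℝ
  φ : ℕ → ℕ → ℕ → Fin K → I → ℝ
  ψ : ℕ → ℕ → ℕ → Fin K → I → ℝ

/-- Realizations of all latent variables behind an `N × T` sample. -/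
abbrev Latent (N T : ℕ) : Type := (ℤ × ℤ → I) × (ℤ → I) × (Fin N → Fin T → I)

/-- The observed sample `(y_it, X_it)`. -/
abbrev Panel (K M N T : ℕ) : Type := Fin N → Fin T → (Fin M → ℝ) × (Fin M → Fin K → ℝ)

variable {K M : ℕ}

namespace DGP

/-- The law of the spatial common effects as a measure. -/
abbrev rowMeasure (g : DGP K M) : Measure (ℤ × ℤ → I) := g.rowLaw

/-- The law of the serial common effects as a measure. -/
abbrev timeMeasure (g : DGP K M) : Measure (ℤ → I) := g.timeLaw

/-- Law of the latent variables: the three blocks are independent, and the `ε_it` are i.i.d.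
uniform on `[0,1]`. -/
def latentLaw (g : DGP K M) (N T : ℕ) : Measure (Latent N T) :=
  g.rowMeasure.prod
    (g.timeMeasure.prod
      (Measure.pi fun _ : Fin N => Measure.pi fun _ : Fin T => (volume : Measure I)))

/-- `(α_i, ξ_t, ε_it)`. -/
def cell (𝒮 : Design K) {N T : ℕ} (ω : Latent N T) (i : Fin N) (t : Fin T) : I × I × I :=
  (ω.1 (𝒮.site i), ω.2.1 (t : ℤ), ω.2.2 i t)

/-- `P_{NT,f}`: the law of the observed sample. -/
def dataLaw (g : DGP K M) (𝒮 : Design K) (N T : ℕ) : Measure (Panel K M N T) :=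
  (g.latentLaw N T).map fun ω i t =>
    ((g.f N T (cell 𝒮 ω i t)).1, (g.f N T (cell 𝒮 ω i t)).2.1)

/-! ### Score decomposition

Each `(α_i, ξ_t, ε_it)` is uniform on `[0,1]³`, so conditional expectations of the score given
`α_i`, given `ξ_t` and given both are the partial integrals below. -/

/-- The score `X_itᵀ u_it` as a function of `(α_i, ξ_t, ε_it)`. -/
def score (g : DGP K M) (N T : ℕ) (z : I × I × I) (k : Fin K) : ℝ :=
  ∑ m, (g.f N T z).2.1 m k * (g.f N T z).2.2 m

/-- `E (X_itᵀ u_it)`. -/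
def meanScore (g : DGP K M) (N T : ℕ) (k : Fin K) : ℝ := ∫ z, g.score N T z k

/-- `E (X_itᵀ X_it)`. -/
def Q (g : DGP K M) (N T : ℕ) (k l : Fin K) : ℝ :=
  ∫ z, ∑ m, (g.f N T z).2.1 m k * (g.f N T z).2.1 m l

/-- `a_i` as a function of `α_i`. -/
def aFun (g : DGP K M) (N T : ℕ) (x : I) (k : Fin K) : ℝ :=
  (∫ q : I × I, g.score N T (x, q.1, q.2) k) - g.meanScore N T k

/-- `d_t` as a function of `ξ_t`. -/
def dFun (g : DGP K M) (N T : ℕ) (s : I) (k : Fin K) : ℝ :=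
  (∫ q : I × I, g.score N T (q.1, s, q.2) k) - g.meanScore N T k

/-- `v_it` as a function of `(α_i, ξ_t)`. -/
def vFun (g : DGP K M) (N T : ℕ) (x s : I) (k : Fin K) : ℝ :=
  (∫ e : I, g.score N T (x, s, e) k) - (∫ q : I × I, g.score N T (x, q.1, q.2) k)
    - (∫ q : I × I, g.score N T (q.1, s, q.2) k) + g.meanScore N T k

/-- `e_it` as a function of `(α_i, ξ_t, ε_it)`. -/
def eFun (g : DGP K M) (N T : ℕ) (z : I × I × I) (k : Fin K) : ℝ :=
  g.score N T z k - ∫ e : I, g.score N T (z.1, z.2.1, e) k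

/-- `σ²_{a,f} = N⁻¹ ∑_{i,j} E (a_i a_jᵀ)`. -/
def varA (g : DGP K M) (𝒮 : Design K) (N T : ℕ) (k l : Fin K) : ℝ :=
  (1 / (N : ℝ)) * ∑ i : Fin N, ∑ j : Fin N,
    ∫ w, g.aFun N T (w (𝒮.site i)) k * g.aFun N T (w (𝒮.site j)) l ∂g.rowMeasure

/-- `σ²_{d,f} = T⁻¹ ∑_{t,t'} E (d_t d_t'ᵀ)`. -/
def varD (g : DGP K M) (N T : ℕ) (k l : Fin K) : ℝ :=
  (1 / (T : ℝ)) * ∑ t : Fin T, ∑ t' : Fin T,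
    ∫ w, g.dFun N T (w (t : ℤ)) k * g.dFun N T (w (t' : ℤ)) l ∂g.timeMeasure

/-- `σ²_{v,f} = (NT)⁻¹ ∑_{i,i',t,t'} E (v_it v_i't'ᵀ)`. -/
def varV (g : DGP K M) (𝒮 : Design K) (N T : ℕ) (k l : Fin K) : ℝ :=
  (1 / ((N : ℝ) * T)) * ∑ i : Fin N, ∑ i' : Fin N, ∑ t : Fin T, ∑ t' : Fin T,
    ∫ ω, g.vFun N T (cell 𝒮 ω i t).1 (cell 𝒮 ω i t).2.1 k
      * g.vFun N T (cell 𝒮 ω i' t').1 (cell 𝒮 ω i' t').2.1 l ∂(g.latentLaw N T)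

/-- `σ²_{e,f} = (NT)⁻¹ ∑_{i,i',t,t'} E (e_it e_i't'ᵀ)`. -/
def varE (g : DGP K M) (𝒮 : Design K) (N T : ℕ) (k l : Fin K) : ℝ :=
  (1 / ((N : ℝ) * T)) * ∑ i : Fin N, ∑ i' : Fin N, ∑ t : Fin T, ∑ t' : Fin T,
    ∫ ω, g.eFun N T (cell 𝒮 ω i t) k * g.eFun N T (cell 𝒮 ω i' t') l ∂(g.latentLaw N T)

/-- `T σ²_a + N σ²_d + σ²_v + σ²_e`, which is `NT` times the variance `σ²_{NT,f}` of the mean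
score. -/
def varTotal (g : DGP K M) (𝒮 : Design K) (N T : ℕ) (k l : Fin K) : ℝ :=
  T * g.varA 𝒮 N T k l + N * g.varD N T k l + g.varV 𝒮 N T k l + g.varE 𝒮 N T k l

/-- The rate `r_{NT,f} = min {√N / σ_{a1}, √T / σ_{d1}, √(NT)}`, where a quotient by zero is
`∞`; it is written as one quotient with positive denominator. -/
def rate [NeZero K] (g : DGP K M) (𝒮 : Design K) (N T : ℕ) : ℝ :=
  √((N : ℝ) * T) /
    max 1 (max (√(T * g.varA 𝒮 N T 0 0)) (√(N * g.varD N T 0 0)))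

end DGP

/-- The quadratic form of a `K × K` array. -/
def quad (S : Fin K → Fin K → ℝ) (v : Fin K → ℝ) : ℝ := ∑ k, ∑ l, v k * S k l * v l

/-! ### Mixing coefficients -/

/-- The σ-field generated by the common effects of the clusters in `A`. -/
@[reducible]
def siteField (𝒮 : Design K) (A : Finset ℕ) : MeasurableSpace (ℤ × ℤ → I) :=
  ⨆ i ∈ A, MeasurableSpace.comap (fun w => w (𝒮.site i)) inferInstance

/-- Spatial strong mixing coefficient `α_{∞,∞}(r)`. -/
def spatialMixing (g : DGP K M) (𝒮 : Design K) (r : ℝ) : ℝ :=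
  sSup {x | ∃ A B : Finset ℕ, (∀ i ∈ A, ∀ j ∈ B, r ≤ 𝒮.dist i j) ∧
    ∃ G H : Set (ℤ × ℤ → I), MeasurableSet[siteField 𝒮 A] G ∧ MeasurableSet[siteField 𝒮 B] H ∧
      x = |g.rowMeasure.real (G ∩ H)
        - g.rowMeasure.real G * g.rowMeasure.real H|}

/-- Serial strong mixing coefficient `α(h)`. -/
def serialMixing (g : DGP K M) (h : ℕ) : ℝ :=
  sSup {x | ∃ t : ℤ, ∃ G H : Set (ℤ → I),
    MeasurableSet[⨆ s ∈ Set.Iic t, MeasurableSpace.comap (fun w : ℤ → I => w s) inferInstance] G ∧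
    MeasurableSet[⨆ s ∈ Set.Ici (t + h),
      MeasurableSpace.comap (fun w : ℤ → I => w s) inferInstance] H ∧
    x = |g.timeMeasure.real (G ∩ H)
      - g.timeMeasure.real G * g.timeMeasure.real H|}

/-! ### The maintained assumptions and the two regimes -/

/-- Two-way representation with uniform marginals and strictly stationary common effects, for the
linear model. -/
structure AHKRepresentation (g : DGP K M) : Prop where
  measurable : ∀ N T, Measurable (g.f N T)
  linear : ∀ N T z m, (g.f N T z).1 m
    = ∑ k, (g.f N T z).2.1 m k * g.β k + (g.f N T z).2.2 m
  row_uniform : ∀ z, g.rowMeasure.map (fun w => w z) = (volume : Measure I)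
  row_stationary : ∀ h : ℤ × ℤ,
    g.rowMeasure.map (fun w z => w (z + h)) = g.rowMeasure
  time_uniform : ∀ t, g.timeMeasure.map (fun w => w t) = (volume : Measure I)
  time_stationary : ∀ h : ℤ,
    g.timeMeasure.map (fun w t => w (t + h)) = g.timeMeasure

/-- `v_{it,k} = ∑_{l,l'} c_{ll',k} φ_{l,k}(α_i) ψ_{l',k}(ξ_t)` in `L²`, with orthonormal systems,
square-summably dominated coefficients and uniformly bounded first three moments. -/
structure SpectralCondition (g : DGP K M) : Prop where
  measurable_φ : ∀ N T l k, Measurable (g.φ N T l k)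
  measurable_ψ : ∀ N T l k, Measurable (g.ψ N T l k)
  orthonormal_φ : ∀ N T k l l',
    ∫ x, g.φ N T l k x * g.φ N T l' k x = if l = l' then 1 else 0
  orthonormal_ψ : ∀ N T k l l',
    ∫ x, g.ψ N T l k x * g.ψ N T l' k x = if l = l' then 1 else 0
  expansion : ∀ N T, 0 < N → 0 < T → ∀ k,
    Tendsto (fun S : Finset (ℕ × ℕ) => eLpNorm (fun z : I × I => g.vFun N T z.1 z.2 k
      - ∑ l ∈ S, g.coef N T l.1 l.2 k * g.φ N T l.1 k z.1 * g.ψ N T l.2 k z.2) 2 volume)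
      atTop (𝓝 0)
  coef_bound : ∃ c : ℕ × ℕ → ℝ, Summable (fun l => c l ^ 2) ∧
    ∀ N T, 0 < N → 0 < T → ∀ l l' k, |g.coef N T l l' k| ≤ c (l, l')
  moments : ∃ B : ℝ, ∀ N T l k, ∀ m ∈ Finset.Icc 1 3,
    ∫⁻ x, ‖g.φ N T l k x‖ₑ ^ m ≤ ENNReal.ofReal B ∧
    ∫⁻ x, ‖g.ψ N T l k x‖ₑ ^ m ≤ ENNReal.ofReal B

/-- Moment and variance conditions, with moments of order `p`. -/
structure MomentCondition (g : DGP K M) (𝒮 : Design K) (p : ℝ) : Prop where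
  mean_zero : ∀ N T, 0 < N → 0 < T → ∀ k, g.meanScore N T k = 0
  Q_pos : ∃ q > 0, ∀ N T, 0 < N → 0 < T → ∀ v, q * ∑ k, v k ^ 2 ≤ quad (g.Q N T) v
  moment_Xu : ∃ C : ℝ, ∀ N T, 0 < N → 0 < T →
    ∫⁻ z, ‖(g.f N T z).2.1‖ₑ ^ p ≤ ENNReal.ofReal C ∧
    ∫⁻ z, ‖(g.f N T z).2.2‖ₑ ^ p ≤ ENNReal.ofReal C
  moment_components : ∃ C : ℝ, ∀ N T, 0 < N → 0 < T → ∀ k,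
    (0 < g.varA 𝒮 N T k k →
      ∫⁻ x, ‖g.aFun N T x k / √(g.varA 𝒮 N T k k)‖ₑ ^ p ≤ ENNReal.ofReal C) ∧
    (0 < g.varD N T k k →
      ∫⁻ s, ‖g.dFun N T s k / √(g.varD N T k k)‖ₑ ^ p ≤ ENNReal.ofReal C) ∧
    (0 < g.varE 𝒮 N T k k →
      ∫⁻ z, ‖g.eFun N T z k / √(g.varE 𝒮 N T k k)‖ₑ ^ p ≤ ENNReal.ofReal C) ∧
    (0 < g.varV 𝒮 N T k k →
      ∫⁻ z : I × I, ‖g.vFun N T z.1 z.2 k / √(g.varV 𝒮 N T k k)‖ₑ ^ p ≤ ENNReal.ofReal C)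
  nondegenerate : ∃ κ > 0, ∀ᶠ n : ℕ × ℕ in atTop ×ˢ atTop, ∀ v,
    κ * ∑ k, v k ^ 2 ≤ quad (g.varTotal 𝒮 n.1 n.2) v

/-- All maintained assumptions on a DGP, together with the null hypothesis. -/
structure Regular (g : DGP K M) (𝒮 : Design K) : Prop where
  null : ∑ k, 𝒮.ϱ k * g.β k = ∑ k, 𝒮.ϱ k * 𝒮.β₀ k
  representation : AHKRepresentation g
  spectral : SpectralCondition g
  moments_mixing : ∃ ζ δ : ℝ, 1 < ζ ∧ 0 < δ ∧ MomentCondition g 𝒮 (8 * (ζ + δ)) ∧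
    (∃ lam : ℝ, 2 * ζ / (ζ - 1) < lam ∧
      (fun h : ℕ => serialMixing g h) =O[atTop] fun h : ℕ => (h : ℝ) ^ (-lam)) ∧
    (fun r : ℝ => spatialMixing g 𝒮 r ^ (1 - 1 / (2 * (ζ + δ) - 1))) =o[atTop]
      fun r : ℝ => r ^ (-4 : ℝ)
  /-- `λ_max (σ²_{NT,f}) / λ_min (σ²_{NT,f}) = O(1)`. -/
  same_rate : ∃ C : ℝ, ∀ᶠ n : ℕ × ℕ in atTop ×ˢ atTop, ∀ v w : Fin K → ℝ,
    ∑ k, v k ^ 2 = 1 → ∑ k, w k ^ 2 = 1 →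
      quad (g.varTotal 𝒮 n.1 n.2) v ≤ C * quad (g.varTotal 𝒮 n.1 n.2) w

/-- The interaction variance of coordinate `k` does not vanish. -/
def NonGaussian (g : DGP K M) (𝒮 : Design K) (k : Fin K) : Prop :=
  ∃ s > 0, ∀ᶠ n : ℕ × ℕ in atTop ×ˢ atTop, s ≤ g.varV 𝒮 n.1 n.2 k k

/-- Regime (I&N) for coordinate `k`. -/
def IntermediateNonGaussian (g : DGP K M) (𝒮 : Design K) (k : Fin K) : Prop :=
  (∃ lim > 0, Tendsto (fun n : ℕ × ℕ =>
    max (n.2 * g.varA 𝒮 n.1 n.2 k k) (n.1 * g.varD n.1 n.2 k k)) (atTop ×ˢ atTop) (𝓝 lim)) ∧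
  NonGaussian g 𝒮 k

/-- Regime (V&N) for coordinate `k`. -/
def VanishingNonGaussian (g : DGP K M) (𝒮 : Design K) (k : Fin K) : Prop :=
  Tendsto (fun n : ℕ × ℕ => n.2 * g.varA 𝒮 n.1 n.2 k k) (atTop ×ˢ atTop) (𝓝 0) ∧
  Tendsto (fun n : ℕ × ℕ => n.1 * g.varD n.1 n.2 k k) (atTop ×ˢ atTop) (𝓝 0) ∧
  NonGaussian g 𝒮 k

/-- The class `𝓑₁`: (I&N) holds for some coordinate. -/
def classIN (M : ℕ) (𝒮 : Design K) : Set (DGP K M) :=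
  {g | Regular g 𝒮 ∧ ∃ k, IntermediateNonGaussian g 𝒮 k}

/-- The class `𝓑₂`: (V&N) holds for all coordinates. -/
def classVN (M : ℕ) (𝒮 : Design K) : Set (DGP K M) :=
  {g | Regular g 𝒮 ∧ ∀ k, VanishingNonGaussian g 𝒮 k}

/-! ### The limit law -/

/-- The variables `r N⁻¹ ∑ a_i` (index `inl k`) and `N^{-1/2} ∑ φ_l(α_i)` (index `inr (l, k)`). -/
def rowPrimitive [NeZero K] (g : DGP K M) (𝒮 : Design K) (N T : ℕ) :
    Fin K ⊕ (ℕ × Fin K) → (ℤ × ℤ → I) → ℝ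
  | .inl k => fun w => g.rate 𝒮 N T / N * ∑ i : Fin N, g.aFun N T (w (𝒮.site i)) k
  | .inr (l, k) => fun w => 1 / √(N : ℝ) * ∑ i : Fin N, g.φ N T l k (w (𝒮.site i))

/-- The variables `r T⁻¹ ∑ d_t` (index `inl k`) and `T^{-1/2} ∑ ψ_l(ξ_t)` (index `inr (l, k)`). -/
def timePrimitive [NeZero K] (g : DGP K M) (𝒮 : Design K) (N T : ℕ) :
    Fin K ⊕ (ℕ × Fin K) → (ℤ → I) → ℝ
  | .inl k => fun w => g.rate 𝒮 N T / T * ∑ t : Fin T, g.dFun N T (w (t : ℤ)) k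
  | .inr (l, k) => fun w => 1 / √(T : ℝ) * ∑ t : Fin T, g.ψ N T l k (w (t : ℤ))

/-- `L` is distributed as
`ν_a Z^a + ν_d Z^d + ν_e Z^e + ν_v ∑_{l,l'} c_{ll'} ⊙ Z_l^φ ⊙ Z_{l'}^ψ`. Here `A` collects
`ν_a Z^a` and the `Z_l^φ`, `D` collects `ν_d Z^d` and the `Z_{l'}^ψ`, and `E` is `ν_e Z^e`: three
independent centred Gaussian families with the covariances of the corresponding normalized sums;
`ν_v = r / √(NT)`, and the series converges in `L²`. -/
structure IsLimitRepresentation [NeZero K] (g : DGP K M) (𝒮 : Design K) (N T : ℕ)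
    {Ω : Type} [MeasurableSpace Ω] (P : Measure Ω)
    (A D : Fin K ⊕ (ℕ × Fin K) → Ω → ℝ) (E : Fin K → Ω → ℝ) (L : Ω → Fin K → ℝ) : Prop where
  measurable_A : ∀ p, Measurable (A p)
  measurable_D : ∀ p, Measurable (D p)
  measurable_E : ∀ k, Measurable (E k)
  measurable_L : Measurable L
  gaussian_A : IsGaussianProcess A P
  gaussian_D : IsGaussianProcess D P
  gaussian_E : IsGaussianProcess E P
  mean_A : ∀ p, ∫ w, A p w ∂P = 0
  mean_D : ∀ p, ∫ w, D p w ∂P = 0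
  mean_E : ∀ k, ∫ w, E k w ∂P = 0
  cov_A : ∀ p q, cov[A p, A q; P]
    = cov[rowPrimitive g 𝒮 N T p, rowPrimitive g 𝒮 N T q; g.rowMeasure]
  cov_D : ∀ p q, cov[D p, D q; P]
    = cov[timePrimitive g 𝒮 N T p, timePrimitive g 𝒮 N T q; g.timeMeasure]
  cov_E : ∀ k l, cov[E k, E l; P] = g.rate 𝒮 N T ^ 2 / (N * T) * g.varE 𝒮 N T k l
  indep_A : IndepFun (fun w p => A p w) (fun w => ((fun p => D p w), fun k => E k w)) P
  indep_D : IndepFun (fun w p => D p w) (fun w k => E k w) P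
  series : ∀ k, Tendsto (fun S : Finset (ℕ × ℕ) => eLpNorm (fun w => L w k
      - (A (.inl k) w + D (.inl k) w + E k w + g.rate 𝒮 N T / √((N : ℝ) * T)
        * ∑ l ∈ S, g.coef N T l.1 l.2 k * A (.inr (l.1, k)) w * D (.inr (l.2, k)) w)) 2 P)
    atTop (𝓝 0)

/-- The target `𝓛₀(ν_f, {c_{ll',f}})`, as the set of the laws of all its representations; these
laws coincide, since the covariances determine the Gaussian families in law. -/
def limitLaw [NeZero K] (g : DGP K M) (𝒮 : Design K) (N T : ℕ) : Set (Measure (Fin K → ℝ)) :=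
  {μ | ∃ (Ω : Type) (_ : MeasurableSpace Ω) (P : Measure Ω) (_ : IsProbabilityMeasure P)
    (A D : Fin K ⊕ (ℕ × Fin K) → Ω → ℝ) (E : Fin K → Ω → ℝ) (L : Ω → Fin K → ℝ),
    IsLimitRepresentation g 𝒮 N T P A D E L ∧ μ = P.map L}

/-- Kolmogorov distance between laws on a finite-dimensional space or on the line. -/
def kolmogorov {V : Type*} [MeasurableSpace V] [Preorder V] (μ ν : Measure V) : ℝ :=
  ⨆ x : V, |μ.real (Set.Iic x) - ν.real (Set.Iic x)|

/-! ### Procedures -/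

/-- Measurable maps from the observed sample to the probability laws on `V`. -/
abbrev LawEstimator (K M N T : ℕ) (V : Type) [MeasurableSpace V] : Type :=
  {D : Kernel (Panel K M N T) V // IsMarkovKernel D}

/-- Possibly randomized tests: given the sample, the decision is drawn from a law on `Bool`. -/
abbrev Test (K M N T : ℕ) : Type := LawEstimator K M N T Bool

/-- The law of the decision of the test `D` under the DGP `g`. -/
def decisionLaw (g : DGP K M) (𝒮 : Design K) {N T : ℕ} (D : Test K M N T) : Measure Bool :=
  (g.dataLaw 𝒮 N T).bind D.1

/-- Probability that the decisions on two independent samples, from `g₁` and from `g₂`, agree. -/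
def independentAgreement (g₁ g₂ : DGP K M) (𝒮 : Design K) {N T : ℕ} (D : Test K M N T) : ℝ≥0∞ :=
  ((decisionLaw g₁ 𝒮 D).prod (decisionLaw g₂ 𝒮 D)) {p | p.1 = p.2}

/-- Largest probability, over all joint laws of the two decisions, that they agree. -/
def coupledAgreement (g₁ g₂ : DGP K M) (𝒮 : Design K) {N T : ℕ} (D : Test K M N T) : ℝ≥0∞ :=
  ⨆ (π : Measure (Bool × Bool)) (_ : π.map Prod.fst = decisionLaw g₁ 𝒮 D)
    (_ : π.map Prod.snd = decisionLaw g₂ 𝒮 D), π {p | p.1 = p.2}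

/-- The OLS estimator `(XᵀX)⁻¹ Xᵀy`. -/
def ols {N T : ℕ} (z : Panel K M N T) : Fin K → ℝ :=
  ((Matrix.of fun k l => ∑ i, ∑ t, ∑ m, (z i t).2 m k * (z i t).2 m l)⁻¹).mulVec
    fun k => ∑ i, ∑ t, ∑ m, (z i t).2 m k * (z i t).1 m

/-- `ϱᵀ β̂`. -/
def estimate (𝒮 : Design K) {N T : ℕ} (z : Panel K M N T) : ℝ := ∑ k, 𝒮.ϱ k * ols z k

/-- `ϱᵀ β₀`. -/
def Design.target (𝒮 : Design K) : ℝ := ∑ k, 𝒮.ϱ k * 𝒮.β₀ k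

/-- The law of the estimation error `ϱᵀ(β̂ - β₀)` under `P_{NT,f}`. -/
def errorLaw (g : DGP K M) (𝒮 : Design K) (N T : ℕ) : Measure ℝ :=
  (g.dataLaw 𝒮 N T).map fun z => estimate 𝒮 z - 𝒮.target

/-- The quantile of order `p ∈ (0,1)`. -/
def quantile (μ : Measure ℝ) (p : ℝ) : ℝ := sInf {x | p ≤ μ.real (Set.Iic x)}

/-- A distributional calibration rule: an estimator, for every sample size, of the law of
`ϱᵀ(β̂ - β₀)`. -/
abbrev Calibration (K M : ℕ) : Type := ∀ N T : ℕ, LawEstimator K M N T ℝ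

/-- Equal-tailed confidence interval for `ϱᵀβ₀` with the quantiles of the estimated law. -/
def equalTailedCI (𝒮 : Design K) (D : Calibration K M) (a : ℝ) {N T : ℕ} (z : Panel K M N T) :
    Set ℝ :=
  {b | estimate 𝒮 z - b ∈
    Set.Icc (quantile ((D N T).1 z) (a / 2)) (quantile ((D N T).1 z) (1 - a / 2))}

/-- Symmetric confidence interval for `ϱᵀβ₀`: the critical value is the quantile of the modulus
under the estimated law. -/
def symmetricCI (𝒮 : Design K) (D : Calibration K M) (a : ℝ) {N T : ℕ} (z : Panel K M N T) :
    Set ℝ :=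
  {b | |estimate 𝒮 z - b| ≤ quantile (((D N T).1 z).map fun x => |x|) (1 - a)}

/-- The calibration rules in `𝒟` are uniformly asymptotically exact over the class `C`: the
estimated law is uniformly Kolmogorov consistent for the law of `ϱᵀ(β̂ - β₀)`. -/
def UniformlyExact (𝒮 : Design K) (𝒟 : Set (Calibration K M)) (C : Set (DGP K M)) : Prop :=
  ∀ η : ℝ, 0 < η → Tendsto (fun n : ℕ × ℕ => ⨆ D ∈ 𝒟, ⨆ g ∈ C,
    g.dataLaw 𝒮 n.1 n.2 {z | η < kolmogorov ((D n.1 n.2).1 z) (errorLaw g 𝒮 n.1 n.2)})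
    (atTop ×ˢ atTop) (𝓝 0)

/-! ### The limiting minimax quantities -/

/-- Asymptotic minimax probability of missing the limit law by more than `ε` over `C`. -/
def estimationRisk [NeZero K] (𝒮 : Design K) (C : Set (DGP K M)) (ε : ℝ) : ℝ≥0∞ :=
  liminf (fun n : ℕ × ℕ => ⨅ D : LawEstimator K M n.1 n.2 (Fin K → ℝ),
    ⨆ g ∈ C, ⨆ μ ∈ limitLaw g 𝒮 n.1 n.2,
      g.dataLaw 𝒮 n.1 n.2 {z | ε < kolmogorov (D.1 z) μ}) (atTop ×ˢ atTop)

/-- Asymptotic worst-case agreement of the best test, over couplings of the two decisions. -/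
def coupledAgreementLimit (𝒮 : Design K) (C₁ C₂ : Set (DGP K M)) : ℝ≥0∞ :=
  liminf (fun n : ℕ × ℕ => ⨅ D : Test K M n.1 n.2,
    ⨆ g₁ ∈ C₁, ⨆ g₂ ∈ C₂, coupledAgreement g₁ g₂ 𝒮 D) (atTop ×ˢ atTop)

/-- Asymptotic worst-case agreement of the best test on two independent samples. -/
def independentAgreementLimit (𝒮 : Design K) (C₁ C₂ : Set (DGP K M)) : ℝ≥0∞ :=
  liminf (fun n : ℕ × ℕ => ⨅ D : Test K M n.1 n.2,
    ⨆ g₁ ∈ C₁, ⨆ g₂ ∈ C₂, independentAgreement g₁ g₂ 𝒮 D) (atTop ×ˢ atTop)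

/-- Best worst-case asymptotic coverage over `C` of the intervals `ci D` with `D ∈ 𝒟`. -/
def coverageLimit (𝒮 : Design K) (𝒟 : Set (Calibration K M)) (C : Set (DGP K M))
    (ci : Calibration K M → ∀ {N T : ℕ}, Panel K M N T → Set ℝ) : ℝ≥0∞ :=
  liminf (fun n : ℕ × ℕ => ⨆ D ∈ 𝒟, ⨅ g ∈ C,
    g.dataLaw 𝒮 n.1 n.2 {z | 𝒮.target ∈ ci D z}) (atTop ×ˢ atTop)

end TwoWay

end

set_option linter.unusedSectionVars false

noncomputable section

namespace TwoWay

section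

/-! ### Products of a standard normal variable and a shifted one -/

/-! All three parts rest on one family of processes, `shiftDGP`, indexed by a real `c`. A cluster
draws a uniform label in `Fin K` and an independent standard normal `g_i`; a period draws a standard
normal `w_t`. The only nonzero regressor row of a cell is the unit vector of the label, and its
error is `g_i (w_t + c/√T)`. The score of coordinate `k` is therefore `1{label_i = k} g_i (w_t +
c/√T)`: the shift creates `a_i = (c/√T) 1{label_i = k} g_i`, the interaction is `1{label_i = k} g_i
w_t` whatever `c` is, and `d`, `e` vanish. Hence `T σ_a² = c²/K` and `σ_v² = 1/K` on the diagonal,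
so `c ≠ 0` lies in the intermediate class and `c = 0` in the vanishing one (`shiftDGP_mem_classIN`,
`shiftDGP_mem_classVN`).

The sample sees `c` only through the mean `c/√T` of `T` independent normal variables
(`dataLaw_shiftDGP`). The likelihood ratio against `c = 0` has second moment `exp(c²)` for all `N`
and all `T > 0`. By Cauchy–Schwarz this gives a total variation bound `√(exp(c²) - 1)`, small for
small `c` (`dataLaw_shift_close`), and the contiguity bound `P_c(S) ≤ exp(c²/2) P_0(S)^{1/2}` for
every `c` (`dataLaw_shift_le_sqrt`).

Yet `c` survives in the limit. For `c² ≤ 1` the target law is that of `K^{-1/2} Z_k (W + c)` with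
independent standard normal variables, and the probability of `|Z| |W + c| ≤ y` is strictly
decreasing in `c ≥ 0` for `y > 0` (`prodNormalCDF_lt`), because a symmetric interval loses normal
mass when moved away from the centre.

Part (a) is Le Cam's two-point argument: two small positive shifts have different target laws, but
their samples are close in total variation. For (b), compare a small `c` with `0`: the rejection
probabilities nearly coincide, so some coupling of the decisions agrees with probability near `1`,
and independent decisions agree with probability at least about `1/2`. A fair coin shows that `1/2`
is attained.

For (c), compare `c = 1` with `c = 0`. Given the labels, the OLS error is a product of two
independent normal averages; the label frequencies tend to `1/K`, so `√(NT)` times its modulus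
converges in law to `√K |G| |Z + c|` (`tendsto_coveredGiven`). A rule that is exact at `c = 0`
reproduces the `c = 0` error law also under `c = 1`, by contiguity. Its critical values are thus
those for `c = 0`, and these are too short for the more dispersed error under `c = 1`. -/

/-- The standard normal law. -/
abbrev stdNormal : Measure ℝ := gaussianReal 0 1

lemma stdNormal_measurePreserving_neg : MeasurePreserving (fun x : ℝ => -x) stdNormal stdNormal :=
  ⟨measurable_neg, by simpa using gaussianReal_map_neg (μ := 0) (v := 1)⟩

instance : NullSingletonClass stdNormal := nullSingletonClass_gaussianReal one_ne_zero

lemma stdNormal_real_Icc {a b : ℝ} (h : a ≤ b) :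
    stdNormal.real (Set.Icc a b) = ∫ x in a..b, gaussianPDFReal 0 1 x := by
  rw [measureReal_def, gaussianReal_apply_eq_integral _ one_ne_zero,
    ENNReal.toReal_ofReal (integral_nonneg fun x => gaussianPDFReal_nonneg _ _ _),
    intervalIntegral.integral_of_le h, integral_Icc_eq_integral_Ioc]

lemma continuous_gaussianPDFReal_std : Continuous (gaussianPDFReal 0 1) := by
  unfold gaussianPDFReal; fun_prop

lemma gaussianPDFReal_std_le {x y : ℝ} (h : x ^ 2 ≤ y ^ 2) :
    gaussianPDFReal 0 1 y ≤ gaussianPDFReal 0 1 x := by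
  simp only [gaussianPDFReal, sub_zero]
  exact mul_le_mul_of_nonneg_left (Real.exp_le_exp.2 (by simp; linarith)) (by positivity)

lemma gaussianPDFReal_std_lt {x y : ℝ} (h : x ^ 2 < y ^ 2) :
    gaussianPDFReal 0 1 y < gaussianPDFReal 0 1 x := by
  simp only [gaussianPDFReal, sub_zero]
  refine mul_lt_mul_of_pos_left (Real.exp_lt_exp.2 (by simp; linarith)) ?_
  simp only [NNReal.coe_one, mul_one, inv_pos]
  positivity

/-- A symmetric interval loses normal mass when it is shifted further away from the centre. -/
lemma stdNormal_shift_lt {c c' x : ℝ} (hc : 0 ≤ c) (hcc : c < c') (hx : 0 < x) :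
    stdNormal.real {z | |z + c'| ≤ x} < stdNormal.real {z | |z + c| ≤ x} := by
  have hset : ∀ c : ℝ, {z : ℝ | |z + c| ≤ x} = Set.Icc (-x - c) (x - c) := by
    intro c; ext z
    simp only [Set.mem_ofPred_eq, abs_le, Set.mem_Icc]
    constructor <;> rintro ⟨h1, h2⟩ <;> constructor <;> linarith
  rw [hset, hset, stdNormal_real_Icc (by linarith), stdNormal_real_Icc (by linarith)]
  set p := gaussianPDFReal 0 1 with hp
  have hcont : Continuous p := continuous_gaussianPDFReal_std
  have hint : ∀ a b : ℝ, IntervalIntegrable p volume a b := fun a b => hcont.intervalIntegrable a b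
  have hsym : ∀ z, p (-z) = p z := fun z =>
    le_antisymm (gaussianPDFReal_std_le (by simp)) (gaussianPDFReal_std_le (by simp))
  -- The interval gained on the left by the shift has, by evenness, the mass of `[x + c, x + c']`,
  -- the reflection at `x` of the interval lost on the right. Since `x > 0`, reflection moves points
  -- of the lost interval away from `0`, where the density is smaller.
  have h1 : ∫ z in (-x - c')..(-x - c), p z = ∫ z in (x - c')..(x - c), p (2 * x - z) := by
    rw [intervalIntegral.integral_comp_sub_left (fun z => p z) (2 * x)]
    have := intervalIntegral.integral_comp_neg (a := x + c) (b := x + c') p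
    simp only [hsym] at this
    rw [show -x - c' = -(x + c') by ring, show -x - c = -(x + c) by ring, ← this]
    congr 1 <;> ring
  have h2 : ∫ z in (x - c')..(x - c), p (2 * x - z) < ∫ z in (x - c')..(x - c), p z := by
    refine intervalIntegral.integral_lt_integral_of_continuousOn_of_le_of_exists_lt (by linarith)
      (by fun_prop) (by fun_prop) (fun z hz => gaussianPDFReal_std_le ?_)
      ⟨x - c', ⟨le_rfl, by linarith⟩, gaussianPDFReal_std_lt ?_⟩
    · nlinarith [hz.2]
    · nlinarith
  have h3 := intervalIntegral.integral_add_adjacent_intervals (hint (-x - c') (-x - c))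
    (hint (-x - c) (x - c'))
  have h4 := intervalIntegral.integral_add_adjacent_intervals (hint (-x - c) (x - c'))
    (hint (x - c') (x - c))
  linarith

/-- The distribution function of `|G| |Z + c|` for independent standard normal `G` and `Z`. -/
def prodNormalCDF (c y : ℝ) : ℝ :=
  (stdNormal.prod stdNormal).real {p | |p.1| * |p.2 + c| ≤ y}

lemma measurableSet_prodNormal (c y : ℝ) :
    MeasurableSet {p : ℝ × ℝ | |p.1| * |p.2 + c| ≤ y} :=
  measurableSet_le (by fun_prop) measurable_const

lemma prodNormalCDF_eq_integral (c y : ℝ) :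
    prodNormalCDF c y = ∫ x, stdNormal.real {z | |x| * |z + c| ≤ y} ∂stdNormal := by
  rw [prodNormalCDF, measureReal_def, Measure.prod_apply (measurableSet_prodNormal c y),
    ← integral_toReal (measurable_measure_prodMk_left
      (measurableSet_prodNormal c y)).aemeasurable (ae_of_all _ fun x => measure_lt_top _ _)]
  rfl

/-- For almost every value `x` of the first factor the fibre is a symmetric interval of half-width
`y/|x|`, to which `stdNormal_shift_lt` applies; strictness on almost every fibre passes to the
integral. -/
lemma prodNormalCDF_lt {c c' y : ℝ} (hc : 0 ≤ c) (hcc : c < c') (hy : 0 < y) :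
    prodNormalCDF c' y < prodNormalCDF c y := by
  rw [prodNormalCDF_eq_integral, prodNormalCDF_eq_integral]
  have hae : ∀ᵐ x ∂stdNormal, x ≠ 0 := by
    rw [ae_iff]; simp
  have hlt : ∀ᵐ x ∂stdNormal, stdNormal.real {z | |x| * |z + c'| ≤ y}
      < stdNormal.real {z | |x| * |z + c| ≤ y} := by
    filter_upwards [hae] with x hx
    have hx' : 0 < |x| := abs_pos.2 hx
    have := stdNormal_shift_lt hc hcc (div_pos hy hx')
    simpa only [le_div_iff₀' hx'] using this
  have hint : ∀ c, Integrable (fun x => stdNormal.real {z | |x| * |z + c| ≤ y}) stdNormal := by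
    intro c
    refine Integrable.of_bound (C := 1) ?_ (ae_of_all _ fun x => ?_)
    · exact (measurable_measure_prodMk_left
        (measurableSet_prodNormal c y)).ennreal_toReal.aestronglyMeasurable
    · rw [Real.norm_of_nonneg measureReal_nonneg]; exact measureReal_le_one
  refine lt_of_le_of_ne (integral_mono_ae (hint c') (hint c) (hlt.mono fun x hx => hx.le)) ?_
  intro heq
  have h0 := (integral_eq_iff_of_ae_le (hint c') (hint c) (hlt.mono fun x hx => hx.le)).1 heq
  obtain ⟨x, hx, hx'⟩ := (hlt.and h0).exists
  exact hx.ne hx'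

lemma prodNormal_level_null (c y : ℝ) :
    (stdNormal.prod stdNormal) {p | |p.1| * |p.2 + c| = y} = 0 := by
  rw [Measure.measure_prod_null (measurableSet_eq_fun (by fun_prop) measurable_const)]
  have hae : ∀ᵐ x ∂stdNormal, x ≠ 0 := by
    rw [ae_iff]; simp
  filter_upwards [hae] with x hx
  refine measure_mono_null (t := {y / |x| - c, -(y / |x|) - c}) ?_
    (Set.Finite.measure_zero (by simp) _)
  intro z hz
  simp only [Set.preimage_ofPred_eq, Set.mem_ofPred_eq] at hz
  have : |z + c| = y / |x| := by rw [eq_div_iff (abs_ne_zero.2 hx)]; linarith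
  rcases eq_or_eq_neg_of_abs_eq this with h | h
  · left; linarith
  · right; simp only [Set.mem_singleton_iff]; linarith

/-- The fibres of each level set have at most two points, so the law has no atoms. Continuity is
what permits intermediate values and perturbing the argument, both in the choice of the critical
level and in the limit over label frequencies. -/
lemma continuous_prodNormalCDF (c : ℝ) : Continuous (prodNormalCDF c) := by
  set ν : Measure ℝ := (stdNormal.prod stdNormal).map fun p => |p.1| * |p.2 + c| with hν
  have hm : Measurable fun p : ℝ × ℝ => |p.1| * |p.2 + c| := by fun_prop
  have : IsProbabilityMeasure ν := Measure.isProbabilityMeasure_map hm.aemeasurable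
  have hJ : prodNormalCDF c = cdf ν := by
    ext y
    rw [cdf_eq_real, hν, map_measureReal_apply hm measurableSet_Iic]
    rfl
  rw [hJ]
  have hsing : ∀ y, ν {y} = 0 := fun y => by
    rw [hν, Measure.map_apply hm (measurableSet_singleton y)]
    exact prodNormal_level_null c y
  refine continuous_iff_continuousAt.2 fun y => ?_
  rw [(monotone_cdf ν).continuousAt_iff_leftLim_eq_rightLim, StieltjesFunction.rightLim_eq]
  have h := hsing y
  rw [← measure_cdf ν, StieltjesFunction.measure_singleton, ENNReal.ofReal_eq_zero] at h
  exact le_antisymm ((monotone_cdf ν).leftLim_le le_rfl) (by linarith)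

lemma prodNormalCDF_zero (c : ℝ) : prodNormalCDF c 0 = 0 := by
  have : {p : ℝ × ℝ | |p.1| * |p.2 + c| ≤ 0} = {p | |p.1| * |p.2 + c| = 0} := by
    ext p; exact ⟨fun h => le_antisymm h (by positivity), fun h => le_of_eq h⟩
  rw [prodNormalCDF, this, measureReal_def, prodNormal_level_null, ENNReal.toReal_zero]

lemma tendsto_prodNormalCDF (c : ℝ) : Tendsto (prodNormalCDF c) atTop (𝓝 1) := by
  set ν : Measure ℝ := (stdNormal.prod stdNormal).map fun p => |p.1| * |p.2 + c| with hν
  have hm : Measurable fun p : ℝ × ℝ => |p.1| * |p.2 + c| := by fun_prop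
  have : IsProbabilityMeasure ν := Measure.isProbabilityMeasure_map hm.aemeasurable
  have hJ : prodNormalCDF c = cdf ν := by
    ext y
    rw [cdf_eq_real, hν, map_measureReal_apply hm measurableSet_Iic]
    rfl
  rw [hJ]
  exact tendsto_cdf_atTop ν

lemma prodNormalCDF_nonneg (c y : ℝ) : 0 ≤ prodNormalCDF c y := measureReal_nonneg

lemma prodNormalCDF_le_one (c y : ℝ) : prodNormalCDF c y ≤ 1 := measureReal_le_one

/-- Every level in `(0,1)` separates the distribution functions with and without shift. -/
lemma exists_prodNormalCDF_separation {c q : ℝ} (hc : 0 < c) (h0 : 0 < q) (h1 : q < 1) :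
    ∃ y, 0 < y ∧ prodNormalCDF c y < q ∧ q < prodNormalCDF 0 y := by
  -- The average of the two distribution functions takes the value `q` somewhere. Since they differ
  -- there, one lies strictly below `q` and the other strictly above.
  set m : ℝ → ℝ := fun y => (prodNormalCDF c y + prodNormalCDF 0 y) / 2 with hm
  have hcont : Continuous m :=
    ((continuous_prodNormalCDF c).add (continuous_prodNormalCDF 0)).div_const 2
  have hlim : Tendsto m atTop (𝓝 1) := by
    have := ((tendsto_prodNormalCDF c).add (tendsto_prodNormalCDF 0)).div_const 2
    simpa [hm] using this
  have hz : m 0 = 0 := by simp [hm, prodNormalCDF_zero]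
  obtain ⟨Y, hY, hY0⟩ := ((hlim.eventually (lt_mem_nhds h1)).and (eventually_ge_atTop 0)).exists
  obtain ⟨y, hy, hyq⟩ := intermediate_value_Icc hY0 hcont.continuousOn
    (show q ∈ Set.Icc (m 0) (m Y) from ⟨by rw [hz]; exact h0.le, hY.le⟩)
  have hypos : 0 < y := by
    rcases hy.1.lt_or_eq with h | h
    · exact h
    · rw [← h, hz] at hyq; linarith
  have hlt := prodNormalCDF_lt le_rfl hc hypos
  simp only [hm] at hyq
  exact ⟨y, hypos, by linarith, by linarith⟩

end

section

/-! ### Comparison of a law with a law that has a square-integrable density -/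

section Density

variable {Ω : Type*} [MeasurableSpace Ω] {P : Measure Ω} {l : Ω → ℝ}

/-- Cauchy–Schwarz against the constant `1` for the restricted measure. With `f` the density it
yields contiguity; with `f = |l - 1|` and `S` everything it yields total variation. -/
lemma lintegral_ofReal_le_sqrt {f : Ω → ℝ} (hm : Measurable f) (hf : 0 ≤ f)
    (h2 : Integrable (fun ω => f ω ^ 2) P) {S : Set Ω} :
    ∫⁻ ω in S, ENNReal.ofReal (f ω) ∂P
      ≤ ENNReal.ofReal (√(∫ ω, f ω ^ 2 ∂P)) * (P S) ^ (1 / 2 : ℝ) := by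
  have hol := ENNReal.lintegral_mul_le_Lp_mul_Lq (P.restrict S) Real.HolderConjugate.two_two
    (f := fun ω => ENNReal.ofReal (f ω)) (g := fun _ => 1)
    hm.ennreal_ofReal.aemeasurable aemeasurable_const
  simp only [Pi.mul_apply, mul_one, ENNReal.one_rpow, lintegral_const, one_mul,
    Measure.restrict_apply_univ] at hol
  refine hol.trans (mul_le_mul_left ?_ _)
  rw [Real.sqrt_eq_rpow, ← ENNReal.ofReal_rpow_of_nonneg
    (integral_nonneg fun ω => sq_nonneg _) (by norm_num)]
  refine ENNReal.rpow_le_rpow ?_ (by norm_num)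
  rw [ofReal_integral_eq_lintegral_ofReal h2 (ae_of_all _ fun ω => sq_nonneg _)]
  refine (setLIntegral_le_lintegral _ _).trans (lintegral_mono fun ω => le_of_eq ?_)
  rw [ENNReal.ofReal_rpow_of_nonneg (hf ω) (by norm_num), Real.rpow_ofNat]

/-- Contiguity bound. -/
lemma withDensity_le_sqrt (hm : Measurable l) (hl : 0 ≤ l)
    (h2 : Integrable (fun ω => l ω ^ 2) P) {S : Set Ω} (hS : MeasurableSet S) :
    P.withDensity (fun ω => ENNReal.ofReal (l ω)) S
      ≤ ENNReal.ofReal (√(∫ ω, l ω ^ 2 ∂P)) * (P S) ^ (1 / 2 : ℝ) := by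
  rw [withDensity_apply _ hS]
  exact lintegral_ofReal_le_sqrt hm hl h2

lemma integral_abs_sub_one_sq [IsProbabilityMeasure P] (h1 : Integrable l P) (hint : ∫ ω, l ω ∂P = 1)
    (h2 : Integrable (fun ω => l ω ^ 2) P) :
    Integrable (fun ω => |l ω - 1| ^ 2) P ∧
      ∫ ω, |l ω - 1| ^ 2 ∂P = ∫ ω, l ω ^ 2 ∂P - 1 := by
  have heq : (fun ω => |l ω - 1| ^ 2) = fun ω => l ω ^ 2 - 2 * l ω + 1 := by
    ext ω; rw [sq_abs]; ring
  rw [heq]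
  have h3 : Integrable (fun ω => l ω ^ 2 - 2 * l ω) P := h2.sub (h1.const_mul 2)
  refine ⟨h3.add (integrable_const 1), ?_⟩
  rw [integral_add h3 (integrable_const 1), integral_sub h2 (h1.const_mul 2),
    integral_const_mul, hint]
  simp; ring

/-- Total variation bound, for integrals of test functions with values in `[0,1]`. -/
lemma lintegral_withDensity_close [IsProbabilityMeasure P] (hm : Measurable l) (h1 : Integrable l P)
    (hint : ∫ ω, l ω ∂P = 1) (h2 : Integrable (fun ω => l ω ^ 2) P)
    {h : Ω → ℝ≥0∞} (hh : Measurable h) (hle : ∀ ω, h ω ≤ 1) :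
    ∫⁻ ω, h ω ∂P.withDensity (fun ω => ENNReal.ofReal (l ω))
        ≤ ∫⁻ ω, h ω ∂P + ENNReal.ofReal (√(∫ ω, l ω ^ 2 ∂P - 1)) ∧
      ∫⁻ ω, h ω ∂P ≤ ∫⁻ ω, h ω ∂P.withDensity (fun ω => ENNReal.ofReal (l ω))
        + ENNReal.ofReal (√(∫ ω, l ω ^ 2 ∂P - 1)) := by
  obtain ⟨h3, h4⟩ := integral_abs_sub_one_sq h1 hint h2
  have hma : Measurable fun ω => |l ω - 1| := by fun_prop
  -- The chi-square bound: the `L¹` distance of the density from `1` is at most its `L²` distance,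
  -- and `∫ (l - 1)² = ∫ l² - 1` for a probability density.
  have hdist : ∫⁻ ω, ENNReal.ofReal |l ω - 1| ∂P ≤ ENNReal.ofReal (√(∫ ω, l ω ^ 2 ∂P - 1)) := by
    have := lintegral_ofReal_le_sqrt (P := P) (S := Set.univ) hma (fun ω => abs_nonneg _) h3
    rw [h4] at this
    simpa using this
  rw [lintegral_withDensity_eq_lintegral_mul _ hm.ennreal_ofReal hh]
  constructor
  · refine le_trans ?_ (add_le_add_right hdist _)
    rw [← lintegral_add_left hh]
    refine lintegral_mono fun ω => ?_
    calc ENNReal.ofReal (l ω) * h ω ≤ (1 + ENNReal.ofReal |l ω - 1|) * h ω := by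
          gcongr
          rw [← ENNReal.ofReal_one, ← ENNReal.ofReal_add zero_le_one (abs_nonneg _)]
          exact ENNReal.ofReal_le_ofReal (by linarith [le_abs_self (l ω - 1)])
      _ = h ω + ENNReal.ofReal |l ω - 1| * h ω := by ring
      _ ≤ h ω + ENNReal.ofReal |l ω - 1| * 1 := by gcongr; exact hle ω
      _ = _ := by rw [mul_one]
  · refine le_trans ?_ (add_le_add_right hdist _)
    rw [← lintegral_add_left (hm.ennreal_ofReal.mul hh)]
    refine lintegral_mono fun ω => ?_
    calc h ω = 1 * h ω := (one_mul _).symm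
      _ ≤ (ENNReal.ofReal (l ω) + ENNReal.ofReal |l ω - 1|) * h ω := by
          gcongr
          rw [← ENNReal.ofReal_one]
          refine (ENNReal.ofReal_le_ofReal ?_).trans ENNReal.ofReal_add_le
          linarith [neg_abs_le (l ω - 1)]
      _ = ENNReal.ofReal (l ω) * h ω + ENNReal.ofReal |l ω - 1| * h ω := by ring
      _ ≤ ENNReal.ofReal (l ω) * h ω + ENNReal.ofReal |l ω - 1| * 1 := by gcongr; exact hle ω
      _ = _ := by rw [mul_one]; rfl

end Density

/-! ### Shifts of Gaussian vectors -/

/-- The likelihood ratio of `N(m,1)` with respect to `N(0,1)`. -/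
def shiftRatio (m x : ℝ) : ℝ := Real.exp (m * x - m ^ 2 / 2)

lemma measurable_shiftRatio (m : ℝ) : Measurable (shiftRatio m) := by
  unfold shiftRatio; fun_prop

lemma shiftRatio_pos (m x : ℝ) : 0 < shiftRatio m x := Real.exp_pos _

lemma gaussianReal_eq_withDensity (m : ℝ) :
    gaussianReal m 1 = stdNormal.withDensity fun x => ENNReal.ofReal (shiftRatio m x) := by
  rw [gaussianReal_of_var_ne_zero _ one_ne_zero, stdNormal,
    gaussianReal_of_var_ne_zero _ one_ne_zero,
    ← withDensity_mul _ (measurable_gaussianPDF _ _) (measurable_shiftRatio m).ennreal_ofReal]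
  congr 1
  ext x
  simp only [Pi.mul_apply, gaussianPDF]
  rw [← ENNReal.ofReal_mul (gaussianPDFReal_nonneg _ _ _)]
  congr 1
  simp only [gaussianPDFReal, shiftRatio, mul_assoc, ← Real.exp_add]
  congr 2
  simp only [NNReal.coe_one]
  ring

lemma integrable_shiftRatio (m : ℝ) : Integrable (shiftRatio m) stdNormal := by
  have := (integrable_exp_mul_gaussianReal (μ := 0) (v := 1) m).mul_const (Real.exp (-(m ^ 2 / 2)))
  refine this.congr (ae_of_all _ fun x => ?_)
  simp only [shiftRatio, ← Real.exp_add]; ring_nf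

lemma integral_shiftRatio (m : ℝ) : ∫ x, shiftRatio m x ∂stdNormal = 1 := by
  have h : (fun x => shiftRatio m x) = fun x => Real.exp (m * x) * Real.exp (-(m ^ 2 / 2)) := by
    ext x; simp only [shiftRatio, ← Real.exp_add]; ring_nf
  have := congrFun (mgf_fun_id_gaussianReal (μ := 0) (v := 1)) m
  simp only [mgf, NNReal.coe_one, zero_mul, zero_add, one_mul] at this
  rw [h, integral_mul_const, this, ← Real.exp_add]
  simp

/-- Completing the square: the square is again a likelihood ratio, for the doubled shift, up to a
constant. This reads off the second moment `exp(m²)` without a further Gaussian integral. -/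
lemma shiftRatio_sq (m x : ℝ) : shiftRatio m x ^ 2 = Real.exp (m ^ 2) * shiftRatio (2 * m) x := by
  simp only [shiftRatio, ← Real.exp_add, ← Real.exp_nat_mul]; push_cast; ring_nf

variable {ι : Type*} [Fintype ι]

/-- The likelihood ratio of a vector of independent `N(m,1)` variables. -/
def shiftRatioPi (m : ℝ) (w : ι → ℝ) : ℝ := ∏ i, shiftRatio m (w i)

lemma measurable_shiftRatioPi (m : ℝ) : Measurable (shiftRatioPi (ι := ι) m) :=
  Finset.measurable_prod _ fun i _ => (measurable_shiftRatio m).comp (measurable_pi_apply i)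

lemma shiftRatioPi_nonneg (m : ℝ) (w : ι → ℝ) : 0 ≤ shiftRatioPi m w :=
  Finset.prod_nonneg fun _ _ => (shiftRatio_pos _ _).le

lemma integrable_shiftRatioPi (m : ℝ) :
    Integrable (shiftRatioPi (ι := ι) m) (Measure.pi fun _ => stdNormal) :=
  Integrable.fintype_prod fun _ => integrable_shiftRatio m

lemma integral_shiftRatioPi (m : ℝ) :
    ∫ w, shiftRatioPi (ι := ι) m w ∂(Measure.pi fun _ => stdNormal) = 1 := by
  simp only [shiftRatioPi]
  rw [integral_fintype_prod_eq_prod (fun _ : ι => shiftRatio m)]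
  simp [integral_shiftRatio]

lemma shiftRatioPi_sq (m : ℝ) (w : ι → ℝ) :
    shiftRatioPi m w ^ 2 = Real.exp (m ^ 2) ^ Fintype.card ι * shiftRatioPi (2 * m) w := by
  simp only [shiftRatioPi, ← Finset.prod_pow, shiftRatio_sq, Finset.prod_mul_distrib,
    Finset.prod_const, Finset.card_univ]

lemma pi_gaussianReal_eq_withDensity (m : ℝ) :
    (Measure.pi fun _ : ι => gaussianReal m 1)
      = (Measure.pi fun _ : ι => stdNormal).withDensity
        fun w => ENNReal.ofReal (shiftRatioPi m w) := by
  refine Measure.pi_eq fun s hs => ?_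
  rw [withDensity_apply _ (MeasurableSet.univ_pi hs), Measure.restrict_pi_pi]
  have hint : ∀ i, Integrable (shiftRatio m) (stdNormal.restrict (s i)) :=
    fun i => (integrable_shiftRatio m).restrict
  rw [← ofReal_integral_eq_lintegral_ofReal (f := shiftRatioPi m)
    (Integrable.fintype_prod hint) (ae_of_all _ fun w => shiftRatioPi_nonneg m w)]
  simp only [shiftRatioPi]
  rw [integral_fintype_prod_eq_prod (fun _ : ι => shiftRatio m),
    ENNReal.ofReal_prod_of_nonneg fun i _ => integral_nonneg fun x => (shiftRatio_pos m x).le]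
  refine Finset.prod_congr rfl fun i _ => ?_
  rw [gaussianReal_eq_withDensity, withDensity_apply _ (hs i),
    ofReal_integral_eq_lintegral_ofReal (hint i) (ae_of_all _ fun x => (shiftRatio_pos m x).le)]

section Product

variable {A : Type*} [MeasurableSpace A] (R : Measure A)

lemma prod_pi_gaussianReal_eq_withDensity (m : ℝ) :
    R.prod (Measure.pi fun _ : ι => gaussianReal m 1)
      = (R.prod (Measure.pi fun _ : ι => stdNormal)).withDensity
        fun z => ENNReal.ofReal (shiftRatioPi m z.2) := by
  rw [pi_gaussianReal_eq_withDensity,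
    prod_withDensity_right (measurable_shiftRatioPi m).ennreal_ofReal]

lemma integrable_shiftRatioPi_sq [IsProbabilityMeasure R] (m : ℝ) :
    Integrable (fun z : A × (ι → ℝ) => shiftRatioPi m z.2 ^ 2)
      (R.prod (Measure.pi fun _ : ι => stdNormal)) := by
  simp only [shiftRatioPi_sq]
  exact ((integrable_shiftRatioPi (2 * m)).const_mul _).comp_snd R

lemma integral_shiftRatioPi_sq [IsProbabilityMeasure R] (m : ℝ) :
    ∫ z : A × (ι → ℝ), shiftRatioPi m z.2 ^ 2 ∂(R.prod (Measure.pi fun _ : ι => stdNormal))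
      = Real.exp (m ^ 2) ^ Fintype.card ι := by
  rw [integral_fun_snd fun w => shiftRatioPi m w ^ 2]
  simp only [shiftRatioPi_sq]
  rw [integral_const_mul, integral_shiftRatioPi]
  simp

lemma prod_pi_gaussianReal_le_sqrt [IsProbabilityMeasure R] (m : ℝ) {S : Set (A × (ι → ℝ))} (hS : MeasurableSet S) :
    R.prod (Measure.pi fun _ : ι => gaussianReal m 1) S
      ≤ ENNReal.ofReal (√(Real.exp (m ^ 2) ^ Fintype.card ι))
        * (R.prod (Measure.pi fun _ : ι => stdNormal) S) ^ (1 / 2 : ℝ) := by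
  rw [prod_pi_gaussianReal_eq_withDensity, ← integral_shiftRatioPi_sq R m]
  exact withDensity_le_sqrt ((measurable_shiftRatioPi m).comp measurable_snd)
    (fun z => shiftRatioPi_nonneg m z.2) (integrable_shiftRatioPi_sq R m) hS

lemma lintegral_prod_pi_gaussianReal_close [IsProbabilityMeasure R] (m : ℝ) {h : A × (ι → ℝ) → ℝ≥0∞} (hh : Measurable h)
    (hle : ∀ z, h z ≤ 1) :
    ∫⁻ z, h z ∂(R.prod (Measure.pi fun _ : ι => gaussianReal m 1))
        ≤ ∫⁻ z, h z ∂(R.prod (Measure.pi fun _ : ι => stdNormal))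
          + ENNReal.ofReal (√(Real.exp (m ^ 2) ^ Fintype.card ι - 1)) ∧
      ∫⁻ z, h z ∂(R.prod (Measure.pi fun _ : ι => stdNormal))
        ≤ ∫⁻ z, h z ∂(R.prod (Measure.pi fun _ : ι => gaussianReal m 1))
          + ENNReal.ofReal (√(Real.exp (m ^ 2) ^ Fintype.card ι - 1)) := by
  rw [prod_pi_gaussianReal_eq_withDensity, ← integral_shiftRatioPi_sq R m]
  refine lintegral_withDensity_close ((measurable_shiftRatioPi m).comp measurable_snd)
    ((integrable_shiftRatioPi m).comp_snd R) ?_ (integrable_shiftRatioPi_sq R m) hh hle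
  exact (integral_fun_snd fun w => shiftRatioPi m w).trans (by rw [integral_shiftRatioPi]; simp)

end Product

end

section

/-! ### Independent and identically distributed families -/

section IID

variable {ι X : Type*} [MeasurableSpace X] {μ : Measure X} [IsProbabilityMeasure μ]

lemma measurePreserving_infinitePi_eval (i : ι) :
    MeasurePreserving (fun w : ι → X => w i) (Measure.infinitePi fun _ => μ) μ :=
  measurePreserving_eval_infinitePi (fun _ => μ) i

lemma integral_infinitePi_eval {F : X → ℝ} (hF : Measurable F) (i : ι) :
    ∫ w, F (w i) ∂(Measure.infinitePi fun _ : ι => μ) = ∫ x, F x ∂μ := by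
  have h := integral_map (μ := Measure.infinitePi fun _ : ι => μ) (f := F)
    (measurable_pi_apply i).aemeasurable hF.aestronglyMeasurable
  rw [← h, (measurePreserving_infinitePi_eval (μ := μ) i).map_eq]

lemma memLp_infinitePi_eval {F : X → ℝ} {p : ℝ≥0∞} (hF : MemLp F p μ) (i : ι) :
    MemLp (fun w => F (w i)) p (Measure.infinitePi fun _ : ι => μ) :=
  hF.comp_measurePreserving (measurePreserving_infinitePi_eval i)

lemma indepFun_infinitePi_eval {Y Z : Type*} [MeasurableSpace Y] [MeasurableSpace Z]
    {F : X → Y} {G : X → Z} (hF : Measurable F) (hG : Measurable G) {i j : ι} (hij : i ≠ j) :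
    IndepFun (fun w => F (w i)) (fun w => G (w j)) (Measure.infinitePi fun _ : ι => μ) :=
  ((iIndepFun_infinitePi (P := fun _ : ι => μ) (X := fun _ => id)
    fun _ => measurable_id).indepFun hij).comp hF hG

lemma integral_infinitePi_mul [DecidableEq ι] {F G : X → ℝ} (hF : Measurable F) (hG : Measurable G)
    (i j : ι) :
    ∫ w, F (w i) * G (w j) ∂(Measure.infinitePi fun _ : ι => μ)
      = if i = j then ∫ x, F x * G x ∂μ else (∫ x, F x ∂μ) * ∫ x, G x ∂μ := by
  split_ifs with h
  · subst h
    exact integral_infinitePi_eval (hF.mul hG) i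
  · rw [(indepFun_infinitePi_eval hF hG h).integral_fun_mul_eq_mul_integral
      (hF.comp (measurable_pi_apply i)).aestronglyMeasurable
      (hG.comp (measurable_pi_apply j)).aestronglyMeasurable,
      integral_infinitePi_eval hF, integral_infinitePi_eval hG]

/-- The marks of finitely many members of an i.i.d. family. -/
lemma map_infinitePi_injective {Y : Type*} [MeasurableSpace Y] {n : ℕ} {s : Fin n → ι}
    (hs : s.Injective) {φ : X → Y} (hφ : Measurable φ) :
    (Measure.infinitePi fun _ : ι => μ).map (fun w i => φ (w (s i)))
      = Measure.pi fun _ : Fin n => μ.map φ := by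
  have hp : IsProbabilityMeasure (μ.map φ) := Measure.isProbabilityMeasure_map hφ.aemeasurable
  have h1 := Measure.map_infinitePi_infinitePi_of_inj (P := fun _ : ι => μ) hs
  have h2 := Measure.infinitePi_map_pi (fun _ : Fin n => μ) (f := fun _ => φ) fun _ => hφ
  rw [← Measure.infinitePi_eq_pi, ← h2, ← h1, Measure.map_map (by fun_prop) (by fun_prop)]
  rfl

end IID

/-! ### Marks -/

/-- The uniform law on `Fin K`. -/
def uniformLabel (K : ℕ) : Measure (Fin K) := (K : ℝ≥0∞)⁻¹ • Measure.count

instance (K : ℕ) [NeZero K] : IsProbabilityMeasure (uniformLabel K) :=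
  ⟨by
    simp only [uniformLabel, Measure.smul_apply, Measure.count_univ, ENat.card_eq_coe_fintype_card,
      Fintype.card_fin, smul_eq_mul]
    exact ENNReal.inv_mul_cancel (by simp [NeZero.ne K]) (by simp)⟩

lemma integral_uniformLabel {K : ℕ} (f : Fin K → ℝ) :
    ∫ k, f k ∂(uniformLabel K) = (K : ℝ)⁻¹ * ∑ k, f k := by
  rw [uniformLabel, integral_smul_measure, integral_count]
  simp

/-- The law of a sequence of independent standard normal variables. -/
abbrev normalSequence : Measure (ℕ → ℝ) := Measure.infinitePi fun _ => stdNormal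

variable (K : ℕ) [NeZero K]

/-- Common effects must be uniform on `[0,1]`, so the label and the whole normal sequence are
encoded in one uniform variable. A sequence is needed because the spectral condition asks for
infinite orthonormal systems. -/
lemma exists_rowMark : ∃ τ : I → Fin K × (ℕ → ℝ), Measurable τ ∧
    (volume : Measure I).map τ = (uniformLabel K).prod normalSequence :=
  Measure.exists_measurable_map_eq _

/-- A label and an independent standard normal sequence, as a function of a uniform variable. -/
def rowMark : I → Fin K × (ℕ → ℝ) := (exists_rowMark K).choose

lemma measurePreserving_rowMark :
    MeasurePreserving (rowMark K) volume ((uniformLabel K).prod normalSequence) :=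
  ⟨(exists_rowMark K).choose_spec.1, (exists_rowMark K).choose_spec.2⟩

lemma exists_timeMark : ∃ τ : I → ℕ → ℝ, Measurable τ ∧
    (volume : Measure I).map τ = normalSequence :=
  Measure.exists_measurable_map_eq _

/-- A standard normal sequence, as a function of a uniform variable. -/
def timeMark : I → ℕ → ℝ := exists_timeMark.choose

lemma measurePreserving_timeMark : MeasurePreserving timeMark volume normalSequence :=
  ⟨exists_timeMark.choose_spec.1, exists_timeMark.choose_spec.2⟩

/-- The `l`-th normal variable attached to a period. -/
def timeNormal (l : ℕ) (s : I) : ℝ := timeMark s l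

lemma measurePreserving_timeNormal (l : ℕ) : MeasurePreserving (timeNormal l) volume stdNormal :=
  (measurePreserving_infinitePi_eval l).comp measurePreserving_timeMark

lemma measurable_timeNormal (l : ℕ) : Measurable (timeNormal l) :=
  (measurePreserving_timeNormal l).measurable

lemma integral_stdNormal_mul : ∫ x, x * x ∂stdNormal = 1 := by
  have := variance_fun_id_gaussianReal (μ := 0) (v := 1)
  rw [variance_eq_sub (X := fun x => x) (memLp_id_gaussianReal 2)] at this
  simpa [integral_id_gaussianReal, pow_two] using this

lemma integral_normalSequence_mul (i j : ℕ) :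
    ∫ w, w i * w j ∂normalSequence = if i = j then 1 else 0 := by
  rw [integral_infinitePi_mul (F := fun x => x) (G := fun x => x) measurable_id measurable_id]
  simp [integral_stdNormal_mul, integral_id_gaussianReal]

lemma integral_timeNormal (l : ℕ) : ∫ s, timeNormal l s = 0 := by
  have := (measurePreserving_timeNormal l).map_eq
  have h2 : ∫ x, x ∂((volume : Measure I).map (timeNormal l)) = ∫ s, timeNormal l s :=
    integral_map (measurable_timeNormal l).aemeasurable measurable_id.aestronglyMeasurable
  rw [← h2, this, integral_id_gaussianReal]

lemma integral_timeNormal_mul (l l' : ℕ) :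
    ∫ s, timeNormal l s * timeNormal l' s = if l = l' then 1 else 0 := by
  rw [← integral_normalSequence_mul, ← measurePreserving_timeMark.map_eq,
    integral_map measurePreserving_timeMark.measurable.aemeasurable
      (by fun_prop)]
  rfl

lemma memLp_timeNormal (l : ℕ) {p : ℝ≥0∞} (hp : p ≠ ∞) : MemLp (timeNormal l) p volume :=
  (memLp_id_gaussianReal' p hp).comp_measurePreserving (measurePreserving_timeNormal l)

lemma integrable_timeNormal (l : ℕ) : Integrable (timeNormal l) :=
  memLp_one_iff_integrable.1 (memLp_timeNormal l ENNReal.one_ne_top)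

/-- The label of a cluster. -/
def label (x : I) : Fin K := (rowMark K x).1

/-- The normal variable attached to a cluster that enters the regression error. -/
def rowNormal (x : I) : ℝ := (rowMark K x).2 0

lemma measurable_label : Measurable (label K) :=
  measurable_fst.comp (measurePreserving_rowMark K).measurable

lemma measurable_rowNormal : Measurable (rowNormal K) :=
  (measurable_pi_apply 0).comp (measurable_snd.comp (measurePreserving_rowMark K).measurable)

lemma map_label_rowNormal :
    (volume : Measure I).map (fun x => (label K x, rowNormal K x))
      = (uniformLabel K).prod stdNormal := by
  have h := ((MeasurePreserving.id (uniformLabel K)).prod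
    (measurePreserving_infinitePi_eval (μ := stdNormal) 0)).comp (measurePreserving_rowMark K)
  exact h.map_eq

variable {K}

/-- The factor of `rowScore` that depends on the label. -/
def labelFactor : Fin K ⊕ ℕ → Fin K → ℝ
  | .inl k => fun k' => if k' = k then √(K : ℝ) else 0
  | .inr _ => fun _ => 1

/-- The index of the normal factor of `rowScore`. -/
def normalIndex : Fin K ⊕ ℕ → ℕ
  | .inl _ => 0
  | .inr l => l + 1

/-- An orthonormal system of centred functions of a row effect. -/
def rowScore (j : Fin K ⊕ ℕ) (x : I) : ℝ :=
  labelFactor j (label K x) * (rowMark K x).2 (normalIndex j)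

lemma measurable_rowScore (j : Fin K ⊕ ℕ) : Measurable (rowScore j) :=
  ((measurable_of_countable _).comp (measurable_label K)).mul ((measurable_pi_apply _).comp
    (measurable_snd.comp (measurePreserving_rowMark K).measurable))

lemma rowScore_inl (k : Fin K) (x : I) :
    rowScore (.inl k) x = √(K : ℝ) * if label K x = k then rowNormal K x else 0 := by
  simp only [rowScore, labelFactor, normalIndex, rowNormal]
  split_ifs <;> simp

lemma integral_rowScore (j : Fin K ⊕ ℕ) : ∫ x, rowScore j x = 0 := by
  have hm := measurePreserving_rowMark K
  have h : ∫ z, labelFactor j z.1 * z.2 (normalIndex j)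
      ∂((volume : Measure I).map (rowMark K)) = ∫ x, rowScore j x :=
    integral_map hm.measurable.aemeasurable (by
      refine Measurable.aestronglyMeasurable (Measurable.mul ?_ (by fun_prop))
      exact (measurable_of_countable (labelFactor j)).comp measurable_fst)
  rw [← h, hm.map_eq, integral_prod_mul (labelFactor j) fun w : ℕ → ℝ => w (normalIndex j),
    integral_infinitePi_eval (F := fun x => x) measurable_id, integral_id_gaussianReal, mul_zero]

/-- Label and normal sequence are independent, so the integral factorizes. Distinct normal indices
give zero; two `inl` members share the normal of index `0` but have disjoint label events, each of
probability `1/K`, which the factor `√K` normalizes. -/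
lemma integral_rowScore_mul (j j' : Fin K ⊕ ℕ) :
    ∫ x, rowScore j x * rowScore j' x = if j = j' then 1 else 0 := by
  have hm := measurePreserving_rowMark K
  have h : ∫ z, (labelFactor j z.1 * labelFactor j' z.1)
        * (z.2 (normalIndex j) * z.2 (normalIndex j'))
      ∂((volume : Measure I).map (rowMark K)) = ∫ x, rowScore j x * rowScore j' x := by
    rw [integral_map hm.measurable.aemeasurable (by
      refine Measurable.aestronglyMeasurable (Measurable.mul ?_ (by fun_prop))
      exact (measurable_of_countable fun k => labelFactor j k * labelFactor j' k).comp
        measurable_fst)]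
    refine integral_congr_ae (ae_of_all _ fun x => ?_)
    simp only [rowScore, label]; ring
  rw [← h, hm.map_eq, integral_prod_mul (fun k => labelFactor j k * labelFactor j' k)
    fun w : ℕ → ℝ => w (normalIndex j) * w (normalIndex j'), integral_normalSequence_mul,
    integral_uniformLabel]
  have hK : (K : ℝ) ≠ 0 := by simp [NeZero.ne K]
  have hsq : √(K : ℝ) * √(K : ℝ) = K := Real.mul_self_sqrt (by positivity)
  rcases j with k | l <;> rcases j' with k' | l'
  · by_cases hk : k = k'
    · subst hk
      simp [labelFactor, normalIndex, hsq, hK]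
    · simp [labelFactor, normalIndex, hk, Ne.symm hk]
  · simp [normalIndex]
  · simp [normalIndex]
  · simp [labelFactor, normalIndex, hK]

/-- One bound for the entire system, so that the moments of the row functions are bounded uniformly
over it. -/
lemma abs_labelFactor_le (j : Fin K ⊕ ℕ) (k : Fin K) : |labelFactor j k| ≤ √(K : ℝ) := by
  have h1 : 1 ≤ √(K : ℝ) := Real.one_le_sqrt.2 (by exact_mod_cast NeZero.one_le)
  rcases j with k' | l
  · simp only [labelFactor]
    split_ifs <;> simp [abs_of_nonneg]
  · simpa [labelFactor] using h1

lemma measurePreserving_rowMark_normal (l : ℕ) :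
    MeasurePreserving (fun x => (rowMark K x).2 l) volume stdNormal :=
  ((measurePreserving_infinitePi_eval l).comp measurePreserving_snd).comp
    (measurePreserving_rowMark K)

lemma memLp_rowScore (j : Fin K ⊕ ℕ) {p : ℝ≥0∞} (hp : p ≠ ∞) : MemLp (rowScore j) p volume := by
  have h : MemLp (fun x => (rowMark K x).2 (normalIndex j)) p volume :=
    (memLp_id_gaussianReal' p hp).comp_measurePreserving (measurePreserving_rowMark_normal _)
  refine (h.const_mul √(K : ℝ)).mono (measurable_rowScore j).aestronglyMeasurable
    (ae_of_all _ fun x => ?_)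
  rw [rowScore, norm_mul, norm_mul, Real.norm_eq_abs, Real.norm_eq_abs √(K : ℝ),
    abs_of_nonneg (Real.sqrt_nonneg _)]
  exact mul_le_mul_of_nonneg_right (abs_labelFactor_le _ _) (norm_nonneg _)

/-- The absolute moments of the row system, bounded uniformly over the system. -/
lemma lintegral_rowScore_pow_le (j : Fin K ⊕ ℕ) {p : ℝ} (hp : 0 ≤ p) :
    ∫⁻ x, ‖rowScore j x‖ₑ ^ p
      ≤ ENNReal.ofReal √(K : ℝ) ^ p * ∫⁻ x, ‖x‖ₑ ^ p ∂stdNormal := by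
  rw [← (measurePreserving_rowMark_normal (K := K) (normalIndex j)).lintegral_comp
    (by fun_prop), ← lintegral_const_mul' _ _ (by finiteness)]
  refine lintegral_mono fun x => ?_
  rw [rowScore, enorm_mul, ENNReal.mul_rpow_of_nonneg _ _ hp]
  gcongr
  rw [← ofReal_norm]
  exact ENNReal.ofReal_le_ofReal (abs_labelFactor_le _ _)

lemma lintegral_timeNormal_pow (l : ℕ) (p : ℝ) :
    ∫⁻ x, ‖timeNormal l x‖ₑ ^ p = ∫⁻ x, ‖x‖ₑ ^ p ∂stdNormal :=
  (measurePreserving_timeNormal l).lintegral_comp (f := fun x => ‖x‖ₑ ^ p) (by fun_prop)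

lemma lintegral_stdNormal_pow_lt_top {p : ℝ} (hp : 0 < p) :
    ∫⁻ x, ‖x‖ₑ ^ p ∂stdNormal < ∞ := by
  have h := (memLp_id_gaussianReal' (μ := 0) (v := 1) (ENNReal.ofReal p) (by simp)).2
  have h2 := lintegral_rpow_enorm_lt_top_of_eLpNorm_lt_top (by simp [hp]) (by simp) h
  simpa [ENNReal.toReal_ofReal hp.le] using h2

end

section

/-! ### A one-parameter family of data-generating processes -/

variable {K M : ℕ} [NeZero K] [NeZero M]

/-- The error of the regression: a product of a row effect and a shifted time effect. -/
def shiftError (K : ℕ) [NeZero K] (c : ℝ) (T : ℕ) (x s : I) : ℝ :=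
  rowNormal K x * (timeNormal 0 s + c / √(T : ℝ))

/-- The first observation of a cell selects the regressor given by the label of the cluster, and
the other observations vanish. The time effect is shifted by `c / √T`. -/
def shiftDGP (M : ℕ) [NeZero M] (𝒮 : Design K) (c : ℝ) : DGP K M where
  rowLaw := ⟨Measure.infinitePi fun _ => volume, inferInstance⟩
  timeLaw := ⟨Measure.infinitePi fun _ => volume, inferInstance⟩
  β := 𝒮.β₀
  f _ T z :=
    (fun m => ∑ k, (if m = 0 ∧ label K z.1 = k then 1 else 0) * 𝒮.β₀ k
        + if m = 0 then shiftError K c T z.1 z.2.1 else 0,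
      fun m k => if m = 0 ∧ label K z.1 = k then 1 else 0,
      fun m => if m = 0 then shiftError K c T z.1 z.2.1 else 0)
  -- The interaction is the single product of the indicator-weighted cluster normal and the first
  -- time normal. The coefficient undoes the factor `√K` that gives `φ_{0,k}` unit norm; all later
  -- members only complete the systems.
  coef _ _ l l' _ := if l = 0 ∧ l' = 0 then (√(K : ℝ))⁻¹ else 0
  φ _ _ l k := rowScore (match l with | 0 => .inl k | l + 1 => .inr l)
  ψ _ _ l _ := timeNormal l

/-- The index in `rowScore` of a member of the system `φ`. -/
def systemIndex : ℕ × Fin K → Fin K ⊕ ℕ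
  | (0, k) => .inl k
  | (l + 1, _) => .inr l

lemma systemIndex_eq_iff (k : Fin K) (l l' : ℕ) :
    systemIndex (l, k) = systemIndex (l', k) ↔ l = l' := by
  rcases l with _ | l <;> rcases l' with _ | l' <;> simp [systemIndex]

variable (𝒮 : Design K) (c : ℝ)

lemma shiftDGP_φ (N T l : ℕ) (k : Fin K) :
    (shiftDGP M 𝒮 c).φ N T l k = rowScore (systemIndex (l, k)) := by
  rcases l with _ | l <;> rfl

lemma shiftDGP_rowMeasure :
    (shiftDGP M 𝒮 c).rowMeasure = Measure.infinitePi fun _ => volume := rfl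

lemma shiftDGP_timeMeasure :
    (shiftDGP M 𝒮 c).timeMeasure = Measure.infinitePi fun _ => volume := rfl

/-- The part of the score of coordinate `k` that depends on the row effect. -/
def rowPart (k : Fin K) (x : I) : ℝ := (√(K : ℝ))⁻¹ * rowScore (.inl k) x

lemma rowPart_eq (k : Fin K) (x : I) :
    rowPart k x = if label K x = k then rowNormal K x else 0 := by
  have : √(K : ℝ) ≠ 0 := by simp [NeZero.ne K]
  rw [rowPart, rowScore_inl, inv_mul_cancel_left₀ this]

lemma measurable_rowPart (k : Fin K) : Measurable (rowPart k) :=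
  (measurable_rowScore _).const_mul _

lemma integral_rowPart (k : Fin K) : ∫ x, rowPart k x = 0 := by
  simp only [rowPart]
  rw [integral_const_mul, integral_rowScore, mul_zero]

lemma integral_rowPart_mul (k l : Fin K) :
    ∫ x, rowPart k x * rowPart l x = if k = l then (K : ℝ)⁻¹ else 0 := by
  have : ∀ x, rowPart k x * rowPart l x
      = (√(K : ℝ) * √(K : ℝ))⁻¹ * (rowScore (.inl k) x * rowScore (.inl l) x) := by
    intro x; simp only [rowPart, mul_inv]; ring
  simp only [this]
  rw [integral_const_mul, integral_rowScore_mul, Real.mul_self_sqrt (by positivity)]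
  simp

lemma score_shiftDGP (N T : ℕ) (z : I × I × I) (k : Fin K) :
    (shiftDGP M 𝒮 c).score N T z k
      = rowPart k z.1 * (timeNormal 0 z.2.1 + c / √(T : ℝ)) := by
  rw [DGP.score, Finset.sum_eq_single 0]
  · simp only [shiftDGP, rowPart_eq, shiftError]
    split_ifs <;> simp_all
  · intro m _ hm; simp [shiftDGP, hm]
  · simp

lemma integral_timeNormal_add (l : ℕ) (r : ℝ) : ∫ s : I, (timeNormal l s + r) = r := by
  rw [integral_add (integrable_timeNormal l) (integrable_const r), integral_timeNormal]
  simp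

lemma meanScore_shiftDGP (N T : ℕ) (k : Fin K) : (shiftDGP M 𝒮 c).meanScore N T k = 0 := by
  simp only [DGP.meanScore, score_shiftDGP]
  have := integral_prod_mul (μ := (volume : Measure I)) (ν := (volume : Measure (I × I)))
    (rowPart k) (fun q => timeNormal 0 q.1 + c / √(T : ℝ))
  rw [Measure.volume_eq_prod, this, integral_rowPart, zero_mul]

lemma integral_timeNormal_add_fst (r : ℝ) : ∫ q : I × I, (timeNormal 0 q.1 + r) = r := by
  rw [Measure.volume_eq_prod, integral_fun_fst fun s => timeNormal 0 s + r,
    integral_timeNormal_add]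
  simp

/-- Averaging over the period leaves only the mean `c/√T` of the shifted time effect. The order
`T^{-1/2}` is exactly what makes `T σ_a²` a nonzero constant when `c ≠ 0`. -/
lemma aFun_shiftDGP (N T : ℕ) (x : I) (k : Fin K) :
    (shiftDGP M 𝒮 c).aFun N T x k = c / √(T : ℝ) * rowPart k x := by
  simp only [DGP.aFun, score_shiftDGP, meanScore_shiftDGP]
  rw [integral_const_mul, integral_timeNormal_add_fst]
  ring

lemma integral_score_time (N T : ℕ) (s : I) (k : Fin K) :
    ∫ q : I × I, (shiftDGP M 𝒮 c).score N T (q.1, s, q.2) k = 0 := by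
  simp only [score_shiftDGP]
  rw [integral_mul_const, Measure.volume_eq_prod, integral_fun_fst (rowPart k), integral_rowPart]
  simp

lemma dFun_shiftDGP (N T : ℕ) (s : I) (k : Fin K) : (shiftDGP M 𝒮 c).dFun N T s k = 0 := by
  rw [DGP.dFun, integral_score_time, meanScore_shiftDGP, sub_zero]

lemma vFun_shiftDGP (N T : ℕ) (x s : I) (k : Fin K) :
    (shiftDGP M 𝒮 c).vFun N T x s k = rowPart k x * timeNormal 0 s := by
  rw [DGP.vFun, integral_score_time, meanScore_shiftDGP]
  simp only [score_shiftDGP]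
  rw [integral_const_mul, integral_const_mul, integral_timeNormal_add_fst]
  simp; ring

lemma eFun_shiftDGP (N T : ℕ) (z : I × I × I) (k : Fin K) :
    (shiftDGP M 𝒮 c).eFun N T z k = 0 := by
  simp [DGP.eFun, score_shiftDGP]

lemma sum_sum_diagonal {n : ℕ} (r : ℝ) :
    ∑ i : Fin n, ∑ j : Fin n, (if i = j then r else 0) = n * r := by
  simp

lemma site_fin_injective (N : ℕ) : Function.Injective fun i : Fin N => 𝒮.site i :=
  𝒮.site_injective.comp Fin.val_injective

lemma integral_row_mul {F G : I → ℝ} (hF : Measurable F) (hG : Measurable G)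
    (hF0 : ∫ x, F x = 0) {N : ℕ} (i j : Fin N) :
    ∫ w, F (w (𝒮.site i)) * G (w (𝒮.site j)) ∂(shiftDGP M 𝒮 c).rowMeasure
      = if i = j then ∫ x, F x * G x else 0 := by
  rw [shiftDGP_rowMeasure, integral_infinitePi_mul hF hG, hF0, zero_mul]
  congr 1
  exact propext (site_fin_injective 𝒮 N).eq_iff

lemma integral_time_mul {F G : I → ℝ} (hF : Measurable F) (hG : Measurable G)
    (hF0 : ∫ x, F x = 0) {T : ℕ} (i j : Fin T) :
    ∫ w, F (w (i : ℤ)) * G (w (j : ℤ)) ∂(shiftDGP M 𝒮 c).timeMeasure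
      = if i = j then ∫ x, F x * G x else 0 := by
  rw [shiftDGP_timeMeasure, integral_infinitePi_mul hF hG, hF0, zero_mul]
  congr 1
  simp [Fin.ext_iff]

lemma varA_shiftDGP {N : ℕ} (hN : 0 < N) (T : ℕ) (k l : Fin K) :
    (shiftDGP M 𝒮 c).varA 𝒮 N T k l = if k = l then c ^ 2 / (T * K) else 0 := by
  have h : ∀ i j : Fin N, ∫ w, (shiftDGP M 𝒮 c).aFun N T (w (𝒮.site i)) k
      * (shiftDGP M 𝒮 c).aFun N T (w (𝒮.site j)) l ∂(shiftDGP M 𝒮 c).rowMeasure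
      = if i = j then (c / √(T : ℝ)) ^ 2 * (if k = l then (K : ℝ)⁻¹ else 0) else 0 := by
    intro i j
    rw [← integral_rowPart_mul, ← integral_const_mul]
    simp only [aFun_shiftDGP]
    rw [integral_row_mul 𝒮 c ((measurable_rowPart k).const_mul _)
      ((measurable_rowPart l).const_mul _) (by rw [integral_const_mul, integral_rowPart, mul_zero])]
    congr 1
    refine integral_congr_ae (ae_of_all _ fun x => ?_)
    simp only; ring
  have hN' : (N : ℝ) ≠ 0 := by exact_mod_cast hN.ne'
  rw [DGP.varA]
  simp only [h]
  rw [sum_sum_diagonal, div_pow, Real.sq_sqrt (by positivity)]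
  split_ifs
  · field_simp
  · simp

lemma varD_shiftDGP (N T : ℕ) (k l : Fin K) : (shiftDGP M 𝒮 c).varD N T k l = 0 := by
  simp [DGP.varD, dFun_shiftDGP]

lemma varE_shiftDGP (N T : ℕ) (k l : Fin K) : (shiftDGP M 𝒮 c).varE 𝒮 N T k l = 0 := by
  simp [DGP.varE, eFun_shiftDGP]

lemma varV_shiftDGP {N T : ℕ} (hN : 0 < N) (hT : 0 < T) (k l : Fin K) :
    (shiftDGP M 𝒮 c).varV 𝒮 N T k l = if k = l then (K : ℝ)⁻¹ else 0 := by
  have h : ∀ (i i' : Fin N) (t t' : Fin T),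
      ∫ ω, (shiftDGP M 𝒮 c).vFun N T (DGP.cell 𝒮 ω i t).1 (DGP.cell 𝒮 ω i t).2.1 k
        * (shiftDGP M 𝒮 c).vFun N T (DGP.cell 𝒮 ω i' t').1 (DGP.cell 𝒮 ω i' t').2.1 l
        ∂(shiftDGP M 𝒮 c).latentLaw N T
      = (if i = i' then (if k = l then (K : ℝ)⁻¹ else 0) else 0) * if t = t' then 1 else 0 := by
    intro i i' t t'
    simp only [vFun_shiftDGP, DGP.cell]
    rw [← integral_rowPart_mul, ← integral_row_mul (M := M) 𝒮 c (measurable_rowPart k)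
      (measurable_rowPart l) (integral_rowPart k)]
    have h2 := integral_time_mul (M := M) 𝒮 c (measurable_timeNormal 0)
      (measurable_timeNormal 0) (integral_timeNormal 0) t t'
    simp only [integral_timeNormal_mul, if_true] at h2
    have h3 := integral_fun_fst (μ := (shiftDGP M 𝒮 c).timeMeasure)
      (ν := Measure.pi fun _ : Fin N => Measure.pi fun _ : Fin T => (volume : Measure I))
      (fun w => timeNormal 0 (w (t : ℤ)) * timeNormal 0 (w (t' : ℤ)))
    rw [probReal_univ, one_smul] at h3
    rw [← h2, ← h3, ← integral_prod_mul]
    refine integral_congr_ae (ae_of_all _ fun x => ?_)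
    simp only; ring
  have hN' : (N : ℝ) ≠ 0 := by exact_mod_cast hN.ne'
  have hT' : (T : ℝ) ≠ 0 := by exact_mod_cast hT.ne'
  rw [DGP.varV]
  simp only [h, ← Finset.mul_sum, ← Finset.sum_mul, sum_sum_diagonal]
  split_ifs
  · field_simp
  · simp

/-- A fixed multiple of the identity, because distinct labels exclude each other. Nondegeneracy and
the eigenvalue ratio bound then hold with equality, the ratio being `1`. -/
lemma varTotal_shiftDGP {N T : ℕ} (hN : 0 < N) (hT : 0 < T) (k l : Fin K) :
    (shiftDGP M 𝒮 c).varTotal 𝒮 N T k l = if k = l then (c ^ 2 + 1) / K else 0 := by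
  have hT' : (T : ℝ) ≠ 0 := by exact_mod_cast hT.ne'
  have hK : (K : ℝ) ≠ 0 := by simp [NeZero.ne K]
  rw [DGP.varTotal, varA_shiftDGP 𝒮 c hN, varD_shiftDGP, varV_shiftDGP 𝒮 c hN hT, varE_shiftDGP]
  split_ifs
  · field_simp; ring
  · simp

lemma Q_shiftDGP (N T : ℕ) (k l : Fin K) :
    (shiftDGP M 𝒮 c).Q N T k l = if k = l then (K : ℝ)⁻¹ else 0 := by
  have h : ∀ z : I × I × I, ∑ m, ((shiftDGP M 𝒮 c).f N T z).2.1 m k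
      * ((shiftDGP M 𝒮 c).f N T z).2.1 m l
      = (if label K z.1 = k then 1 else 0) * if label K z.1 = l then 1 else 0 := by
    intro z
    rw [Finset.sum_eq_single 0]
    · simp [shiftDGP]
    · intro m _ hm; simp [shiftDGP, hm]
    · simp
  rw [DGP.Q]
  simp only [h]
  have h1 := integral_fun_fst (μ := (volume : Measure I)) (ν := (volume : Measure (I × I)))
    (fun x => (if label K x = k then (1 : ℝ) else 0) * if label K x = l then 1 else 0)
  rw [Measure.volume_eq_prod, h1, probReal_univ, one_smul]
  have h2 := integral_map (μ := (volume : Measure I))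
    (φ := fun x => (label K x, rowNormal K x))
    ((measurable_label K).prodMk (measurable_rowNormal K)).aemeasurable
    (f := fun p => (if p.1 = k then (1 : ℝ) else 0) * if p.1 = l then 1 else 0)
    ((measurable_of_countable fun p : Fin K =>
      (if p = k then (1 : ℝ) else 0) * if p = l then 1 else 0).comp
        measurable_fst).aestronglyMeasurable
  rw [← h2, map_label_rowNormal, integral_fun_fst fun p : Fin K =>
      (if p = k then (1 : ℝ) else 0) * if p = l then 1 else 0, integral_uniformLabel]
  simp [eq_comm]

lemma quad_diagonal (r : ℝ) (v : Fin K → ℝ) :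
    quad (fun k l => if k = l then r else 0) v = r * ∑ k, v k ^ 2 := by
  simp only [quad, mul_ite, mul_zero, ite_mul, zero_mul, Finset.sum_ite_eq, Finset.mem_univ,
    if_true, Finset.mul_sum]
  exact Finset.sum_congr rfl fun k _ => by ring

end

section

variable {K M : ℕ} [NeZero K] [NeZero M] (𝒮 : Design K) (c : ℝ)

/-! ### Regularity of the family -/

lemma measurable_shiftError (T : ℕ) :
    Measurable fun z : I × I × I => shiftError K c T z.1 z.2.1 := by
  have h1 := measurable_rowNormal K
  have h2 := measurable_timeNormal 0
  unfold shiftError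
  fun_prop

lemma measurable_selector (m : Fin M) (k : Fin K) :
    Measurable fun z : I × I × I => if m = 0 ∧ label K z.1 = k then (1 : ℝ) else 0 :=
  (measurable_of_countable fun j => if m = 0 ∧ j = k then (1 : ℝ) else 0).comp
    ((measurable_label K).comp measurable_fst)

lemma measurable_shiftDGP (N T : ℕ) : Measurable ((shiftDGP M 𝒮 c).f N T) := by
  have hu : ∀ m : Fin M, Measurable fun z : I × I × I =>
      if m = 0 then shiftError K c T z.1 z.2.1 else 0 := fun m => by
    by_cases h : m = 0
    · simpa [h] using measurable_shiftError c T
    · simp [h]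
  refine Measurable.prodMk (measurable_pi_lambda _ fun m => ?_)
    (Measurable.prodMk (measurable_pi_lambda _ fun m => measurable_pi_lambda _ fun k => ?_)
      (measurable_pi_lambda _ fun m => hu m))
  · exact (Finset.measurable_sum _ fun k _ => (measurable_selector m k).mul_const _).add (hu m)
  · exact measurable_selector m k

lemma map_infinitePi_shift {ι X : Type*} [MeasurableSpace X] (μ : Measure X)
    [IsProbabilityMeasure μ] {e : ι → ι} (he : e.Injective) :
    (Measure.infinitePi fun _ : ι => μ).map (fun w i => w (e i)) = Measure.infinitePi fun _ => μ :=
  Measure.map_infinitePi_infinitePi_of_inj (P := fun _ : ι => μ) he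

lemma representation_shiftDGP : AHKRepresentation (shiftDGP M 𝒮 c) where
  measurable := measurable_shiftDGP 𝒮 c
  linear _ _ _ _ := rfl
  row_uniform z := (measurePreserving_infinitePi_eval z).map_eq
  row_stationary h := map_infinitePi_shift volume (add_left_injective h)
  time_uniform t := (measurePreserving_infinitePi_eval t).map_eq
  time_stationary h := map_infinitePi_shift volume (add_left_injective h)

lemma spectral_shiftDGP : SpectralCondition (shiftDGP M 𝒮 c) where
  measurable_φ N T l k := by rw [shiftDGP_φ]; exact measurable_rowScore _
  measurable_ψ N T l k := measurable_timeNormal l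
  orthonormal_φ N T k l l' := by
    simp only [shiftDGP_φ, integral_rowScore_mul, systemIndex_eq_iff]
  orthonormal_ψ N T k l l' := integral_timeNormal_mul l l'
  expansion N T _ _ k := by
    refine tendsto_const_nhds.congr' ?_
    filter_upwards [eventually_ge_atTop {((0 : ℕ), (0 : ℕ))}] with S hS
    have hmem : ((0 : ℕ), (0 : ℕ)) ∈ S := hS (Finset.mem_singleton_self _)
    have h0 : (fun z : I × I => (shiftDGP M 𝒮 c).vFun N T z.1 z.2 k
        - ∑ l ∈ S, (shiftDGP M 𝒮 c).coef N T l.1 l.2 k * (shiftDGP M 𝒮 c).φ N T l.1 k z.1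
          * (shiftDGP M 𝒮 c).ψ N T l.2 k z.2) = 0 := by
      ext z
      rw [Finset.sum_eq_single_of_mem _ hmem]
      · rw [vFun_shiftDGP]
        simp [shiftDGP, rowPart]
      · rintro ⟨l, l'⟩ _ hl
        have : ¬(l = 0 ∧ l' = 0) := fun h => hl (by rw [h.1, h.2])
        simp [shiftDGP, this]
    rw [h0, eLpNorm_zero]
  coef_bound := by
    refine ⟨fun l => if l = (0, 0) then (√(K : ℝ))⁻¹ else 0, ?_, fun N T _ _ l l' k => ?_⟩
    · refine summable_of_ne_finset_zero (s := {(0, 0)}) fun l hl => ?_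
      simp [Finset.mem_singleton.not.1 hl]
    · simp only [shiftDGP, Prod.mk.injEq]
      split_ifs <;> simp [abs_of_nonneg]
  moments := by
    set b : ℕ → ℝ≥0∞ := fun m => ENNReal.ofReal √(K : ℝ) ^ (m : ℝ) * ∫⁻ x, ‖x‖ₑ ^ (m : ℝ) ∂stdNormal
      with hb
    set b' : ℕ → ℝ≥0∞ := fun m => ∫⁻ x, ‖x‖ₑ ^ (m : ℝ) ∂stdNormal with hb'
    have hfin : ∀ m ∈ Finset.Icc 1 3, b m + b' m < ∞ := fun m hm => by
      have hm' : (0 : ℝ) < m := by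
        have := (Finset.mem_Icc.1 hm).1
        exact_mod_cast this
      have := lintegral_stdNormal_pow_lt_top hm'
      simp only [hb, hb']
      finiteness
    have hsum : ∑ m ∈ Finset.Icc 1 3, (b m + b' m) ≠ ∞ := (ENNReal.sum_lt_top.2 hfin).ne
    refine ⟨(∑ m ∈ Finset.Icc 1 3, (b m + b' m)).toReal, fun N T l k m hm => ?_⟩
    rw [ENNReal.ofReal_toReal hsum, shiftDGP_φ]
    have hle : b m + b' m ≤ ∑ m ∈ Finset.Icc 1 3, (b m + b' m) :=
      Finset.single_le_sum (f := fun m => b m + b' m) (fun _ _ => zero_le) hm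
    constructor
    · refine le_trans ?_ (le_self_add.trans hle)
      simpa [hb] using lintegral_rowScore_pow_le (systemIndex (l, k)) (Nat.cast_nonneg m)
    · refine le_trans (le_of_eq ?_) (le_add_self.trans hle)
      simpa [hb', shiftDGP] using lintegral_timeNormal_pow l m

lemma lintegral_rowPart_pow_lt_top (k : Fin K) {p : ℝ} (hp : 0 < p) :
    ∫⁻ x, ‖rowPart k x‖ₑ ^ p < ∞ := by
  have h := ((memLp_rowScore (.inl k) (p := ENNReal.ofReal p) (by simp)).const_mul (√(K : ℝ))⁻¹).2
  have h2 := lintegral_rpow_enorm_lt_top_of_eLpNorm_lt_top (by simp [hp]) (by simp) h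
  rwa [ENNReal.toReal_ofReal hp.le] at h2

lemma lintegral_rowNormal_pow_lt_top {p : ℝ} (hp : 0 < p) :
    ∫⁻ x, ‖rowNormal K x‖ₑ ^ p < ∞ := by
  have h := (measurePreserving_rowMark_normal (K := K) 0).lintegral_comp
    (f := fun x => ‖x‖ₑ ^ p) (by fun_prop)
  exact h.trans_lt (lintegral_stdNormal_pow_lt_top hp)

lemma lintegral_timeNormal_add_pow_lt_top {p : ℝ} (hp : 0 < p) (r : ℝ) :
    ∫⁻ s : I, (‖timeNormal 0 s‖ₑ + ‖r‖ₑ) ^ p < ∞ := by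
  have h := ((memLp_timeNormal 0 (p := ENNReal.ofReal p) (by simp)).norm.add
    (memLp_const ‖r‖)).2
  have h2 := lintegral_rpow_enorm_lt_top_of_eLpNorm_lt_top (by simp [hp]) (by simp) h
  rw [ENNReal.toReal_ofReal hp.le] at h2
  refine lt_of_eq_of_lt (lintegral_congr fun s => ?_) h2
  simp only [Pi.add_apply]
  rw [Real.enorm_of_nonneg (add_nonneg (norm_nonneg _) (norm_nonneg _)),
    ENNReal.ofReal_add (norm_nonneg _) (norm_nonneg _), ofReal_norm, ofReal_norm]

lemma lintegral_I3_mul {f g : I → ℝ≥0∞} (hf : Measurable f) (hg : Measurable g) :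
    ∫⁻ z : I × I × I, f z.1 * g z.2.1 = (∫⁻ x, f x) * ∫⁻ s, g s := by
  have h1 := lintegral_prod_mul (μ := (volume : Measure I)) (ν := (volume : Measure (I × I)))
    (f := f) (g := fun q => g q.1) hf.aemeasurable (hg.comp measurable_fst).aemeasurable
  have h2 := lintegral_prod_mul (μ := (volume : Measure I)) (ν := (volume : Measure I))
    (f := g) (g := fun _ => 1) hg.aemeasurable aemeasurable_const
  simp only [mul_one, lintegral_const, measure_univ] at h2
  rw [Measure.volume_eq_prod, h1, Measure.volume_eq_prod, h2]

lemma moments_shiftDGP {p : ℝ} (hp : 0 < p) : MomentCondition (shiftDGP M 𝒮 c) 𝒮 p where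
  mean_zero N T _ _ k := meanScore_shiftDGP 𝒮 c N T k
  Q_pos := by
    refine ⟨(K : ℝ)⁻¹, by simp [NeZero.pos K], fun N T _ _ v => ?_⟩
    rw [← quad_diagonal]
    exact le_of_eq (congrArg (quad · v) (by ext k l; rw [Q_shiftDGP]))
  moment_Xu := by
    have h1 := lintegral_rowNormal_pow_lt_top (K := K) hp
    have h2 := lintegral_timeNormal_add_pow_lt_top hp c
    set B : ℝ≥0∞ := (∫⁻ x, ‖rowNormal K x‖ₑ ^ p) * ∫⁻ s : I, (‖timeNormal 0 s‖ₑ + ‖c‖ₑ) ^ p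
    have hB : B + 1 ≠ ∞ := by finiteness
    refine ⟨(B + 1).toReal, fun N T _ hT => ?_⟩
    rw [ENNReal.ofReal_toReal hB]
    constructor
    · refine le_trans (b := 1) ?_ le_add_self
      calc ∫⁻ z, ‖((shiftDGP M 𝒮 c).f N T z).2.1‖ₑ ^ p ≤ ∫⁻ _ : I × I × I, 1 := by
            refine lintegral_mono fun z => ENNReal.rpow_le_one ?_ hp.le
            rw [← ofReal_norm, ← ENNReal.ofReal_one]
            refine ENNReal.ofReal_le_ofReal ?_
            rw [pi_norm_le_iff_of_nonneg zero_le_one]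
            intro m
            rw [pi_norm_le_iff_of_nonneg zero_le_one]
            intro k
            simp only [shiftDGP]
            split_ifs <;> simp
        _ = 1 := by simp
    · refine le_trans (b := B) ?_ le_self_add
      have hmr := measurable_rowNormal K
      have hmt := measurable_timeNormal 0
      refine le_trans (lintegral_mono fun z => ?_) (le_of_eq (lintegral_I3_mul
        (f := fun x => ‖rowNormal K x‖ₑ ^ p) (g := fun s => (‖timeNormal 0 s‖ₑ + ‖c‖ₑ) ^ p)
        (by fun_prop) (by fun_prop)))
      rw [← ENNReal.mul_rpow_of_nonneg _ _ hp.le]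
      refine ENNReal.rpow_le_rpow ?_ hp.le
      have hc : ‖c / √(T : ℝ)‖ₑ ≤ ‖c‖ₑ := by
        rw [← ofReal_norm, ← ofReal_norm]
        refine ENNReal.ofReal_le_ofReal ?_
        rw [norm_div, Real.norm_of_nonneg (Real.sqrt_nonneg _)]
        exact div_le_self (norm_nonneg _) (Real.one_le_sqrt.2 (by exact_mod_cast hT))
      have hu : ‖((shiftDGP M 𝒮 c).f N T z).2.2‖ₑ ≤ ‖shiftError K c T z.1 z.2.1‖ₑ := by
        rw [← ofReal_norm, ← ofReal_norm]
        refine ENNReal.ofReal_le_ofReal ?_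
        rw [pi_norm_le_iff_of_nonneg (norm_nonneg _)]
        intro m
        simp only [shiftDGP]
        split_ifs <;> simp
      refine hu.trans ?_
      rw [shiftError, enorm_mul]
      gcongr
      exact (enorm_add_le _ _).trans (by gcongr)
  moment_components := by
    -- `r` is the standard deviation of the row part. After standardization `c`, `N` and `T` cancel
    -- from both `a` and `v`, up to the sign of `c`, so one finite bound serves all sample sizes.
    set r : ℝ := √(K : ℝ)⁻¹
    have hfin1 : ∀ k : Fin K, ∫⁻ x, ‖r⁻¹ * rowPart k x‖ₑ ^ p < ∞ := fun k => by
      simp only [enorm_mul, ENNReal.mul_rpow_of_nonneg _ _ hp.le]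
      have := lintegral_rowPart_pow_lt_top k hp
      rw [lintegral_const_mul' _ _ (by finiteness)]
      finiteness
    have hfin2 : ∀ k : Fin K, ∫⁻ z : I × I, ‖r⁻¹ * (rowPart k z.1 * timeNormal 0 z.2)‖ₑ ^ p < ∞ :=
      fun k => by
      have h1 := lintegral_rowPart_pow_lt_top k hp
      have h2 := lintegral_stdNormal_pow_lt_top hp
      rw [← lintegral_timeNormal_pow 0] at h2
      have hm1 := measurable_rowPart k
      have hm2 := measurable_timeNormal 0
      have h3 := lintegral_prod_mul (μ := (volume : Measure I)) (ν := (volume : Measure I))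
        (f := fun x => ‖rowPart k x‖ₑ ^ p) (g := fun s => ‖timeNormal 0 s‖ₑ ^ p)
        (by fun_prop) (by fun_prop)
      simp only [enorm_mul, ENNReal.mul_rpow_of_nonneg _ _ hp.le]
      rw [lintegral_const_mul' _ _ (by finiteness), Measure.volume_eq_prod, h3]
      finiteness
    set B : ℝ≥0∞ := ∑ k : Fin K, ((∫⁻ x, ‖r⁻¹ * rowPart k x‖ₑ ^ p)
      + ∫⁻ z : I × I, ‖r⁻¹ * (rowPart k z.1 * timeNormal 0 z.2)‖ₑ ^ p) with hB
    have hBtop : B ≠ ∞ := (ENNReal.sum_lt_top.2 fun k _ =>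
      ENNReal.add_lt_top.2 ⟨hfin1 k, hfin2 k⟩).ne
    refine ⟨B.toReal, fun N T hN hT k => ?_⟩
    rw [ENNReal.ofReal_toReal hBtop]
    have hle := Finset.single_le_sum (f := fun k : Fin K => (∫⁻ x, ‖r⁻¹ * rowPart k x‖ₑ ^ p)
      + ∫⁻ z : I × I, ‖r⁻¹ * (rowPart k z.1 * timeNormal 0 z.2)‖ₑ ^ p)
      (fun _ _ => zero_le) (Finset.mem_univ k)
    rw [← hB] at hle
    refine ⟨fun hpos => ?_, fun h => ?_, fun h => ?_, fun _ => ?_⟩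
    · refine le_trans (lintegral_mono fun x => ?_) (le_self_add.trans hle)
      refine ENNReal.rpow_le_rpow (le_of_eq ?_) hp.le
      rw [varA_shiftDGP 𝒮 c hN, if_pos rfl] at hpos ⊢
      rw [← ofReal_norm, ← ofReal_norm, Real.norm_eq_abs, Real.norm_eq_abs]
      congr 1
      have hT' : √(T : ℝ) ≠ 0 := Real.sqrt_ne_zero'.2 (by exact_mod_cast hT)
      have hc : c ≠ 0 := by rintro rfl; simp at hpos
      have hr : √(c ^ 2 / (T * K)) = |c| / √(T : ℝ) * r := by
        rw [Real.sqrt_div (sq_nonneg c), Real.sqrt_sq_eq_abs, Real.sqrt_mul (by positivity),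
          show r = (√(K : ℝ))⁻¹ from Real.sqrt_inv _]
        field_simp
      rw [aFun_shiftDGP, hr, abs_div, abs_mul, abs_mul, abs_mul, abs_div, abs_div, abs_abs, abs_inv,
        abs_of_nonneg (Real.sqrt_nonneg _)]
      have hc' : |c| ≠ 0 := abs_ne_zero.2 hc
      have hr0 : r ≠ 0 := by
        simp only [r, Real.sqrt_inv]; simp [NeZero.ne K]
      field_simp
    · simp [varD_shiftDGP] at h
    · simp [varE_shiftDGP] at h
    · refine le_trans (lintegral_mono fun x => ?_) (le_add_self.trans hle)
      refine ENNReal.rpow_le_rpow (le_of_eq ?_) hp.le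
      rw [varV_shiftDGP 𝒮 c hN hT, if_pos rfl, vFun_shiftDGP, div_eq_inv_mul]
  nondegenerate := by
    refine ⟨(c ^ 2 + 1) / K, div_pos (by positivity) (by simp [NeZero.pos K]), ?_⟩
    filter_upwards [(eventually_gt_atTop 0).prod_mk (eventually_gt_atTop 0)] with n hn v
    rw [← quad_diagonal]
    exact le_of_eq (congrArg (quad · v) (by
      ext k l; rw [varTotal_shiftDGP 𝒮 c hn.1 hn.2]))

lemma serialMixing_shiftDGP {h : ℕ} (hh : 0 < h) : serialMixing (shiftDGP M 𝒮 c) h = 0 := by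
  refine le_antisymm (Real.sSup_le ?_ le_rfl) (Real.sSup_nonneg ?_)
  · rintro x ⟨t, G, H, hG, hH, rfl⟩
    have hind : iIndep (fun s : ℤ => MeasurableSpace.comap (fun w : ℤ → I => w s) inferInstance)
        (shiftDGP M 𝒮 c).timeMeasure :=
      iIndepFun_infinitePi (P := fun _ : ℤ => (volume : Measure I)) (X := fun _ => id)
        fun _ => measurable_id
    have hd : Disjoint (Set.Iic t) (Set.Ici (t + h)) := by
      rw [Set.disjoint_left]
      intro s hs hs'
      simp only [Set.mem_Iic, Set.mem_Ici] at hs hs'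
      omega
    have := (Indep_iff _ _ _).1 (indep_iSup_of_disjoint
      (fun s => (measurable_pi_apply s).comap_le) hind hd) G H hG hH
    rw [measureReal_def, this, ENNReal.toReal_mul, ← measureReal_def, ← measureReal_def]
    simp
  · rintro x ⟨t, G, H, hG, hH, rfl⟩
    exact abs_nonneg _

/-- The effects are independent across sites, and two sets of clusters at distance at least `r > 0`
cannot share a member, which would be at distance `0` from itself. -/
lemma spatialMixing_shiftDGP {r : ℝ} (hr : 0 < r) : spatialMixing (shiftDGP M 𝒮 c) 𝒮 r = 0 := by
  refine le_antisymm (Real.sSup_le ?_ le_rfl) (Real.sSup_nonneg ?_)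
  · rintro x ⟨A, B, hAB, G, H, hG, hH, rfl⟩
    have hind : iIndep (fun i : ℕ => MeasurableSpace.comap
        (fun w : ℤ × ℤ → I => w (𝒮.site i)) inferInstance) (shiftDGP M 𝒮 c).rowMeasure :=
      (iIndepFun_infinitePi (P := fun _ : ℤ × ℤ => (volume : Measure I)) (X := fun _ => id)
        fun _ => measurable_id).precomp 𝒮.site_injective
    have hd : Disjoint (A : Set ℕ) (B : Set ℕ) := by
      rw [Set.disjoint_left]
      intro i hi hi'
      have := hAB i hi i hi'
      simp only [Design.dist, sub_self, norm_zero] at this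
      linarith
    have := (Indep_iff _ _ _).1 (indep_iSup_of_disjoint
      (fun i => (measurable_pi_apply (𝒮.site i)).comap_le) hind hd) G H hG hH
    rw [measureReal_def, this, ENNReal.toReal_mul, ← measureReal_def, ← measureReal_def]
    simp
  · rintro x ⟨A, B, hAB, G, H, hG, hH, rfl⟩
    exact abs_nonneg _

lemma regular_shiftDGP : Regular (shiftDGP M 𝒮 c) 𝒮 where
  null := rfl
  representation := representation_shiftDGP 𝒮 c
  spectral := spectral_shiftDGP 𝒮 c
  moments_mixing := by
    -- With `ζ = 2` and `δ = 1` the serial threshold `2ζ/(ζ-1)` is `4`, below the chosen `5`, and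
    -- the spatial exponent is `4/5`. The latter must be nonzero, since the mixing coefficient `0`
    -- is raised to it.
    refine ⟨2, 1, by norm_num, by norm_num, moments_shiftDGP 𝒮 c (by norm_num),
      ⟨5, by norm_num, ?_⟩, ?_⟩
    · refine (Asymptotics.isBigO_zero _ _).congr' ?_ EventuallyEq.rfl
      filter_upwards [eventually_gt_atTop 0] with h hh
      rw [serialMixing_shiftDGP 𝒮 c hh]
    · refine (Asymptotics.isLittleO_zero _ _).congr' ?_ EventuallyEq.rfl
      filter_upwards [eventually_gt_atTop 0] with r hr
      rw [spatialMixing_shiftDGP 𝒮 c hr, Real.zero_rpow (by norm_num)]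
  same_rate := by
    refine ⟨1, ?_⟩
    filter_upwards [(eventually_gt_atTop 0).prod_mk (eventually_gt_atTop 0)] with n hn v w hv hw
    have : (shiftDGP M 𝒮 c).varTotal 𝒮 n.1 n.2
        = fun k l => if k = l then (c ^ 2 + 1) / (K : ℝ) else 0 := by
      ext k l; rw [varTotal_shiftDGP 𝒮 c hn.1 hn.2]
    rw [this, quad_diagonal, quad_diagonal, hv, hw, one_mul]

lemma nonGaussian_shiftDGP (k : Fin K) : NonGaussian (shiftDGP M 𝒮 c) 𝒮 k := by
  refine ⟨(K : ℝ)⁻¹, by simp [NeZero.pos K], ?_⟩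
  filter_upwards [(eventually_gt_atTop 0).prod_mk (eventually_gt_atTop 0)] with n hn
  rw [varV_shiftDGP 𝒮 c hn.1 hn.2, if_pos rfl]

lemma eventually_varA_shiftDGP (k : Fin K) : ∀ᶠ n : ℕ × ℕ in atTop ×ˢ atTop,
    n.2 * (shiftDGP M 𝒮 c).varA 𝒮 n.1 n.2 k k = c ^ 2 / K := by
  filter_upwards [(eventually_gt_atTop 0).prod_mk (eventually_gt_atTop 0)] with n hn
  have : (n.2 : ℝ) ≠ 0 := by exact_mod_cast (show n.2 ≠ 0 from hn.2.ne')
  rw [varA_shiftDGP 𝒮 c hn.1, if_pos rfl]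
  field_simp

lemma shiftDGP_mem_classIN (hc : c ≠ 0) : shiftDGP M 𝒮 c ∈ classIN M 𝒮 := by
  refine ⟨regular_shiftDGP 𝒮 c, 0, ⟨c ^ 2 / K, div_pos (by positivity) (by simp [NeZero.pos K]), ?_⟩,
    nonGaussian_shiftDGP 𝒮 c 0⟩
  refine tendsto_const_nhds.congr' ?_
  filter_upwards [eventually_varA_shiftDGP (M := M) 𝒮 c 0] with n hn
  rw [hn, varD_shiftDGP, mul_zero, max_eq_left (by positivity)]

lemma shiftDGP_mem_classVN : shiftDGP M 𝒮 0 ∈ classVN M 𝒮 := by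
  refine ⟨regular_shiftDGP 𝒮 0, fun k => ⟨?_, ?_, nonGaussian_shiftDGP 𝒮 0 k⟩⟩
  · refine tendsto_const_nhds.congr' ?_
    filter_upwards [eventually_varA_shiftDGP (M := M) 𝒮 0 k] with n hn
    rw [hn]; simp
  · simp [varD_shiftDGP]

end

section

variable {K M : ℕ} [NeZero K] [NeZero M] (𝒮 : Design K) (c : ℝ)

/-! ### The law of the sample -/

/-- The law of the labels and normal variables of `N` clusters. -/
abbrev rowMarkLaw (K N : ℕ) : Measure (Fin N → Fin K × ℝ) :=
  Measure.pi fun _ => (uniformLabel K).prod stdNormal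

/-- The sample as a function of the marks of the clusters and the shifted time effects. -/
def panelMap (M : ℕ) [NeZero M] (𝒮 : Design K) {N T : ℕ} (p : (Fin N → Fin K × ℝ) × (Fin T → ℝ)) :
    Panel K M N T := fun i t =>
  (fun m => ∑ k, (if m = 0 ∧ (p.1 i).1 = k then 1 else 0) * 𝒮.β₀ k
      + if m = 0 then (p.1 i).2 * p.2 t else 0,
    fun m k => if m = 0 ∧ (p.1 i).1 = k then 1 else 0)

lemma measurable_panelMap {N T : ℕ} : Measurable (panelMap M 𝒮 (N := N) (T := T)) := by
  have hsel : ∀ (i : Fin N) (m : Fin M) (k : Fin K), Measurable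
      fun p : (Fin N → Fin K × ℝ) × (Fin T → ℝ) =>
        if m = 0 ∧ (p.1 i).1 = k then (1 : ℝ) else 0 := fun i m k =>
    (measurable_of_countable fun j => if m = 0 ∧ j = k then (1 : ℝ) else 0).comp
      (measurable_fst.comp ((measurable_pi_apply i).comp measurable_fst))
  refine measurable_pi_lambda _ fun i => measurable_pi_lambda _ fun t =>
    Measurable.prodMk (measurable_pi_lambda _ fun m => ?_)
      (measurable_pi_lambda _ fun m => measurable_pi_lambda _ fun k => hsel i m k)
  refine (Finset.measurable_sum _ fun k _ => (hsel i m k).mul_const _).add ?_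
  by_cases h : m = 0
  · simp only [h, if_true]; fun_prop
  · simp [h]

lemma measurePreserving_rowMarks (N : ℕ) :
    MeasurePreserving (fun (w : ℤ × ℤ → I) (i : Fin N) =>
      (label K (w (𝒮.site i)), rowNormal K (w (𝒮.site i))))
      (Measure.infinitePi fun _ => volume) (rowMarkLaw K N) := by
  have hm : Measurable fun x => (label K x, rowNormal K x) :=
    (measurable_label K).prodMk (measurable_rowNormal K)
  refine ⟨measurable_pi_lambda _ fun i => hm.comp (measurable_pi_apply _), ?_⟩
  rw [rowMarkLaw, ← map_label_rowNormal]
  exact map_infinitePi_injective (site_fin_injective 𝒮 N) hm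

lemma measurePreserving_timeMarks (r : ℝ) (T : ℕ) :
    MeasurePreserving (fun (w : ℤ → I) (t : Fin T) => timeNormal 0 (w (t : ℤ)) + r)
      (Measure.infinitePi fun _ => volume) (Measure.pi fun _ => gaussianReal r 1) := by
  have hm : Measurable fun s : I => timeNormal 0 s + r := (measurable_timeNormal 0).add_const r
  refine ⟨measurable_pi_lambda _ fun i => hm.comp (measurable_pi_apply _), ?_⟩
  have hmap : (volume : Measure I).map (fun s => timeNormal 0 s + r) = gaussianReal r 1 := by
    have := Measure.map_map (μ := (volume : Measure I)) (measurable_add_const r)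
      (measurable_timeNormal 0)
    rw [(measurePreserving_timeNormal 0).map_eq, gaussianReal_map_add_const, zero_add] at this
    exact this.symm
  rw [← hmap]
  refine map_infinitePi_injective (s := fun t : Fin T => (t : ℤ)) ?_ hm
  intro a b hab
  have hab' : ((a : ℕ) : ℤ) = ((b : ℕ) : ℤ) := hab
  exact Fin.ext (by exact_mod_cast hab')

/-- The observed sample is a function of the cluster marks and the shifted time effects, by a map
that does not involve `c`. Every comparison of sample laws thereby reduces to a mean shift of a
standard normal vector of length `T`. -/
lemma dataLaw_shiftDGP (N T : ℕ) :
    (shiftDGP M 𝒮 c).dataLaw 𝒮 N T = ((rowMarkLaw K N).prod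
      (Measure.pi fun _ : Fin T => gaussianReal (c / √(T : ℝ)) 1)).map (panelMap M 𝒮) := by
  have h := (measurePreserving_rowMarks 𝒮 N).prod
    ((measurePreserving_timeMarks (c / √(T : ℝ)) T).comp
      (measurePreserving_fst (μ := Measure.infinitePi fun _ : ℤ => (volume : Measure I))
        (ν := Measure.pi fun _ : Fin N => Measure.pi fun _ : Fin T => (volume : Measure I))))
  rw [← h.map_eq, Measure.map_map (measurable_panelMap 𝒮) h.measurable]
  rfl

instance (N T : ℕ) : IsProbabilityMeasure ((shiftDGP M 𝒮 c).dataLaw 𝒮 N T) := by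
  rw [dataLaw_shiftDGP]
  exact Measure.isProbabilityMeasure_map (measurable_panelMap 𝒮).aemeasurable

/-- Each of the `T` periods contributes `exp(c²/T)` to the second moment of the likelihood ratio.
The product does not depend on the sample size, which makes the comparison uniform in `N` and `T`.
-/
lemma exp_shift_pow {T : ℕ} (hT : 0 < T) :
    Real.exp ((c / √(T : ℝ)) ^ 2) ^ Fintype.card (Fin T) = Real.exp (c ^ 2) := by
  have : (T : ℝ) ≠ 0 := by exact_mod_cast hT.ne'
  rw [← Real.exp_nat_mul, Fintype.card_fin, div_pow, Real.sq_sqrt (by positivity)]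
  congr 1
  field_simp

lemma dataLaw_shift_le_sqrt {N T : ℕ} (hT : 0 < T) (S : Set (Panel K M N T)) :
    (shiftDGP M 𝒮 c).dataLaw 𝒮 N T S
      ≤ ENNReal.ofReal √(Real.exp (c ^ 2))
        * ((shiftDGP M 𝒮 0).dataLaw 𝒮 N T S) ^ (1 / 2 : ℝ) := by
  -- The bound is needed for events defined by a Kolmogorov distance, for which no measurability is
  -- available. Replacing `S` by its measurable hull for the unshifted law keeps the right side and
  -- can only enlarge the left.
  rw [← measure_toMeasurable (μ := (shiftDGP M 𝒮 0).dataLaw 𝒮 N T) S]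
  refine (measure_mono (subset_toMeasurable ((shiftDGP M 𝒮 0).dataLaw 𝒮 N T) S)).trans ?_
  have hS := measurableSet_toMeasurable ((shiftDGP M 𝒮 0).dataLaw 𝒮 N T) S
  set S' := toMeasurable ((shiftDGP M 𝒮 0).dataLaw 𝒮 N T) S
  rw [dataLaw_shiftDGP, dataLaw_shiftDGP, Measure.map_apply (measurable_panelMap 𝒮) hS,
    Measure.map_apply (measurable_panelMap 𝒮) hS, zero_div, ← exp_shift_pow c hT]
  exact prod_pi_gaussianReal_le_sqrt _ _ (measurable_panelMap 𝒮 hS)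

/-- A bound for the total variation distance between the samples with and without shift. -/
def shiftDistance (c : ℝ) : ℝ≥0∞ := ENNReal.ofReal √(Real.exp (c ^ 2) - 1)

lemma tendsto_shiftDistance : Tendsto shiftDistance (𝓝 0) (𝓝 0) := by
  have h : Continuous shiftDistance := by
    unfold shiftDistance
    exact ENNReal.continuous_ofReal.comp (by fun_prop)
  simpa [shiftDistance] using h.tendsto 0

lemma exists_shiftDistance_lt {η : ℝ≥0∞} (hη : 0 < η) :
    ∃ r > 0, ∀ c : ℝ, 0 < c → c < r → shiftDistance c < η := by
  obtain ⟨r, hr, h⟩ := Metric.eventually_nhds_iff.1 (tendsto_shiftDistance.eventually_lt_const hη)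
  exact ⟨r, hr, fun c hc hcr => h (by rwa [Real.dist_0_eq_abs, abs_of_pos hc])⟩

lemma lintegral_dataLaw_close {N T : ℕ} (hT : 0 < T) {h : Panel K M N T → ℝ≥0∞}
    (hh : Measurable h) (hle : ∀ z, h z ≤ 1) :
    ∫⁻ z, h z ∂(shiftDGP M 𝒮 c).dataLaw 𝒮 N T
        ≤ ∫⁻ z, h z ∂(shiftDGP M 𝒮 0).dataLaw 𝒮 N T + shiftDistance c ∧
      ∫⁻ z, h z ∂(shiftDGP M 𝒮 0).dataLaw 𝒮 N T
        ≤ ∫⁻ z, h z ∂(shiftDGP M 𝒮 c).dataLaw 𝒮 N T + shiftDistance c := by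
  have hm := measurable_panelMap (M := M) 𝒮 (N := N) (T := T)
  rw [dataLaw_shiftDGP, dataLaw_shiftDGP, lintegral_map hh hm, lintegral_map hh hm, zero_div,
    shiftDistance, ← exp_shift_pow c hT]
  exact lintegral_prod_pi_gaussianReal_close _ _ (hh.comp hm) fun z => hle _

/-- The case of indicators. As `S` is arbitrary, each inequality uses the measurable hull with
respect to the law on its right-hand side. -/
lemma dataLaw_shift_close {N T : ℕ} (hT : 0 < T) (S : Set (Panel K M N T)) :
    (shiftDGP M 𝒮 c).dataLaw 𝒮 N T S
        ≤ (shiftDGP M 𝒮 0).dataLaw 𝒮 N T S + shiftDistance c ∧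
      (shiftDGP M 𝒮 0).dataLaw 𝒮 N T S
        ≤ (shiftDGP M 𝒮 c).dataLaw 𝒮 N T S + shiftDistance c := by
  have key : ∀ S : Set (Panel K M N T), MeasurableSet S → _ := fun S hS =>
    lintegral_dataLaw_close (M := M) 𝒮 c (N := N) hT (h := S.indicator 1)
      (measurable_one.indicator hS) (fun z => Set.indicator_le (fun _ _ => le_rfl) z)
  simp only [Pi.one_def] at key
  constructor
  · refine (measure_mono (subset_toMeasurable ((shiftDGP M 𝒮 0).dataLaw 𝒮 N T) S)).trans ?_
    have hS := measurableSet_toMeasurable ((shiftDGP M 𝒮 0).dataLaw 𝒮 N T) S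
    have := (key _ hS).1
    rwa [lintegral_indicator_const hS, lintegral_indicator_const hS, one_mul, one_mul,
      measure_toMeasurable] at this
  · refine (measure_mono (subset_toMeasurable ((shiftDGP M 𝒮 c).dataLaw 𝒮 N T) S)).trans ?_
    have hS := measurableSet_toMeasurable ((shiftDGP M 𝒮 c).dataLaw 𝒮 N T) S
    have := (key _ hS).2
    rwa [lintegral_indicator_const hS, lintegral_indicator_const hS, one_mul, one_mul,
      measure_toMeasurable] at this

/-! ### Tests -/

/-- For a process outside the regular classes the sample map may fail to be measurable, and then the
pushforward is the zero measure. Total mass at most `1` is what holds in general and suffices for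
the upper bounds on agreement. -/
lemma dataLaw_univ_le_one (g : DGP K M) (N T : ℕ) : g.dataLaw 𝒮 N T Set.univ ≤ 1 := by
  have : IsProbabilityMeasure (g.latentLaw N T) := by unfold DGP.latentLaw; infer_instance
  by_cases h : AEMeasurable (fun (ω : Latent N T) (i : Fin N) (t : Fin T) =>
    ((g.f N T (DGP.cell 𝒮 ω i t)).1, (g.f N T (DGP.cell 𝒮 ω i t)).2.1)) (g.latentLaw N T)
  · rw [DGP.dataLaw, Measure.map_apply_of_aemeasurable h MeasurableSet.univ]
    exact prob_le_one
  · rw [DGP.dataLaw, Measure.map_of_not_aemeasurable h]; simp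

lemma decisionLaw_apply (g : DGP K M) {N T : ℕ} (D : Test K M N T) (b : Set Bool) :
    decisionLaw g 𝒮 D b = ∫⁻ z, D.1 z b ∂g.dataLaw 𝒮 N T :=
  Measure.bind_apply (MeasurableSet.of_discrete) D.1.aemeasurable

lemma decisionLaw_univ_le_one (g : DGP K M) {N T : ℕ} (D : Test K M N T) :
    decisionLaw g 𝒮 D Set.univ ≤ 1 := by
  have := D.2
  rw [decisionLaw_apply]
  simp only [measure_univ, lintegral_const, one_mul]
  exact dataLaw_univ_le_one 𝒮 g N T

lemma isProbabilityMeasure_decisionLaw {N T : ℕ} (D : Test K M N T) :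
    IsProbabilityMeasure (decisionLaw (shiftDGP M 𝒮 c) 𝒮 D) :=
  ⟨by have := D.2; rw [decisionLaw_apply]; simp only [measure_univ, lintegral_const, one_mul]⟩

lemma decisionLaw_close {N T : ℕ} (hT : 0 < T) (D : Test K M N T) (b : Set Bool) :
    decisionLaw (shiftDGP M 𝒮 c) 𝒮 D b ≤ decisionLaw (shiftDGP M 𝒮 0) 𝒮 D b + shiftDistance c ∧
      decisionLaw (shiftDGP M 𝒮 0) 𝒮 D b
        ≤ decisionLaw (shiftDGP M 𝒮 c) 𝒮 D b + shiftDistance c := by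
  have := D.2
  rw [decisionLaw_apply, decisionLaw_apply]
  exact lintegral_dataLaw_close 𝒮 c hT (D.1.measurable_coe MeasurableSet.of_discrete)
    fun z => prob_le_one

lemma add_bool_eq_one (μ : Measure Bool) [IsProbabilityMeasure μ] : μ {true} + μ {false} = 1 := by
  rw [← measure_univ (μ := μ), ← measure_union (by simp) (measurableSet_singleton _)]
  congr 1
  ext b; cases b <;> simp

/-- Marginal bookkeeping for the maximal coupling: the common mass at `false`, plus the truncated
excess `b - a` sent off the diagonal, restores the mass `a'`. -/
lemma min_add_tsub_of_add_eq_one {a a' b b' : ℝ≥0∞} (ha : a + a' = 1) (hb : b + b' = 1) :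
    min a' b' + (b - a) = a' := by
  have hane : a ≠ ∞ := fun h => by simp [h] at ha
  have hbne : b ≠ ∞ := fun h => by simp [h] at hb
  rcases le_total a b with h | h
  · have h1 : a' = b' + (b - a) := by
      refine (ENNReal.add_right_inj hane).1 ?_
      rw [ha, ← hb, add_left_comm, add_tsub_cancel_of_le h, add_comm]
    rw [min_eq_right (h1 ▸ le_self_add), ← h1]
  · have h1 : b' = a' + (a - b) := by
      refine (ENNReal.add_right_inj hbne).1 ?_
      rw [hb, ← ha, add_left_comm, add_tsub_cancel_of_le h, add_comm]
    rw [tsub_eq_zero_of_le h, add_zero, min_eq_left (h1 ▸ le_self_add)]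

/-- Two laws on `Bool` at distance at most `τ` have a coupling that agrees with probability at
least `1 - τ`. -/
lemma exists_coupling_bool {μ ν : Measure Bool} [IsProbabilityMeasure μ] [IsProbabilityMeasure ν]
    {τ : ℝ≥0∞} (h1 : μ {true} ≤ ν {true} + τ) (h2 : ν {true} ≤ μ {true} + τ) :
    ∃ π : Measure (Bool × Bool), π.map Prod.fst = μ ∧ π.map Prod.snd = ν ∧
      1 - τ ≤ π {p | p.1 = p.2} := by
  have hμ := add_bool_eq_one μ
  have hν := add_bool_eq_one ν
  set a := μ {true} with ha
  set a' := μ {false} with ha'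
  set b := ν {true} with hb
  set b' := ν {false} with hb'
  -- The maximal coupling: the common mass of each outcome sits on the diagonal and the excess off
  -- it. By truncated subtraction at most one of the two off-diagonal atoms is charged.
  refine ⟨min a b • Measure.dirac (true, true) + min a' b' • Measure.dirac (false, false)
    + (a - b) • Measure.dirac (true, false) + (b - a) • Measure.dirac (false, true), ?_, ?_, ?_⟩
  · refine Measure.ext_of_singleton fun x => ?_
    rw [Measure.map_apply measurable_fst (measurableSet_singleton x)]
    cases x
    · simp [min_add_tsub_of_add_eq_one hμ hν, ← ha']
    · simp [← ha, add_comm (min a b), tsub_add_min]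
  · refine Measure.ext_of_singleton fun x => ?_
    rw [Measure.map_apply measurable_snd (measurableSet_singleton x)]
    cases x
    · simp [min_comm a', min_add_tsub_of_add_eq_one hν hμ, ← hb']
    · simp [← hb, min_comm a b, add_comm (min b a), tsub_add_min]
  · simp only [Measure.coe_add, Measure.coe_smul, Pi.add_apply, Pi.smul_apply, smul_eq_mul]
    rw [Measure.dirac_apply' _ (by measurability), Measure.dirac_apply' _ (by measurability),
      Measure.dirac_apply' _ (by measurability), Measure.dirac_apply' _ (by measurability)]
    simp only [Set.indicator, Set.mem_ofPred_eq, if_true, Pi.one_apply, mul_one, mul_zero, add_zero,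
      reduceCtorEq, if_false]
    refine tsub_le_iff_right.2 ?_
    rcases le_total a b with h | h
    · have h3 : b' ≤ a' := by
        have := min_add_tsub_of_add_eq_one hν hμ
        rw [tsub_eq_zero_of_le h, add_zero] at this
        exact min_eq_left_iff.1 this
      rw [min_eq_left h, min_eq_right h3, ← hν]
      calc b + b' ≤ a + τ + b' := by gcongr
        _ = a + b' + τ := by ring
    · have h3 : a' ≤ b' := by
        have := min_add_tsub_of_add_eq_one hμ hν
        rw [tsub_eq_zero_of_le h, add_zero] at this
        exact min_eq_left_iff.1 this
      rw [min_eq_right h, min_eq_left h3, ← hμ]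
      calc a + a' ≤ b + τ + a' := by gcongr
        _ = b + a' + τ := by ring

lemma prod_agreement (μ ν : Measure Bool) [IsFiniteMeasure μ] [IsFiniteMeasure ν] :
    (μ.prod ν) {p | p.1 = p.2} = μ {true} * ν {true} + μ {false} * ν {false} := by
  have : {p : Bool × Bool | p.1 = p.2} = ({true} ×ˢ {true}) ∪ ({false} ×ˢ {false}) := by
    ext ⟨x, y⟩; cases x <;> cases y <;> simp
  rw [this, measure_union (by simp) ((measurableSet_singleton _).prod (measurableSet_singleton _)),
    Measure.prod_prod, Measure.prod_prod]

/-- With acceptance masses `a` and `b` for `true`, the agreement is `1/2 + ((a + b - 1)² - (a -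
b)²)/2`. The loss is at most `(a - b)²`, which is at most `|a - b|` as both masses lie in `[0,1]`.
-/
lemma half_le_prod_agreement {μ ν : Measure Bool} [IsProbabilityMeasure μ]
    [IsProbabilityMeasure ν] {τ : ℝ≥0∞} (h1 : μ {true} ≤ ν {true} + τ)
    (h2 : ν {true} ≤ μ {true} + τ) : 1 / 2 - τ ≤ (μ.prod ν) {p | p.1 = p.2} := by
  rw [prod_agreement]
  have hμ := add_bool_eq_one μ
  have hν := add_bool_eq_one ν
  by_cases hτ : τ = ∞
  · simp [hτ]
  have e : ∀ (ρ : Measure Bool) [IsProbabilityMeasure ρ] (s : Set Bool),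
      ρ s = ENNReal.ofReal (ρ.real s) := fun ρ _ s => by simp
  have n : ∀ (ρ : Measure Bool) (s : Set Bool), 0 ≤ ρ.real s := fun _ _ => measureReal_nonneg
  have hhalf : (1 / 2 : ℝ≥0∞) = ENNReal.ofReal (1 / 2) := by
    rw [ENNReal.ofReal_div_of_pos two_pos]; simp
  rw [← ENNReal.ofReal_toReal hτ] at h1 h2 ⊢
  set t := τ.toReal
  have ht : 0 ≤ t := ENNReal.toReal_nonneg
  rw [e μ, e ν, ← ENNReal.ofReal_add (n _ _) ht, ENNReal.ofReal_le_ofReal_iff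
    (add_nonneg (n _ _) ht)] at h1 h2
  rw [e μ, e μ, ← ENNReal.ofReal_add (n _ _) (n _ _), ENNReal.ofReal_eq_one] at hμ
  rw [e ν, e ν, ← ENNReal.ofReal_add (n _ _) (n _ _), ENNReal.ofReal_eq_one] at hν
  rw [hhalf, ← ENNReal.ofReal_sub _ ht, e μ, e μ, e ν, e ν, ← ENNReal.ofReal_mul (n _ _),
    ← ENNReal.ofReal_mul (n _ _), ← ENNReal.ofReal_add (mul_nonneg (n _ _) (n _ _))
      (mul_nonneg (n _ _) (n _ _))]
  refine ENNReal.ofReal_le_ofReal ?_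
  have ha := n μ {true}
  have hb := n ν {true}
  have ha1 := n μ {false}
  have hb1 := n ν {false}
  set a := μ.real {true}
  set b := ν.real {true}
  have ea : μ.real {false} = 1 - a := by linarith
  have eb : ν.real {false} = 1 - b := by linarith
  rw [ea] at ha1 ⊢
  rw [eb] at hb1 ⊢
  have hd : |a - b| ≤ t := abs_le.2 ⟨by linarith, by linarith⟩
  have hd1 : |a - b| ≤ 1 := abs_le.2 ⟨by linarith, by linarith⟩
  have hsq : (a - b) ^ 2 ≤ |a - b| := by
    rw [← sq_abs, pow_two]
    exact mul_le_of_le_one_left (abs_nonneg _) hd1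
  nlinarith [sq_nonneg (a + b - 1)]

lemma coupledAgreement_le_one (g₁ g₂ : DGP K M) {N T : ℕ} (D : Test K M N T) :
    coupledAgreement g₁ g₂ 𝒮 D ≤ 1 := by
  refine iSup_le fun π => iSup_le fun h1 => iSup_le fun _ => ?_
  calc π {p | p.1 = p.2} ≤ π Set.univ := measure_mono (Set.subset_univ _)
    _ = decisionLaw g₁ 𝒮 D Set.univ := by
      rw [← h1, Measure.map_apply measurable_fst MeasurableSet.univ, Set.preimage_univ]
    _ ≤ 1 := decisionLaw_univ_le_one 𝒮 g₁ D

lemma coupledAgreement_shiftDGP {N T : ℕ} (hT : 0 < T) (D : Test K M N T) :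
    1 - shiftDistance c ≤ coupledAgreement (shiftDGP M 𝒮 c) (shiftDGP M 𝒮 0) 𝒮 D := by
  have := isProbabilityMeasure_decisionLaw 𝒮 c D
  have := isProbabilityMeasure_decisionLaw 𝒮 0 D
  obtain ⟨h1, h2⟩ := decisionLaw_close 𝒮 c hT D {true}
  obtain ⟨π, hf, hs, hle⟩ := exists_coupling_bool h1 h2
  exact hle.trans (le_iSup_of_le π (le_iSup_of_le hf (le_iSup_of_le hs le_rfl)))

lemma independentAgreement_shiftDGP {N T : ℕ} (hT : 0 < T) (D : Test K M N T) :
    1 / 2 - shiftDistance c ≤ independentAgreement (shiftDGP M 𝒮 c) (shiftDGP M 𝒮 0) 𝒮 D := by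
  have := isProbabilityMeasure_decisionLaw 𝒮 c D
  have := isProbabilityMeasure_decisionLaw 𝒮 0 D
  obtain ⟨h1, h2⟩ := decisionLaw_close 𝒮 c hT D {true}
  exact half_le_prod_agreement h1 h2

/-- The fair coin. -/
def coinLaw : Measure Bool := (1 / 2 : ℝ≥0∞) • Measure.count

instance : IsProbabilityMeasure coinLaw :=
  ⟨by
    rw [coinLaw, Measure.smul_apply, Measure.count_univ, ENat.card_eq_coe_fintype_card,
      Fintype.card_bool, smul_eq_mul]
    exact ENNReal.div_mul_cancel (by simp) (by simp)⟩

/-- The test that ignores the sample and tosses a fair coin. -/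
def coinTest (K M N T : ℕ) : Test K M N T := ⟨Kernel.const _ coinLaw, inferInstance⟩

/-- Each decision has mass at most `1/2` under either process, so the two products add up to at most
`1/2`. This caps the minimax value and supplies the upper half of the exact constant. -/
lemma independentAgreement_coinTest (g₁ g₂ : DGP K M) (N T : ℕ) :
    independentAgreement g₁ g₂ 𝒮 (coinTest K M N T) ≤ 1 / 2 := by
  have hle : ∀ (g : DGP K M) (b : Bool), decisionLaw g 𝒮 (coinTest K M N T) {b} ≤ 1 / 2 := by
    intro g b
    rw [decisionLaw_apply]
    simp only [coinTest, Kernel.const_apply, coinLaw, Measure.smul_apply, Measure.count_singleton,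
      smul_eq_mul, mul_one, lintegral_const]
    exact (mul_le_mul_right (dataLaw_univ_le_one 𝒮 g N T) _).trans (by simp)
  have hfin : ∀ g : DGP K M, IsFiniteMeasure (decisionLaw g 𝒮 (coinTest K M N T)) := fun g =>
    ⟨(decisionLaw_univ_le_one 𝒮 g _).trans_lt ENNReal.one_lt_top⟩
  have := hfin g₁
  have := hfin g₂
  rw [independentAgreement, prod_agreement]
  calc _ ≤ (1 / 2 : ℝ≥0∞) * (1 / 2) + (1 / 2) * (1 / 2) := by gcongr <;> exact hle _ _
    _ = 1 / 2 := by
      rw [← mul_add, ENNReal.add_halves, mul_one]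

lemma eventually_pos_snd : ∀ᶠ n : ℕ × ℕ in atTop ×ˢ atTop, 0 < n.2 :=
  tendsto_snd.eventually (eventually_gt_atTop 0)

variable {𝒮}

lemma le_coupledAgreementLimit {C₁ C₂ : Set (DGP K M)} (h1 : shiftDGP M 𝒮 c ∈ C₁)
    (h2 : shiftDGP M 𝒮 0 ∈ C₂) : 1 - shiftDistance c ≤ coupledAgreementLimit 𝒮 C₁ C₂ := by
  refine le_liminf_of_le (by isBoundedDefault) ?_
  filter_upwards [eventually_pos_snd] with n hn
  exact le_iInf fun D => (coupledAgreement_shiftDGP 𝒮 c hn D).trans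
    (le_iSup₂_of_le _ h1 (le_iSup₂_of_le _ h2 le_rfl))

lemma le_independentAgreementLimit {C₁ C₂ : Set (DGP K M)} (h1 : shiftDGP M 𝒮 c ∈ C₁)
    (h2 : shiftDGP M 𝒮 0 ∈ C₂) : 1 / 2 - shiftDistance c ≤ independentAgreementLimit 𝒮 C₁ C₂ := by
  refine le_liminf_of_le (by isBoundedDefault) ?_
  filter_upwards [eventually_pos_snd] with n hn
  exact le_iInf fun D => (independentAgreement_shiftDGP 𝒮 c hn D).trans
    (le_iSup₂_of_le _ h1 (le_iSup₂_of_le _ h2 le_rfl))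

lemma coupledAgreementLimit_le_one (C₁ C₂ : Set (DGP K M)) :
    coupledAgreementLimit 𝒮 C₁ C₂ ≤ 1 := by
  refine liminf_le_of_le (by isBoundedDefault) fun b hb => ?_
  obtain ⟨n, hn⟩ := hb.exists
  exact hn.trans ((iInf_le _ (coinTest K M n.1 n.2)).trans
    (iSup₂_le fun g₁ _ => iSup₂_le fun g₂ _ => coupledAgreement_le_one 𝒮 g₁ g₂ _))

lemma independentAgreementLimit_le_half (C₁ C₂ : Set (DGP K M)) :
    independentAgreementLimit 𝒮 C₁ C₂ ≤ 1 / 2 := by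
  refine liminf_le_of_le (by isBoundedDefault) fun b hb => ?_
  obtain ⟨n, hn⟩ := hb.exists
  exact hn.trans ((iInf_le _ (coinTest K M n.1 n.2)).trans
    (iSup₂_le fun g₁ _ => iSup₂_le fun g₂ _ => independentAgreement_coinTest 𝒮 g₁ g₂ _ _))

/-- The two regimes cannot be told apart. -/
theorem agreement_limits (M : ℕ) [NeZero M] (𝒮 : Design K) :
    (coupledAgreementLimit 𝒮 (classIN M 𝒮) (classVN M 𝒮) = 1 ∧
      independentAgreementLimit 𝒮 (classIN M 𝒮) (classVN M 𝒮) = 1 / 2) ∧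
      ∀ η : ℝ≥0∞, 0 < η → ∃ F₁ F₂ : Set (DGP K M), F₁.Finite ∧ F₂.Finite ∧
        F₁ ⊆ classIN M 𝒮 ∧ F₂ ⊆ classVN M 𝒮 ∧
        ∀ C₁ C₂ : Set (DGP K M), F₁ ⊆ C₁ → C₁ ⊆ classIN M 𝒮 →
          F₂ ⊆ C₂ → C₂ ⊆ classVN M 𝒮 →
          1 - η ≤ coupledAgreementLimit 𝒮 C₁ C₂ ∧
          1 / 2 - η ≤ independentAgreementLimit 𝒮 C₁ C₂ := by
  have key : ∀ η : ℝ≥0∞, 0 < η → ∃ c : ℝ, 0 < c ∧ shiftDistance c ≤ η := by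
    intro η hη
    obtain ⟨r, hr, h⟩ := exists_shiftDistance_lt hη
    exact ⟨r / 2, half_pos hr, (h _ (half_pos hr) (half_lt_self hr)).le⟩
  refine ⟨⟨le_antisymm (coupledAgreementLimit_le_one _ _) ?_,
    le_antisymm (independentAgreementLimit_le_half _ _) ?_⟩, fun η hη => ?_⟩
  · refine ENNReal.le_of_forall_pos_le_add fun ε hε _ => ?_
    obtain ⟨c, hc, hcε⟩ := key ε (by exact_mod_cast hε)
    exact tsub_le_iff_right.1 ((tsub_le_tsub_left hcε 1).trans
      (le_coupledAgreementLimit c (shiftDGP_mem_classIN 𝒮 c hc.ne') (shiftDGP_mem_classVN 𝒮)))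
  · refine ENNReal.le_of_forall_pos_le_add fun ε hε _ => ?_
    obtain ⟨c, hc, hcε⟩ := key ε (by exact_mod_cast hε)
    exact tsub_le_iff_right.1 ((tsub_le_tsub_left hcε _).trans
      (le_independentAgreementLimit c (shiftDGP_mem_classIN 𝒮 c hc.ne') (shiftDGP_mem_classVN 𝒮)))
  · obtain ⟨c, hc, hcη⟩ := key η hη
    refine ⟨{shiftDGP M 𝒮 c}, {shiftDGP M 𝒮 0}, Set.finite_singleton _, Set.finite_singleton _,
      Set.singleton_subset_iff.2 (shiftDGP_mem_classIN 𝒮 c hc.ne'),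
      Set.singleton_subset_iff.2 (shiftDGP_mem_classVN 𝒮), fun C₁ C₂ h1 _ h2 _ => ⟨?_, ?_⟩⟩
    · exact (tsub_le_tsub_left hcη 1).trans (le_coupledAgreementLimit c
        (Set.singleton_subset_iff.1 h1) (Set.singleton_subset_iff.1 h2))
    · exact (tsub_le_tsub_left hcη _).trans (le_independentAgreementLimit c
        (Set.singleton_subset_iff.1 h1) (Set.singleton_subset_iff.1 h2))

end

section

variable {K M : ℕ} [NeZero K] [NeZero M] (𝒮 : Design K) (c : ℝ)

/-! ### The limit law of the family -/

/-- For `c² ≤ 1` the value `T σ_a² = c²/K` does not exceed `1`, so `√(NT)` attains the minimum in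
the rate, and the interaction enters the target with weight exactly `1`. -/
lemma rate_shiftDGP (hc : c ^ 2 ≤ 1) {N T : ℕ} (hN : 0 < N) (hT : 0 < T) :
    (shiftDGP M 𝒮 c).rate 𝒮 N T = √((N : ℝ) * T) := by
  have hT' : (T : ℝ) ≠ 0 := by exact_mod_cast hT.ne'
  have hK : (1 : ℝ) ≤ K := by exact_mod_cast NeZero.one_le
  rw [DGP.rate, varA_shiftDGP 𝒮 c hN, varD_shiftDGP, if_pos rfl, max_eq_left, div_one]
  refine max_le ?_ (by simp)
  rw [Real.sqrt_le_iff, mul_div_assoc', mul_div_mul_left _ _ hT', one_pow]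
  refine ⟨zero_le_one, ?_⟩
  exact div_le_one_of_le₀ (hc.trans hK) (by positivity)

/-- Cross terms vanish by independence and centring, and the `n` diagonal terms cancel the
normalization. Orthonormality of the systems thus becomes independence of the corresponding jointly
Gaussian variables. -/
lemma covariance_normalized_sum {ι X : Type*} [MeasurableSpace X] {μ : Measure X}
    [IsProbabilityMeasure μ] {n : ℕ} (hn : 0 < n) {s : Fin n → ι} (hs : s.Injective) {F G : X → ℝ}
    (hF : Measurable F) (hG : Measurable G) (hF2 : MemLp F 2 μ) (hG2 : MemLp G 2 μ)
    (hF0 : ∫ x, F x ∂μ = 0) :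
    cov[fun w => 1 / √(n : ℝ) * ∑ i, F (w (s i)), fun w => 1 / √(n : ℝ) * ∑ i, G (w (s i));
      Measure.infinitePi fun _ : ι => μ] = ∫ x, F x * G x ∂μ := by
  classical
  rw [covariance_const_mul_left, covariance_const_mul_right, covariance_fun_sum_fun_sum
    (fun i => memLp_infinitePi_eval hF2 (s i)) (fun i => memLp_infinitePi_eval hG2 (s i))]
  have h : ∀ i j : Fin n, cov[fun w : ι → X => F (w (s i)), fun w => G (w (s j));
      Measure.infinitePi fun _ : ι => μ] = if i = j then ∫ x, F x * G x ∂μ else 0 := by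
    intro i j
    rw [covariance_eq_sub (memLp_infinitePi_eval hF2 (s i)) (memLp_infinitePi_eval hG2 (s j)),
      integral_infinitePi_eval hF, hF0, zero_mul, sub_zero]
    have := integral_infinitePi_mul (μ := μ) hF hG (s i) (s j)
    simp only [hF0, zero_mul, hs.eq_iff] at this
    exact this
  simp only [h]
  rw [sum_sum_diagonal, ← mul_assoc, ← mul_assoc]
  have hn' : (0 : ℝ) < n := by exact_mod_cast hn
  have : 1 / √(n : ℝ) * (1 / √(n : ℝ)) * n = 1 := by
    rw [div_mul_div_comm, Real.mul_self_sqrt hn'.le]; field_simp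
  rw [this, one_mul]

lemma isGaussianProcess_eval (ι : Type*) :
    IsGaussianProcess (fun (j : ι) (w : ι → ℝ) => w j) (Measure.infinitePi fun _ => stdNormal) where
  hasGaussianLaw J := by
    refine iIndepFun.hasGaussianLaw (X := fun (j : J) (w : ι → ℝ) => w j) (fun j => ⟨?_⟩) ?_
    · rw [(measurePreserving_infinitePi_eval (μ := stdNormal) (j : ι)).map_eq]
      infer_instance
    · exact (iIndepFun_infinitePi (P := fun _ : ι => stdNormal) (X := fun _ => id)
        fun _ => measurable_id).precomp Subtype.val_injective

lemma IsGaussianProcess.comp_measurePreserving {Ω Ω' J : Type*} [MeasurableSpace Ω]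
    [MeasurableSpace Ω'] {P : Measure Ω} {P' : Measure Ω'} {X : J → Ω → ℝ}
    (hX : IsGaussianProcess X P) {f : Ω' → Ω} (hf : MeasurePreserving f P' P) :
    IsGaussianProcess (fun j ω => X j (f ω)) P' where
  hasGaussianLaw J' := by
    have h := hX.hasGaussianLaw J'
    refine ⟨?_⟩
    have h2 := h.isGaussian_map
    rw [← hf.map_eq] at h2 h
    rwa [AEMeasurable.map_map_of_aemeasurable h.aemeasurable hf.measurable.aemeasurable] at h2

lemma covariance_comp_measurePreserving {Ω Ω' : Type*} [MeasurableSpace Ω] [MeasurableSpace Ω']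
    {P : Measure Ω} {P' : Measure Ω'} {f : Ω' → Ω} (hf : MeasurePreserving f P' P) {X Y : Ω → ℝ}
    (hX : Measurable X) (hY : Measurable Y) :
    cov[fun ω => X (f ω), fun ω => Y (f ω); P'] = cov[X, Y; P] := by
  rw [← hf.map_eq, covariance_map hX.aestronglyMeasurable hY.aestronglyMeasurable
    hf.measurable.aemeasurable]
  rfl

lemma covariance_normal {ι : Type*} [DecidableEq ι] (i j : ι) :
    cov[fun w : ι → ℝ => w i, fun w => w j; Measure.infinitePi fun _ => stdNormal]
      = if i = j then 1 else 0 := by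
  have h2 : MemLp (fun x : ℝ => x) 2 stdNormal := memLp_id_gaussianReal 2
  rw [covariance_eq_sub (memLp_infinitePi_eval h2 i) (memLp_infinitePi_eval h2 j),
    integral_infinitePi_eval (F := fun x => x) measurable_id]
  have := integral_infinitePi_mul (μ := stdNormal) (F := fun x => x) (G := fun x => x)
    measurable_id measurable_id i j
  simp only [integral_id_gaussianReal, zero_mul, integral_stdNormal_mul] at this
  simpa [integral_id_gaussianReal] using this

/-- Independent standard normal variables: one for each member of the row system and one for each
member of the time system. -/
abbrev NormalSpace (K : ℕ) : Type := (Fin K ⊕ ℕ → ℝ) × (ℕ → ℝ)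

/-- The law of the independent standard normal variables. -/
abbrev normalLaw (K : ℕ) : Measure (NormalSpace K) :=
  (Measure.infinitePi fun _ => stdNormal).prod normalSequence

/-- The factor and the normal variable that represent a row primitive. -/
def rowCoef (K : ℕ) (c : ℝ) : Fin K ⊕ (ℕ × Fin K) → ℝ
  | .inl _ => c * (√(K : ℝ))⁻¹
  | .inr _ => 1

/-- The index of the normal variable that represents a row primitive. -/
def rowIndex : Fin K ⊕ (ℕ × Fin K) → Fin K ⊕ ℕ
  | .inl k => .inl k
  | .inr p => systemIndex p

/-- The factor that represents a time primitive. -/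
def timeCoef : Fin K ⊕ (ℕ × Fin K) → ℝ
  | .inl _ => 0
  | .inr _ => 1

/-- The index of the normal variable that represents a time primitive. -/
def timeIndex : Fin K ⊕ (ℕ × Fin K) → ℕ
  | .inl _ => 0
  | .inr p => p.1

/-- The limit variable. -/
def limitVariable (K : ℕ) (c : ℝ) (w : NormalSpace K) (k : Fin K) : ℝ :=
  (√(K : ℝ))⁻¹ * (w.1 (.inl k) * (w.2 0 + c))

lemma measurable_limitVariable : Measurable (limitVariable K c) := by
  unfold limitVariable; fun_prop

/-- The limit law. -/
def shiftLimit (K : ℕ) (c : ℝ) : Measure (Fin K → ℝ) := (normalLaw K).map (limitVariable K c)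

instance : IsProbabilityMeasure (shiftLimit K c) :=
  Measure.isProbabilityMeasure_map (measurable_limitVariable c).aemeasurable

variable {N T : ℕ}

lemma rowPrimitive_shiftDGP (hc : c ^ 2 ≤ 1) (hN : 0 < N) (hT : 0 < T)
    (p : Fin K ⊕ (ℕ × Fin K)) :
    rowPrimitive (shiftDGP M 𝒮 c) 𝒮 N T p = fun w => rowCoef K c p *
      (1 / √(N : ℝ) * ∑ i : Fin N, rowScore (rowIndex p) (w (𝒮.site i))) := by
  ext w
  rcases p with k | ⟨l, k⟩
  · simp only [rowPrimitive, rate_shiftDGP 𝒮 c hc hN hT, aFun_shiftDGP, rowPart, rowCoef, rowIndex]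
    have hN' : √(N : ℝ) ≠ 0 := Real.sqrt_ne_zero'.2 (by exact_mod_cast hN)
    have hT' : √(T : ℝ) ≠ 0 := Real.sqrt_ne_zero'.2 (by exact_mod_cast hT)
    have hNs : (N : ℝ) = √(N : ℝ) * √(N : ℝ) := (Real.mul_self_sqrt (by positivity)).symm
    simp only [← Finset.mul_sum]
    rw [Real.sqrt_mul (by positivity)]
    nth_rewrite 2 [hNs]
    field_simp
  · simp only [rowPrimitive, rowCoef, rowIndex, one_mul, shiftDGP_φ]

lemma timePrimitive_shiftDGP (p : Fin K ⊕ (ℕ × Fin K)) :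
    timePrimitive (shiftDGP M 𝒮 c) 𝒮 N T p = fun w => timeCoef p *
      (1 / √(T : ℝ) * ∑ t : Fin T, timeNormal (timeIndex p) (w (t : ℤ))) := by
  ext w
  rcases p with k | ⟨l, k⟩
  · simp [timePrimitive, dFun_shiftDGP, timeCoef]
  · simp only [timePrimitive, timeCoef, timeIndex, one_mul]
    rfl

/-- The row primitives `inl k` and `inr (0, k)` are multiples of the same normalized sum, so they
are represented by the same normal variable `Z_k`. The linear part `c Z_k / √K` and the only
interaction term `Z_k W / √K` then combine into `Z_k (W + c) / √K`. -/
lemma isLimitRepresentation_shiftDGP (hc : c ^ 2 ≤ 1) (hN : 0 < N) (hT : 0 < T) :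
    IsLimitRepresentation (shiftDGP M 𝒮 c) 𝒮 N T (normalLaw K)
      (fun p w => rowCoef K c p * w.1 (rowIndex p)) (fun p w => timeCoef p * w.2 (timeIndex p))
      (fun _ _ => 0) (limitVariable K c) where
  measurable_A p := by fun_prop
  measurable_D p := by fun_prop
  measurable_E k := measurable_const
  measurable_L := measurable_limitVariable c
  gaussian_A := IsGaussianProcess.comp_measurePreserving
    (((isGaussianProcess_eval (Fin K ⊕ ℕ)).comp_right rowIndex).smul (rowCoef K c))
    measurePreserving_fst
  gaussian_D := IsGaussianProcess.comp_measurePreserving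
    (((isGaussianProcess_eval ℕ).comp_right timeIndex).smul timeCoef) measurePreserving_snd
  gaussian_E := by
    have := ((isGaussianProcess_eval ℕ).comp_right fun _ : Fin K => 0).smul fun _ => 0
    simpa using IsGaussianProcess.comp_measurePreserving this
      (measurePreserving_snd (μ := Measure.infinitePi fun _ : Fin K ⊕ ℕ => stdNormal))
  mean_A p := by
    rw [integral_const_mul, integral_fun_fst fun w : Fin K ⊕ ℕ → ℝ => w (rowIndex p),
      integral_infinitePi_eval (F := fun x => x) measurable_id, integral_id_gaussianReal]
    simp
  mean_D p := by
    rw [integral_const_mul, integral_fun_snd fun w : ℕ → ℝ => w (timeIndex p),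
      integral_infinitePi_eval (F := fun x => x) measurable_id, integral_id_gaussianReal]
    simp
  mean_E k := by simp
  cov_A p q := by
    rw [rowPrimitive_shiftDGP 𝒮 c hc hN hT, rowPrimitive_shiftDGP 𝒮 c hc hN hT,
      covariance_const_mul_left, covariance_const_mul_right, covariance_const_mul_left,
      covariance_const_mul_right, shiftDGP_rowMeasure, covariance_normalized_sum hN
      (site_fin_injective 𝒮 N) (measurable_rowScore _) (measurable_rowScore _)
      (memLp_rowScore _ (by simp)) (memLp_rowScore _ (by simp)) (integral_rowScore _),
      integral_rowScore_mul, ← covariance_normal]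
    congr 2
    exact covariance_comp_measurePreserving measurePreserving_fst (X := fun w : Fin K ⊕ ℕ → ℝ => w (rowIndex p))
      (Y := fun w : Fin K ⊕ ℕ → ℝ => w (rowIndex q)) (measurable_pi_apply _) (measurable_pi_apply _)
  cov_D p q := by
    rw [timePrimitive_shiftDGP, timePrimitive_shiftDGP,
      covariance_const_mul_left, covariance_const_mul_right, covariance_const_mul_left,
      covariance_const_mul_right, shiftDGP_timeMeasure, covariance_normalized_sum hT
      (s := fun t : Fin T => (t : ℤ)) (fun a b h => Fin.ext (by simpa using h))
      (measurable_timeNormal _) (measurable_timeNormal _)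
      (memLp_timeNormal _ (by simp)) (memLp_timeNormal _ (by simp)) (integral_timeNormal _),
      integral_timeNormal_mul, ← covariance_normal]
    congr 2
    exact covariance_comp_measurePreserving measurePreserving_snd (X := fun w : ℕ → ℝ => w (timeIndex p))
      (Y := fun w : ℕ → ℝ => w (timeIndex q)) (measurable_pi_apply _) (measurable_pi_apply _)
  cov_E k l := by rw [varE_shiftDGP, mul_zero]; simp [covariance]
  indep_A := indepFun_prod (X := fun (w : Fin K ⊕ ℕ → ℝ) p => rowCoef K c p * w (rowIndex p))
    (Y := fun (w : ℕ → ℝ) => ((fun p : Fin K ⊕ (ℕ × Fin K) => timeCoef p * w (timeIndex p)),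
      fun _ : Fin K => (0 : ℝ))) (by fun_prop) (by fun_prop)
  indep_D := indepFun_const_right _ _
  series k := by
    refine tendsto_const_nhds.congr' ?_
    filter_upwards [eventually_ge_atTop {((0 : ℕ), (0 : ℕ))}] with S hS
    have hmem : ((0 : ℕ), (0 : ℕ)) ∈ S := hS (Finset.mem_singleton_self _)
    have hne : √((N : ℝ) * T) ≠ 0 := Real.sqrt_ne_zero'.2
      (mul_pos (by exact_mod_cast hN) (by exact_mod_cast hT))
    rw [rate_shiftDGP 𝒮 c hc hN hT, div_self hne]
    refine Eq.symm (Eq.trans (congrArg (eLpNorm · 2 (normalLaw K)) (a₂ := 0) ?_) eLpNorm_zero)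
    ext w
    rw [Finset.sum_eq_single_of_mem _ hmem]
    · simp only [limitVariable, rowCoef, timeCoef, rowIndex, timeIndex, systemIndex, shiftDGP,
        and_self, if_true, Pi.zero_apply]
      ring
    · rintro ⟨l, l'⟩ _ hl
      have : ¬(l = 0 ∧ l' = 0) := fun h => hl (by rw [h.1, h.2])
      simp [shiftDGP, this]

lemma shiftLimit_mem_limitLaw (hc : c ^ 2 ≤ 1) (hN : 0 < N) (hT : 0 < T) :
    shiftLimit K c ∈ limitLaw (shiftDGP M 𝒮 c) 𝒮 N T :=
  ⟨NormalSpace K, inferInstance, normalLaw K, inferInstance, _, _, _, _,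
    isLimitRepresentation_shiftDGP 𝒮 c hc hN hT, rfl⟩

/-- Links the target law in dimension `K` to the scalar distribution functions, in which the
dependence on `c` is strictly monotone. -/
lemma shiftLimit_apply_abs (y : ℝ) :
    (shiftLimit K c).real {v | |v 0| ≤ (√(K : ℝ))⁻¹ * y} = prodNormalCDF c y := by
  have hK : 0 < (√(K : ℝ))⁻¹ := inv_pos.2 (Real.sqrt_pos.2 (by simp [NeZero.pos K]))
  have hm := (measurePreserving_infinitePi_eval (μ := stdNormal) (Sum.inl (0 : Fin K) : Fin K ⊕ ℕ)).prod
    (measurePreserving_infinitePi_eval (μ := stdNormal) (0 : ℕ))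
  rw [shiftLimit, map_measureReal_apply (measurable_limitVariable c)
    (measurableSet_le (by fun_prop) measurable_const), prodNormalCDF, ← hm.map_eq,
    map_measureReal_apply hm.measurable (measurableSet_prodNormal c y)]
  congr 1
  ext w
  simp only [Set.mem_preimage, Set.mem_ofPred_eq, limitVariable, abs_mul, abs_of_pos hK,
    mul_le_mul_iff_right₀ hK, Prod.map]

/-- Laws on `ℝᴷ` with the same distribution function have the same first marginal. -/
lemma map_eval_eq_of_Iic {μ ν : Measure (Fin K → ℝ)} [IsProbabilityMeasure μ]
    [IsProbabilityMeasure ν] (h : ∀ x, μ (Set.Iic x) = ν (Set.Iic x)) :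
    μ.map (fun v => v 0) = ν.map (fun v => v 0) := by
  have hm : Measurable fun v : Fin K → ℝ => v 0 := measurable_pi_apply 0
  have : IsProbabilityMeasure (μ.map fun v => v 0) :=
    Measure.isProbabilityMeasure_map hm.aemeasurable
  refine Measure.ext_of_Iic _ _ fun q => ?_
  rw [Measure.map_apply hm measurableSet_Iic, Measure.map_apply hm measurableSet_Iic]
  -- Corners whose first coordinate stays at `q` while the others grow: their lower orthants
  -- increase to the half-space that determines the first marginal at `q`.
  set x : ℕ → Fin K → ℝ := fun n k => if k = 0 then q else n with hx
  have hmono : Monotone fun n => Set.Iic (x n) := fun m n hmn => Set.Iic_subset_Iic.2 fun k => by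
    simp only [hx]
    split_ifs
    · exact le_rfl
    · exact_mod_cast hmn
  have hU : (fun v : Fin K → ℝ => v 0) ⁻¹' Set.Iic q = ⋃ n, Set.Iic (x n) := by
    ext v
    simp only [Set.mem_preimage, Set.mem_Iic, Set.mem_iUnion]
    constructor
    · intro hv
      obtain ⟨n, hn⟩ := exists_nat_ge (∑ k, |v k|)
      refine ⟨n, fun k => ?_⟩
      simp only [hx]
      split_ifs with hk
      · exact hk ▸ hv
      · exact (le_abs_self _).trans
          ((Finset.single_le_sum (f := fun k => |v k|) (fun _ _ => abs_nonneg _)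
            (Finset.mem_univ k)).trans hn)
    · rintro ⟨n, hn⟩
      simpa [hx] using hn 0
  rw [hU]
  have h1 := tendsto_measure_iUnion_atTop (μ := μ) hmono
  have h2 := tendsto_measure_iUnion_atTop (μ := ν) hmono
  simp only [Function.comp_def, h] at h1 h2
  exact tendsto_nhds_unique h1 h2

/-- If all lower orthants had equal mass, the first marginals would coincide, and with them the
probabilities that the modulus of the first coordinate is at most `1/√K`. Those differ by strict
monotonicity in the shift. -/
lemma exists_shiftLimit_ne {c c' : ℝ} (hc : 0 ≤ c) (hcc : c < c') :
    ∃ x, (shiftLimit K c).real (Set.Iic x) ≠ (shiftLimit K c').real (Set.Iic x) := by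
  by_contra! h
  have h' : ∀ x, shiftLimit K c (Set.Iic x) = shiftLimit K c' (Set.Iic x) := fun x =>
    (measureReal_eq_measureReal_iff).1 (h x)
  have hmap := map_eval_eq_of_Iic h'
  have hlt := prodNormalCDF_lt hc hcc one_pos
  have hset : MeasurableSet {x : ℝ | |x| ≤ (√(K : ℝ))⁻¹ * 1} :=
    measurableSet_le (by fun_prop) measurable_const
  have hm : Measurable fun v : Fin K → ℝ => v 0 := measurable_pi_apply 0
  have e : ∀ c, ((shiftLimit K c).map fun v => v 0).real {x : ℝ | |x| ≤ (√(K : ℝ))⁻¹ * 1}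
      = prodNormalCDF c 1 := fun c =>
    (map_measureReal_apply hm hset).trans (shiftLimit_apply_abs c 1)
  exact hlt.ne' (by rw [← e, ← e, hmap])

/-! ### Impossibility of estimating the limit law -/

/-- The family of differences is bounded by `1`. This has to be shown, since a real supremum of an
unbounded family would default to `0`. -/
lemma abs_sub_le_kolmogorov {V : Type*} [MeasurableSpace V] [Preorder V] (μ ν : Measure V)
    [IsProbabilityMeasure μ] [IsProbabilityMeasure ν] (x : V) :
    |μ.real (Set.Iic x) - ν.real (Set.Iic x)| ≤ kolmogorov μ ν := by
  refine le_ciSup (f := fun x => |μ.real (Set.Iic x) - ν.real (Set.Iic x)|) ⟨1, ?_⟩ x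
  rintro _ ⟨y, rfl⟩
  have h1 := measureReal_le_one (μ := μ) (s := Set.Iic y)
  have h2 := measureReal_le_one (μ := ν) (s := Set.Iic y)
  have h3 := measureReal_nonneg (μ := μ) (s := Set.Iic y)
  have h4 := measureReal_nonneg (μ := ν) (s := Set.Iic y)
  exact abs_le.2 ⟨by linarith, by linarith⟩

/-- The limit law cannot be estimated over the intermediate regime. -/
theorem estimationRisk_pos (M : ℕ) [NeZero M] (𝒮 : Design K) :
    ∃ ε₁ : ℝ, 0 < ε₁ ∧ ∃ F₁ : Set (DGP K M), F₁.Finite ∧ F₁ ⊆ classIN M 𝒮 ∧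
      ∀ C₁ : Set (DGP K M), F₁ ⊆ C₁ → C₁ ⊆ classIN M 𝒮 → 0 < estimationRisk 𝒮 C₁ ε₁ := by
  -- Both shifts are taken below `r`, so each sample law is within `1/4` of the unshifted one, and
  -- below `1`, so that `rate_shiftDGP` applies to both.
  obtain ⟨r, hr, hτ⟩ := exists_shiftDistance_lt (η := 1 / 4) (by simp)
  set s := min r 1
  have hs : 0 < s := lt_min hr one_pos
  have hs1 : s ≤ 1 := min_le_right _ _
  set a := s / 3
  set b := s / 2
  have ha : 0 < a := by positivity
  have hb : 0 < b := by positivity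
  have hab : a < b := by simp only [a, b]; linarith
  have hτa := hτ a ha (by have := min_le_left r 1; simp only [a]; linarith)
  have hτb := hτ b hb (by have := min_le_left r 1; simp only [b]; linarith)
  have ha1 : a ^ 2 ≤ 1 := by simp only [a]; nlinarith
  have hb1 : b ^ 2 ≤ 1 := by simp only [b]; nlinarith
  obtain ⟨x, hx⟩ := exists_shiftLimit_ne (K := K) ha.le hab
  set d := |(shiftLimit K a).real (Set.Iic x) - (shiftLimit K b).real (Set.Iic x)|
  have hd : 0 < d := abs_pos.2 (sub_ne_zero.2 hx)
  -- An estimate within `d/3` of both targets would bring their distribution functions at `x` within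
  -- `2d/3`, less than their gap `d`. So every sample is a miss for at least one of the two.
  refine ⟨d / 3, by positivity, {shiftDGP M 𝒮 a, shiftDGP M 𝒮 b}, by simp, ?_, fun C₁ hF _ => ?_⟩
  · rintro g (rfl | rfl)
    · exact shiftDGP_mem_classIN 𝒮 a ha.ne'
    · exact shiftDGP_mem_classIN 𝒮 b hb.ne'
  refine lt_of_lt_of_le (show (0 : ℝ≥0∞) < 1 / 4 by simp) (le_liminf_of_le (by isBoundedDefault) ?_)
  filter_upwards [(eventually_gt_atTop 0).prod_mk (eventually_gt_atTop 0)] with n hn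
  refine le_iInf fun D => ?_
  have hD := D.2
  set S : ℝ → Set (Panel K M n.1 n.2) := fun c => {z | d / 3 < kolmogorov (D.1 z) (shiftLimit K c)}
  have hcover : (Set.univ : Set (Panel K M n.1 n.2)) ⊆ S a ∪ S b := by
    intro z _
    by_contra hz
    simp only [S, Set.mem_union, Set.mem_ofPred_eq, not_or, not_lt] at hz
    have h1 := (abs_sub_le_kolmogorov (D.1 z) (shiftLimit K a) x).trans hz.1
    have h2 := (abs_sub_le_kolmogorov (D.1 z) (shiftLimit K b) x).trans hz.2
    have h3 : d ≤ d / 3 + d / 3 := by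
      refine le_trans ?_ (add_le_add h1 h2)
      rw [abs_sub_comm ((D.1 z).real _) ((shiftLimit K a).real _)]
      exact abs_sub_le _ _ _
    linarith
  set R := ⨆ g ∈ C₁, ⨆ μ ∈ limitLaw g 𝒮 n.1 n.2,
      g.dataLaw 𝒮 n.1 n.2 {z | d / 3 < kolmogorov (D.1 z) μ}
  have hR : ∀ c : ℝ, c ^ 2 ≤ 1 → shiftDGP M 𝒮 c ∈ C₁ →
      (shiftDGP M 𝒮 c).dataLaw 𝒮 n.1 n.2 (S c) ≤ R := fun c hc hmem =>
    le_iSup₂_of_le _ hmem (le_iSup₂_of_le (f := fun μ _ =>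
      (shiftDGP M 𝒮 c).dataLaw 𝒮 n.1 n.2 {z | d / 3 < kolmogorov (D.1 z) μ}) _
      (shiftLimit_mem_limitLaw 𝒮 c hc hn.1 hn.2) le_rfl)
  have hRa := hR a ha1 (hF (by simp))
  have hRb := hR b hb1 (hF (by simp))
  -- Misses of the second target are moved from the law with shift `a` to the one with shift `b`
  -- through the unshifted law, at cost `1/4` per step. This gives `1 ≤ 2R + 1/2`, that is `R ≥
  -- 1/4`.
  have htotal : (1 : ℝ≥0∞) ≤ R + (R + 1 / 4 + 1 / 4) := by
    calc (1 : ℝ≥0∞) = (shiftDGP M 𝒮 a).dataLaw 𝒮 n.1 n.2 Set.univ := measure_univ.symm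
      _ ≤ (shiftDGP M 𝒮 a).dataLaw 𝒮 n.1 n.2 (S a)
          + (shiftDGP M 𝒮 a).dataLaw 𝒮 n.1 n.2 (S b) :=
        (measure_mono hcover).trans (measure_union_le _ _)
      _ ≤ R + (R + 1 / 4 + 1 / 4) := by
        refine add_le_add hRa (((dataLaw_shift_close 𝒮 a hn.2 (S b)).1.trans
          (add_le_add (dataLaw_shift_close 𝒮 b hn.2 (S b)).2 le_rfl)).trans ?_)
        gcongr
  by_contra! hlt
  have : R + (R + 1 / 4 + 1 / 4) < 1 := by
    have h4 : (1 / 4 : ℝ≥0∞) + 1 / 4 + (1 / 4 + 1 / 4) = 1 := by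
      rw [ENNReal.div_add_div_same, ENNReal.div_add_div_same]
      norm_num
      exact ENNReal.div_self (by simp) (by simp)
    calc R + (R + 1 / 4 + 1 / 4) < 1 / 4 + (1 / 4 + 1 / 4 + 1 / 4) := by
          refine ENNReal.add_lt_add hlt ?_
          refine ENNReal.add_lt_add_of_lt_of_le (by simp) ?_ le_rfl
          exact ENNReal.add_lt_add_of_lt_of_le (by simp) hlt le_rfl
      _ = 1 / 4 + 1 / 4 + (1 / 4 + 1 / 4) := by simp only [add_assoc]
      _ = 1 := h4
  exact absurd htotal (not_le.2 this)

end

section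

variable {K M : ℕ} [NeZero K] [NeZero M] (𝒮 : Design K) (c : ℝ)

/-! ### The estimation error -/

/-- The inverse is the adjugate times the inverse of the determinant, hence a measurable function of
the Gram matrix, also at singular matrices, where it takes the default value. -/
lemma measurable_ols {N T : ℕ} (k : Fin K) : Measurable fun z : Panel K M N T => ols z k := by
  have hA : Measurable fun (z : Panel K M N T) (k l : Fin K) =>
      ∑ i, ∑ t, ∑ m, (z i t).2 m k * (z i t).2 m l := by fun_prop
  have hdet : Continuous fun A : Fin K → Fin K → ℝ => (Matrix.of A).det :=
    Continuous.matrix_det continuous_id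
  have hadj : ∀ l, Continuous fun A : Fin K → Fin K → ℝ => (Matrix.of A).adjugate k l := fun l =>
    (Continuous.matrix_adjugate continuous_id).matrix_elem k l
  simp only [ols, Matrix.mulVec, dotProduct, Matrix.inv_def, Ring.inverse_eq_inv',
    Matrix.smul_apply, smul_eq_mul]
  refine Finset.measurable_sum _ fun l _ => Measurable.mul (Measurable.mul ?_ ?_) (by fun_prop)
  · exact (hdet.measurable.comp hA).inv
  · exact (hadj l).measurable.comp hA

lemma measurable_estimate {N T : ℕ} : Measurable (estimate (M := M) 𝒮 (N := N) (T := T)) :=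
  Finset.measurable_sum _ fun k _ => (measurable_ols k).const_mul _

/-- The number of clusters with label `k`. -/
def labelCount {N : ℕ} (κ : Fin N → Fin K) (k : Fin K) : ℝ := ∑ i, if κ i = k then 1 else 0

/-- The average over clusters in the estimation error. -/
def rowMean {N : ℕ} (ϱ : Fin K → ℝ) (κ : Fin N → Fin K) (g : Fin N → ℝ) : ℝ :=
  ∑ i, ϱ (κ i) / labelCount κ (κ i) * g i

/-- The average over periods in the estimation error. -/
def timeMean {T : ℕ} (w : Fin T → ℝ) : ℝ := (T : ℝ)⁻¹ * ∑ t, w t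

lemma gram_panelMap {N T : ℕ} (p : (Fin N → Fin K × ℝ) × (Fin T → ℝ)) :
    (Matrix.of fun k l => ∑ i, ∑ t, ∑ m,
      (panelMap M 𝒮 p i t).2 m k * (panelMap M 𝒮 p i t).2 m l)
      = Matrix.diagonal fun k => (T : ℝ) * labelCount (fun i => (p.1 i).1) k := by
  ext k l
  have h : ∀ (i : Fin N) (t : Fin T), ∑ m, (panelMap M 𝒮 p i t).2 m k * (panelMap M 𝒮 p i t).2 m l
      = if k = l then (if (p.1 i).1 = k then 1 else 0) else 0 := by
    intro i t
    rw [Finset.sum_eq_single 0]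
    · simp only [panelMap, true_and]
      split_ifs <;> simp_all
    · intro m _ hm; simp [panelMap, hm]
    · simp
  simp only [Matrix.of_apply, h, Matrix.diagonal_apply, labelCount]
  split_ifs
  · simp only [Finset.sum_const, Finset.card_univ, Fintype.card_fin, nsmul_eq_mul,
      ← Finset.mul_sum]
  · simp

lemma moment_panelMap {N T : ℕ} (p : (Fin N → Fin K × ℝ) × (Fin T → ℝ)) (k : Fin K) :
    ∑ i, ∑ t, ∑ m, (panelMap M 𝒮 p i t).2 m k * (panelMap M 𝒮 p i t).1 m
      = (T : ℝ) * labelCount (fun i => (p.1 i).1) k * 𝒮.β₀ k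
        + (∑ i, if (p.1 i).1 = k then (p.1 i).2 else 0) * ∑ t, p.2 t := by
  have h : ∀ (i : Fin N) (t : Fin T), ∑ m, (panelMap M 𝒮 p i t).2 m k * (panelMap M 𝒮 p i t).1 m
      = (if (p.1 i).1 = k then 1 else 0) * 𝒮.β₀ k
        + (if (p.1 i).1 = k then (p.1 i).2 else 0) * p.2 t := by
    intro i t
    rw [Finset.sum_eq_single 0]
    · simp only [panelMap, true_and, if_true, ite_mul, one_mul, zero_mul, Finset.sum_ite_eq,
        Finset.mem_univ]
      split_ifs with h
      · rw [h]
      · simp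
    · intro m _ hm; simp [panelMap, hm]
    · simp
  simp only [h, Finset.sum_add_distrib, Finset.sum_const, Finset.card_univ, Fintype.card_fin,
    nsmul_eq_mul, ← Finset.mul_sum, ← Finset.sum_mul, labelCount]
  ring

lemma ols_panelMap {N T : ℕ} (hT : 0 < T) (p : (Fin N → Fin K × ℝ) × (Fin T → ℝ))
    (hp : ∀ k, labelCount (fun i => (p.1 i).1) k ≠ 0) (k : Fin K) :
    ols (panelMap M 𝒮 p) k = 𝒮.β₀ k + (∑ i, if (p.1 i).1 = k then (p.1 i).2 else 0)
      * (∑ t, p.2 t) / (T * labelCount (fun i => (p.1 i).1) k) := by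
  have hT' : (T : ℝ) ≠ 0 := by exact_mod_cast hT.ne'
  have hne : ∀ k, (T : ℝ) * labelCount (fun i => (p.1 i).1) k ≠ 0 := fun k =>
    mul_ne_zero hT' (hp k)
  have hinv : (Matrix.diagonal fun k => (T : ℝ) * labelCount (fun i => (p.1 i).1) k)⁻¹
      = Matrix.diagonal fun k => ((T : ℝ) * labelCount (fun i => (p.1 i).1) k)⁻¹ := by
    refine Matrix.inv_eq_left_inv ?_
    rw [Matrix.diagonal_mul_diagonal]
    simp only [inv_mul_cancel₀ (hne _)]
    exact Matrix.diagonal_one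
  rw [ols, gram_panelMap, hinv, Matrix.mulVec_diagonal, moment_panelMap]
  have := hp k
  field_simp

/-- Labels make the Gram matrix diagonal with entries `T n_k`, where `n_k` counts clusters with
label `k`. Each coordinate of the error is then the mean of the cluster normals with that label
times the same average over periods, so the latter factors out. -/
lemma estimate_panelMap {N T : ℕ} (hT : 0 < T) (p : (Fin N → Fin K × ℝ) × (Fin T → ℝ))
    (hp : ∀ k, labelCount (fun i => (p.1 i).1) k ≠ 0) :
    estimate 𝒮 (panelMap M 𝒮 p) - 𝒮.target
      = rowMean 𝒮.ϱ (fun i => (p.1 i).1) (fun i => (p.1 i).2) * timeMean p.2 := by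
  have hsum : rowMean 𝒮.ϱ (fun i => (p.1 i).1) (fun i => (p.1 i).2)
      = ∑ k, 𝒮.ϱ k / labelCount (fun i => (p.1 i).1) k
        * ∑ i, if (p.1 i).1 = k then (p.1 i).2 else 0 := by
    simp only [rowMean, Finset.mul_sum]
    rw [Finset.sum_comm]
    refine Finset.sum_congr rfl fun i _ => ?_
    simp
  rw [estimate, Design.target, ← Finset.sum_sub_distrib, hsum, Finset.sum_mul]
  refine Finset.sum_congr rfl fun k _ => ?_
  rw [ols_panelMap 𝒮 hT p hp, timeMean]
  have := hp k
  have hT' : (T : ℝ) ≠ 0 := by exact_mod_cast hT.ne'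
  field_simp
  ring

/-! ### The law of the estimation error -/

lemma map_pi_gaussianReal_sum {n : ℕ} (r : ℝ) (a : Fin n → ℝ) :
    MeasurePreserving (fun w : Fin n → ℝ => ∑ i, a i * w i) (Measure.pi fun _ => gaussianReal r 1)
      (gaussianReal (r * ∑ i, a i) (∑ i, a i ^ 2).toNNReal) := by
  have hev : ∀ i : Fin n, MeasurePreserving (fun w : Fin n → ℝ => w i)
      (Measure.pi fun _ => gaussianReal r 1) (gaussianReal r 1) := fun i =>
    measurePreserving_eval (fun _ : Fin n => gaussianReal r 1) i
  have hind : iIndepFun (fun (i : Fin n) (w : Fin n → ℝ) => a i * w i)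
      (Measure.pi fun _ => gaussianReal r 1) :=
    iIndepFun_pi (X := fun i x => a i * x) fun i => by fun_prop
  have hm : ∀ i : Fin n, Measurable fun w : Fin n → ℝ => a i * w i := fun i =>
    measurable_const.mul (measurable_pi_apply i)
  have hlaw : ∀ i : Fin n, (Measure.pi fun _ : Fin n => gaussianReal r 1).map
      (fun w => a i * w i) = gaussianReal (a i * r)
        (NNReal.mk (a i ^ 2) (sq_nonneg _) * 1) := fun i => by
    have h := Measure.map_map (μ := Measure.pi fun _ : Fin n => gaussianReal r 1)
      (measurable_const_mul (a i)) (hev i).measurable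
    rw [(hev i).map_eq, gaussianReal_map_const_mul] at h
    exact h.symm
  have hg : ∀ i : Fin n, HasGaussianLaw (fun w : Fin n → ℝ => a i * w i)
      (Measure.pi fun _ => gaussianReal r 1) := fun i =>
    ⟨by rw [hlaw]; infer_instance⟩
  have hsum := iIndepFun.hasGaussianLaw_fun_sum hg hind
  have hmean : ∀ i : Fin n, ∫ w : Fin n → ℝ, a i * w i ∂(Measure.pi fun _ => gaussianReal r 1)
      = r * a i := fun i => by
    have h := integral_map (μ := Measure.pi fun _ : Fin n => gaussianReal r 1)
      (φ := fun w : Fin n → ℝ => a i * w i) (hm i).aemeasurable (f := fun x => x) (by fun_prop)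
    rw [hlaw, integral_id_gaussianReal] at h
    rw [← h, mul_comm]
  have hvar : ∀ i : Fin n, Var[fun w : Fin n → ℝ => a i * w i;
      Measure.pi fun _ => gaussianReal r 1] = a i ^ 2 := fun i => by
    have h := variance_map (μ := Measure.pi fun _ : Fin n => gaussianReal r 1)
      (Y := fun w : Fin n → ℝ => a i * w i) (X := fun x => x) (by fun_prop)
      (hm i).aemeasurable
    rw [hlaw, variance_fun_id_gaussianReal] at h
    exact h.symm.trans (by simp)
  refine ⟨by fun_prop, ?_⟩
  have hv := IndepFun.variance_sum (s := Finset.univ) (fun i _ => (hg i).memLp_two)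
    fun i _ j _ hij => hind.indepFun hij
  rw [hsum.map_eq_gaussianReal, integral_finsetSum _ fun i _ => (hg i).integrable]
  simp only [hmean, ← Finset.mul_sum]
  simp only [hvar] at hv
  rw [← hv]
  congr 3
  ext w
  simp

lemma measurePreserving_std_mul (ρ : ℝ) :
    MeasurePreserving (fun x => ρ * x) stdNormal (gaussianReal 0 (ρ ^ 2).toNNReal) := by
  refine ⟨by fun_prop, ?_⟩
  rw [gaussianReal_map_const_mul, mul_zero, mul_one]
  congr 1
  exact (Real.toNNReal_of_nonneg (sq_nonneg ρ)).symm

lemma measurePreserving_std_add :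
    MeasurePreserving (fun x => x + c) stdNormal (gaussianReal c 1) :=
  ⟨by fun_prop, by rw [gaussianReal_map_add_const, zero_add]⟩

/-- The `T` shifts of size `c/√T` add up to a shift by exactly `c` of the normalized mean, which
keeps unit variance. The shift is thus visible in the error at every sample size. -/
lemma measurePreserving_timeMean {T : ℕ} (hT : 0 < T) :
    MeasurePreserving (fun w : Fin T → ℝ => √(T : ℝ) * timeMean w)
      (Measure.pi fun _ => gaussianReal (c / √(T : ℝ)) 1) (gaussianReal c 1) := by
  have hT' : (0 : ℝ) < T := by exact_mod_cast hT
  have hs : √(T : ℝ) ≠ 0 := (Real.sqrt_pos.2 hT').ne'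
  have hss : √(T : ℝ) * √(T : ℝ) = T := Real.mul_self_sqrt hT'.le
  have h := map_pi_gaussianReal_sum (c / √(T : ℝ)) fun _ : Fin T => √(T : ℝ) * (T : ℝ)⁻¹
  have h1 : c / √(T : ℝ) * ∑ _i : Fin T, √(T : ℝ) * (T : ℝ)⁻¹ = c := by
    simp; field_simp
  have h2 : (∑ _i : Fin T, (√(T : ℝ) * (T : ℝ)⁻¹) ^ 2).toNNReal = 1 := by
    simp only [Finset.sum_const, Finset.card_univ, Fintype.card_fin, nsmul_eq_mul, mul_pow,
      Real.sq_sqrt hT'.le]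
    rw [Real.toNNReal_eq_one]
    field_simp
  rw [h1, h2] at h
  convert h using 2 with w
  rw [timeMean, ← mul_assoc, Finset.mul_sum]

/-- The normalized conditional variance of the row average, given the labels. -/
def rowVariance {N : ℕ} (ϱ : Fin K → ℝ) (κ : Fin N → Fin K) : ℝ :=
  ∑ k, ϱ k ^ 2 * (labelCount κ k / N)⁻¹

/-- Group the clusters by label: the `n_k` clusters with label `k` each contribute `N ϱ_k² / n_k²`.
-/
lemma sum_rowWeight_sq {N : ℕ} (ϱ : Fin K → ℝ) (κ : Fin N → Fin K) :
    ∑ i, (√(N : ℝ) * (ϱ (κ i) / labelCount κ (κ i))) ^ 2 = rowVariance ϱ κ := by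
  have h : ∀ i, (√(N : ℝ) * (ϱ (κ i) / labelCount κ (κ i))) ^ 2
      = ∑ k, if κ i = k then N * (ϱ k / labelCount κ k) ^ 2 else 0 := by
    intro i
    rw [Finset.sum_ite_eq, if_pos (Finset.mem_univ _), mul_pow, Real.sq_sqrt (by positivity)]
  simp only [h]
  rw [Finset.sum_comm, rowVariance]
  refine Finset.sum_congr rfl fun k _ => ?_
  have h2 : ∀ i, (if κ i = k then N * (ϱ k / labelCount κ k) ^ 2 else 0)
      = (N * (ϱ k / labelCount κ k) ^ 2) * if κ i = k then 1 else 0 := fun i => by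
    split_ifs <;> simp
  simp only [h2, ← Finset.mul_sum]
  change N * (ϱ k / labelCount κ k) ^ 2 * labelCount κ k = _
  -- An absent label contributes zero on both sides under the convention `x / 0 = 0`.
  by_cases h0 : labelCount κ k = 0
  · simp [h0]
  · rw [inv_div]
    field_simp

lemma measurePreserving_rowMean {N : ℕ} (ϱ : Fin K → ℝ) (κ : Fin N → Fin K) :
    MeasurePreserving (fun g : Fin N → ℝ => √(N : ℝ) * rowMean ϱ κ g)
      (Measure.pi fun _ => stdNormal) (gaussianReal 0 (rowVariance ϱ κ).toNNReal) := by
  have h := map_pi_gaussianReal_sum 0 fun i => √(N : ℝ) * (ϱ (κ i) / labelCount κ (κ i))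
  rw [zero_mul, sum_rowWeight_sq] at h
  convert h using 2 with g
  rw [rowMean, Finset.mul_sum]
  exact Finset.sum_congr rfl fun i _ => by ring

lemma rowVariance_nonneg {N : ℕ} (ϱ : Fin K → ℝ) (κ : Fin N → Fin K) : 0 ≤ rowVariance ϱ κ := by
  rw [← sum_rowWeight_sq]; positivity

lemma labelCount_nonneg {N : ℕ} (κ : Fin N → Fin K) (k : Fin K) : 0 ≤ labelCount κ k :=
  Finset.sum_nonneg fun i _ => by split_ifs <;> simp

lemma rowVariance_pos {N : ℕ} (hN : 0 < N) {κ : Fin N → Fin K} (hκ : ∀ k, labelCount κ k ≠ 0) :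
    0 < rowVariance 𝒮.ϱ κ := by
  have hN' : (0 : ℝ) < N := by exact_mod_cast hN
  have hpos : ∀ k, 0 < (labelCount κ k / N)⁻¹ := fun k =>
    inv_pos.2 (div_pos (lt_of_le_of_ne (labelCount_nonneg κ k) (hκ k).symm) hN')
  have hex : ∃ k, 𝒮.ϱ k ≠ 0 := by
    by_contra! h
    have := 𝒮.ϱ_unit
    simp [h] at this
  obtain ⟨k, hk⟩ := hex
  refine Finset.sum_pos' (fun k _ => mul_nonneg (sq_nonneg _) (hpos k).le)
    ⟨k, Finset.mem_univ k, mul_pos (by positivity) (hpos k)⟩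

/-- With the labels fixed, the two normalized averages are independent and normal, so the law is
that of `ρ |G| |Z + c|` exactly, with `ρ²` the conditional variance. The only asymptotics left
concern the label frequencies. -/
lemma errorProbability_given_labels {N T : ℕ} (hN : 0 < N) (hT : 0 < T) {κ : Fin N → Fin K}
    (hκ : ∀ k, labelCount κ k ≠ 0) (b : ℝ) :
    ((Measure.pi fun _ : Fin N => stdNormal).prod
      (Measure.pi fun _ : Fin T => gaussianReal (c / √(T : ℝ)) 1)).real
        {q | √((N : ℝ) * T) * |rowMean 𝒮.ϱ κ q.1 * timeMean q.2| ≤ b}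
      = prodNormalCDF c (b / √(rowVariance 𝒮.ϱ κ)) := by
  set ρ := √(rowVariance 𝒮.ϱ κ)
  have hρ : 0 < ρ := Real.sqrt_pos.2 (rowVariance_pos 𝒮 hN hκ)
  have hρ2 : ρ ^ 2 = rowVariance 𝒮.ϱ κ := Real.sq_sqrt (rowVariance_nonneg _ _)
  have hset : MeasurableSet {q : ℝ × ℝ | |q.1| * |q.2| ≤ b} :=
    measurableSet_le (by fun_prop) measurable_const
  have h1 := (measurePreserving_rowMean 𝒮.ϱ κ).prod (measurePreserving_timeMean c hT)
  have h2 := (measurePreserving_std_mul ρ).prod (measurePreserving_std_add c)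
  rw [hρ2] at h2
  have e1 := map_measureReal_apply (μ := (Measure.pi fun _ : Fin N => stdNormal).prod
      (Measure.pi fun _ : Fin T => gaussianReal (c / √(T : ℝ)) 1)) h1.measurable hset
  have e2 := map_measureReal_apply (μ := stdNormal.prod stdNormal) h2.measurable hset
  rw [h1.map_eq] at e1
  rw [h2.map_eq, e1] at e2
  have s1 : {q : (Fin N → ℝ) × (Fin T → ℝ) |
      √((N : ℝ) * T) * |rowMean 𝒮.ϱ κ q.1 * timeMean q.2| ≤ b}
      = Prod.map (fun g => √(N : ℝ) * rowMean 𝒮.ϱ κ g) (fun w => √(T : ℝ) * timeMean w) ⁻¹'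
        {q : ℝ × ℝ | |q.1| * |q.2| ≤ b} := by
    ext q
    simp only [Set.mem_ofPred_eq, Set.mem_preimage, Prod.map, abs_mul,
      abs_of_nonneg (Real.sqrt_nonneg _), Real.sqrt_mul (Nat.cast_nonneg N)]
    ring_nf
  have s2 : {q : ℝ × ℝ | |q.1| * |q.2 + c| ≤ b / ρ}
      = Prod.map (fun x => ρ * x) (fun x => x + c) ⁻¹' {q : ℝ × ℝ | |q.1| * |q.2| ≤ b} := by
    ext q
    simp only [Set.mem_ofPred_eq, Set.mem_preimage, Prod.map, abs_mul, abs_of_pos hρ,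
      le_div_iff₀' hρ, mul_assoc]
  rw [s1, prodNormalCDF, s2]
  exact e2

/-- The law of labels, normal variables of the clusters and time effects. -/
lemma measurePreserving_split (N T : ℕ) (r : ℝ) :
    MeasurePreserving (fun p : (Fin N → Fin K × ℝ) × (Fin T → ℝ) =>
      ((fun i => (p.1 i).1), ((fun i => (p.1 i).2), p.2)))
      ((rowMarkLaw K N).prod (Measure.pi fun _ => gaussianReal r 1))
      ((Measure.pi fun _ => uniformLabel K).prod ((Measure.pi fun _ => stdNormal).prod
        (Measure.pi fun _ => gaussianReal r 1))) := by
  have h1 := (measurePreserving_arrowProdEquivProdArrow (Fin K) ℝ (Fin N)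
    (fun _ => uniformLabel K) fun _ => stdNormal).prod
    (MeasurePreserving.id (Measure.pi fun _ : Fin T => gaussianReal r 1))
  exact (measurePreserving_prodAssoc _ _ _).comp h1

/-- The probability that all labels occur and that the normalized error is at most `b`, given
the labels. -/
def coveredGiven {N : ℕ} (𝒮 : Design K) (c b : ℝ) (κ : Fin N → Fin K) : ℝ :=
  open Classical in
  if ∀ k, labelCount κ k ≠ 0 then prodNormalCDF c (b / √(rowVariance 𝒮.ϱ κ)) else 0

/-- All labels occur. -/
def AllLabels {N T : ℕ} (p : (Fin N → Fin K × ℝ) × (Fin T → ℝ)) : Prop :=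
  ∀ k, labelCount (fun i => (p.1 i).1) k ≠ 0

lemma measurable_labels {N : ℕ} {E : Type*} [MeasurableSpace E] (f : (Fin N → Fin K) → E) :
    Measurable f := measurable_of_countable f

lemma measurable_rowMean {N : ℕ} {T : ℕ} :
    Measurable fun q : (Fin N → Fin K) × ((Fin N → ℝ) × (Fin T → ℝ)) =>
      rowMean 𝒮.ϱ q.1 q.2.1 := by
  refine Finset.measurable_sum _ fun i _ => Measurable.mul ?_ (by fun_prop)
  exact (measurable_labels fun κ => 𝒮.ϱ (κ i) / labelCount κ (κ i)).comp measurable_fst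

lemma errorProbability {N T : ℕ} (hN : 0 < N) (hT : 0 < T) (b : ℝ) :
    ((rowMarkLaw K N).prod (Measure.pi fun _ : Fin T => gaussianReal (c / √(T : ℝ)) 1)).real
      {p | AllLabels p ∧ √((N : ℝ) * T) *
        |rowMean 𝒮.ϱ (fun i => (p.1 i).1) (fun i => (p.1 i).2) * timeMean p.2| ≤ b}
      = ∫ κ, coveredGiven 𝒮 c b κ ∂(Measure.pi fun _ : Fin N => uniformLabel K) := by
  set S : Set ((Fin N → Fin K) × ((Fin N → ℝ) × (Fin T → ℝ))) :=
    {q | (∀ k, labelCount q.1 k ≠ 0) ∧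
      √((N : ℝ) * T) * |rowMean 𝒮.ϱ q.1 q.2.1 * timeMean q.2.2| ≤ b} with hSdef
  have hS : MeasurableSet S := by
    refine MeasurableSet.inter ?_ ?_
    · exact measurable_fst (MeasurableSet.of_discrete (s := {κ : Fin N → Fin K |
        ∀ k, labelCount κ k ≠ 0}))
    · have htime : Measurable fun q : (Fin N → Fin K) × ((Fin N → ℝ) × (Fin T → ℝ)) =>
          timeMean q.2.2 := by
        unfold timeMean
        fun_prop
      have herr := (((measurable_rowMean (T := T) (N := N) 𝒮).mul htime).norm).const_mul
        (√((N : ℝ) * T))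
      exact measurableSet_le herr measurable_const
  have hsplit := measurePreserving_split (K := K) N T (c / √(T : ℝ))
  have h1 := map_measureReal_apply (μ := (rowMarkLaw K N).prod
    (Measure.pi fun _ : Fin T => gaussianReal (c / √(T : ℝ)) 1)) hsplit.measurable hS
  rw [hsplit.map_eq] at h1
  refine Eq.trans ?_ (h1.symm.trans ?_)
  · rfl
  rw [measureReal_def, Measure.prod_apply hS, ← integral_toReal
    (measurable_measure_prodMk_left hS).aemeasurable (ae_of_all _ fun x => measure_lt_top _ _)]
  refine integral_congr_ae (ae_of_all _ fun κ => ?_)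
  simp only [coveredGiven]
  split_ifs with hκ
  · rw [← errorProbability_given_labels 𝒮 c hN hT hκ b, measureReal_def]
    congr 2
    ext q
    simp only [hSdef, Set.mem_preimage, Set.mem_ofPred_eq]
    exact ⟨fun h => h.2, fun h => ⟨hκ, h⟩⟩
  · have : Prod.mk κ ⁻¹' S = ∅ := by
      ext q
      simp only [hSdef, Set.mem_preimage, Set.mem_ofPred_eq, Set.mem_empty_iff_false, iff_false]
      exact fun h => hκ h.1
    rw [this]; simp

end

section

variable {K M : ℕ} [NeZero K] [NeZero M] (𝒮 : Design K) (c : ℝ)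

/-! ### Convergence of the label frequencies -/

/-- The labels of the sampled clusters. -/
def siteLabels (N : ℕ) (w : ℤ × ℤ → I) (i : Fin N) : Fin K := label K (w (𝒮.site i))

lemma measurePreserving_label : MeasurePreserving (label K) volume (uniformLabel K) := by
  have h := (measurePreserving_fst (μ := uniformLabel K) (ν := stdNormal)).comp
    ⟨(measurable_label K).prodMk (measurable_rowNormal K), map_label_rowNormal K⟩
  exact h

lemma measurePreserving_siteLabels (N : ℕ) :
    MeasurePreserving (siteLabels 𝒮 N) (Measure.infinitePi fun _ => volume)
      (Measure.pi fun _ => uniformLabel K) := by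
  refine ⟨measurable_pi_lambda _ fun i => (measurable_label K).comp (measurable_pi_apply _), ?_⟩
  rw [← (measurePreserving_label (K := K)).map_eq]
  exact map_infinitePi_injective (site_fin_injective 𝒮 N) (measurable_label K)

lemma ae_tendsto_labelCount (k : Fin K) :
    ∀ᵐ w ∂(Measure.infinitePi fun _ : ℤ × ℤ => (volume : Measure I)),
      Tendsto (fun N : ℕ => labelCount (siteLabels 𝒮 N w) k / N) atTop (𝓝 (K : ℝ)⁻¹) := by
  set F : I → ℝ := fun x => if label K x = k then 1 else 0
  have hF : Measurable F :=
    (measurable_of_countable fun j : Fin K => if j = k then (1 : ℝ) else 0).comp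
      (measurable_label K)
  have hm : ∀ i : ℤ × ℤ, Measurable fun w : ℤ × ℤ → I => F (w i) := fun i =>
    hF.comp (measurable_pi_apply i)
  have hb : MemLp F 1 (volume : Measure I) :=
    MemLp.of_bound hF.aestronglyMeasurable 1 (ae_of_all _ fun x => by
      simp only [F]; split_ifs <;> simp)
  have hlaw : ∀ i : ℤ × ℤ, (Measure.infinitePi fun _ : ℤ × ℤ => (volume : Measure I)).map
      (fun w => F (w i)) = (volume : Measure I).map F := fun i =>
    (Measure.map_map hF (measurable_pi_apply i)).symm.trans (by
      rw [(measurePreserving_infinitePi_eval i).map_eq])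
  have hlln := strong_law_ae_real (μ := Measure.infinitePi fun _ : ℤ × ℤ => (volume : Measure I))
    (fun i w => F (w (𝒮.site i)))
    (memLp_one_iff_integrable.1 (memLp_infinitePi_eval hb _))
    (fun i j hij => indepFun_infinitePi_eval hF hF (𝒮.site_injective.ne hij))
    (fun i => ⟨(hm _).aemeasurable, (hm _).aemeasurable, (hlaw _).trans (hlaw _).symm⟩)
  have hmean : ∫ w, F (w (𝒮.site 0)) ∂(Measure.infinitePi fun _ : ℤ × ℤ => (volume : Measure I))
      = (K : ℝ)⁻¹ := by
    rw [integral_infinitePi_eval hF]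
    have h := integral_map (μ := (volume : Measure I)) (measurable_label K).aemeasurable
      (f := fun j : Fin K => if j = k then (1 : ℝ) else 0)
      (measurable_of_countable _).aestronglyMeasurable
    rw [measurePreserving_label.map_eq, integral_uniformLabel] at h
    exact h.symm.trans (by simp)
  rw [hmean] at hlln
  filter_upwards [hlln] with w hw
  refine hw.congr fun N => ?_
  rw [labelCount, ← Fin.sum_univ_eq_sum_range fun i => F (w (𝒮.site i))]
  rfl

/-- All label vectors are realized on the infinite random field, where the strong law holds
simultaneously for all `N`. Convergence along deterministic arrays with the right frequencies then
passes to the expectations by dominated convergence. -/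
lemma tendsto_integral_labels (𝒮 : Design K) {F : ∀ N : ℕ, (Fin N → Fin K) → ℝ} {l : ℝ}
    (hb : ∀ N κ, |F N κ| ≤ 1)
    (h : ∀ κ : ∀ N : ℕ, Fin N → Fin K,
      (∀ k, Tendsto (fun N : ℕ => labelCount (κ N) k / N) atTop (𝓝 (K : ℝ)⁻¹)) →
        Tendsto (fun N => F N (κ N)) atTop (𝓝 l)) :
    Tendsto (fun N => ∫ κ, F N κ ∂(Measure.pi fun _ : Fin N => uniformLabel K)) atTop (𝓝 l) := by
  have hpull : ∀ N, ∫ w, F N (siteLabels 𝒮 N w)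
        ∂(Measure.infinitePi fun _ : ℤ × ℤ => (volume : Measure I))
      = ∫ κ, F N κ ∂(Measure.pi fun _ : Fin N => uniformLabel K) := fun N => by
    rw [← (measurePreserving_siteLabels 𝒮 N).map_eq,
      integral_map (measurePreserving_siteLabels 𝒮 N).measurable.aemeasurable
        (measurable_labels (F N)).aestronglyMeasurable]
  have hconst : ∫ _w, l ∂(Measure.infinitePi fun _ : ℤ × ℤ => (volume : Measure I)) = l := by simp
  simp only [← hpull]
  rw [← hconst]
  refine tendsto_integral_of_dominated_convergence (fun _ => 1)
    (fun N => ((measurable_labels (F N)).comp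
      (measurePreserving_siteLabels 𝒮 N).measurable).aestronglyMeasurable)
    (integrable_const 1) (fun N => ae_of_all _ fun w => hb N _) ?_
  filter_upwards [ae_all_iff.2 (ae_tendsto_labelCount 𝒮)] with w hw
  exact h (fun N => siteLabels 𝒮 N w) hw

lemma eventually_labelCount_ne_zero {κ : ∀ N : ℕ, Fin N → Fin K}
    (h : ∀ k, Tendsto (fun N : ℕ => labelCount (κ N) k / N) atTop (𝓝 (K : ℝ)⁻¹)) :
    ∀ᶠ N in atTop, ∀ k, labelCount (κ N) k ≠ 0 := by
  have hK : (K : ℝ)⁻¹ ≠ 0 := inv_ne_zero (by exact_mod_cast NeZero.ne K)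
  refine eventually_all.2 fun k => ?_
  filter_upwards [(h k).eventually_ne hK] with N hN h0
  exact hN (by rw [h0, zero_div])

lemma tendsto_rowVariance {κ : ∀ N : ℕ, Fin N → Fin K}
    (h : ∀ k, Tendsto (fun N : ℕ => labelCount (κ N) k / N) atTop (𝓝 (K : ℝ)⁻¹)) :
    Tendsto (fun N => rowVariance 𝒮.ϱ (κ N)) atTop (𝓝 K) := by
  have hK : (K : ℝ)⁻¹ ≠ 0 := inv_ne_zero (by exact_mod_cast NeZero.ne K)
  have hlim := tendsto_finsetSum Finset.univ fun k _ => ((h k).inv₀ hK).const_mul (𝒮.ϱ k ^ 2)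
  rw [← Finset.sum_mul, 𝒮.ϱ_unit, one_mul, inv_inv] at hlim
  exact hlim

/-- As `n_k/N → 1/K` and `ϱ` is a unit vector, the conditional variance tends to `K`. Hence the
threshold `√K b` is asymptotically `b` standard deviations. -/
lemma tendsto_coveredGiven (b : ℝ) :
    Tendsto (fun N => ∫ κ, coveredGiven 𝒮 c (√(K : ℝ) * b) κ
      ∂(Measure.pi fun _ : Fin N => uniformLabel K)) atTop (𝓝 (prodNormalCDF c b)) := by
  have hK : 0 < √(K : ℝ) := Real.sqrt_pos.2 (by exact_mod_cast Nat.pos_of_ne_zero (NeZero.ne K))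
  refine tendsto_integral_labels 𝒮 (fun N κ => ?_) fun κ hκ => ?_
  · rw [coveredGiven]
    split_ifs
    · exact abs_le.2 ⟨by linarith [prodNormalCDF_nonneg c (√(K : ℝ) * b / √(rowVariance 𝒮.ϱ κ))],
        prodNormalCDF_le_one _ _⟩
    · simp
  · have h1 := (Real.continuous_sqrt.tendsto _).comp (tendsto_rowVariance 𝒮 hκ)
    have h2 := ((continuous_prodNormalCDF c).tendsto _).comp
      ((tendsto_const_nhds (x := √(K : ℝ) * b)).div h1 hK.ne')
    rw [mul_div_cancel_left₀ _ hK.ne'] at h2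
    refine h2.congr' ?_
    filter_upwards [eventually_labelCount_ne_zero hκ] with N hN
    rw [coveredGiven, if_pos hN]
    rfl

/-- The probability that some label does not occur. -/
def missingLabel (K N : ℕ) [NeZero K] : ℝ :=
  (Measure.pi fun _ : Fin N => uniformLabel K).real {κ | ¬∀ k, labelCount κ k ≠ 0}

lemma tendsto_missingLabel (𝒮 : Design K) : Tendsto (fun N => missingLabel K N) atTop (𝓝 0) := by
  have h := tendsto_integral_labels 𝒮
    (F := fun N κ => {κ : Fin N → Fin K | ¬∀ k, labelCount κ k ≠ 0}.indicator 1 κ) (l := 0)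
    (fun N κ => by
      rw [Set.indicator_apply]
      split_ifs <;> simp)
    fun κ hκ => tendsto_const_nhds.congr' (by
      filter_upwards [eventually_labelCount_ne_zero hκ] with N hN
      rw [Set.indicator_of_notMem]
      exact fun h => h hN)
  refine h.congr fun N => ?_
  rw [integral_indicator_one (Set.Countable.measurableSet (Set.to_countable _))]
  rfl

/-! ### Bounds for the law of the estimation error -/

variable {N T : ℕ}

lemma measureReal_not_allLabels (r : ℝ) :
    ((rowMarkLaw K N).prod (Measure.pi fun _ : Fin T => gaussianReal r 1)).real
      {p | ¬AllLabels p} = missingLabel K N := by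
  have h := measurePreserving_fst.comp (measurePreserving_split (K := K) N T r)
  rw [missingLabel, ← h.map_eq, map_measureReal_apply h.measurable
    (Set.Countable.measurableSet (Set.to_countable _))]
  rfl

/-- If a label is missing, the Gram matrix is singular and the product formula for the error is not
available. That event is discarded at the price of its probability, which tends to `0` with `N`. -/
lemma dataLaw_real_le (hT : 0 < T) {S : Set ℝ} (hS : MeasurableSet S) :
    ((shiftDGP M 𝒮 c).dataLaw 𝒮 N T).real {z | estimate 𝒮 z - 𝒮.target ∈ S}
      ≤ ((rowMarkLaw K N).prod (Measure.pi fun _ : Fin T => gaussianReal (c / √(T : ℝ)) 1)).real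
        {p | AllLabels p ∧
          rowMean 𝒮.ϱ (fun i => (p.1 i).1) (fun i => (p.1 i).2) * timeMean p.2 ∈ S}
        + missingLabel K N := by
  have hm : MeasurableSet {z : Panel K M N T | estimate 𝒮 z - 𝒮.target ∈ S} :=
    ((measurable_estimate 𝒮).sub_const _) hS
  rw [dataLaw_shiftDGP, map_measureReal_apply (measurable_panelMap 𝒮) hm,
    ← measureReal_not_allLabels (K := K) (N := N) (T := T) (c / √(T : ℝ))]
  refine (measureReal_mono fun p hp => ?_).trans (measureReal_union_le _ _)
  by_cases hall : AllLabels p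
  · refine Or.inl ⟨hall, ?_⟩
    rw [← estimate_panelMap (M := M) 𝒮 hT p hall]
    exact hp
  · exact Or.inr hall

lemma dataLaw_abs_error_le (hN : 0 < N) (hT : 0 < T) (b : ℝ) :
    ((shiftDGP M 𝒮 c).dataLaw 𝒮 N T).real
        {z | |estimate 𝒮 z - 𝒮.target| ≤ b / √((N : ℝ) * T)}
      ≤ (∫ κ, coveredGiven 𝒮 c b κ ∂(Measure.pi fun _ : Fin N => uniformLabel K))
        + missingLabel K N := by
  have hpos : 0 < √((N : ℝ) * T) := Real.sqrt_pos.2 (by positivity)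
  rw [← errorProbability 𝒮 c hN hT]
  refine (dataLaw_real_le (M := M) 𝒮 c hT (S := {x | |x| ≤ b / √((N : ℝ) * T)})
    (measurableSet_le measurable_norm measurable_const)).trans_eq ?_
  simp only [Set.mem_ofPred_eq, le_div_iff₀' hpos]

lemma measurePreserving_neg_time (T : ℕ) :
    MeasurePreserving (fun w : Fin T → ℝ => fun t => -w t) (Measure.pi fun _ => stdNormal)
      (Measure.pi fun _ => stdNormal) :=
  measurePreserving_pi _ _ fun _ => stdNormal_measurePreserving_neg

/-- The estimation error as a function of the marks, if all labels occur. -/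
def markError (p : (Fin N → Fin K × ℝ) × (Fin T → ℝ)) : ℝ :=
  rowMean 𝒮.ϱ (fun i => (p.1 i).1) (fun i => (p.1 i).2) * timeMean p.2

lemma measurable_markError : Measurable (markError 𝒮 (N := N) (T := T)) := by
  have htime : Measurable (timeMean (T := T)) := by
    unfold timeMean
    fun_prop
  exact ((measurable_rowMean (T := T) 𝒮).comp (measurePreserving_split N T 0).measurable).mul
    (htime.comp measurable_snd)

lemma measurableSet_allLabels :
    MeasurableSet {p : (Fin N → Fin K × ℝ) × (Fin T → ℝ) | AllLabels p} :=
  (measurable_fst.comp (measurePreserving_split (K := K) N T 0).measurable)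
    (Set.Countable.measurableSet (s := {κ : Fin N → Fin K | ∀ k, labelCount κ k ≠ 0})
      (Set.to_countable _))

/-- Changing the sign of all time effects preserves their law when there is no shift, and reverses
the sign of the error. -/
lemma errorProbability_symm (b : ℝ) :
    ((rowMarkLaw K N).prod (Measure.pi fun _ : Fin T => stdNormal)).real
        {p | AllLabels p ∧ markError 𝒮 p ∈ Set.Iio (-b)}
      = ((rowMarkLaw K N).prod (Measure.pi fun _ : Fin T => stdNormal)).real
        {p | AllLabels p ∧ markError 𝒮 p ∈ Set.Ioi b} := by
  have h := (MeasurePreserving.id (rowMarkLaw K N)).prod (measurePreserving_neg_time T)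
  have hS : MeasurableSet {p : (Fin N → Fin K × ℝ) × (Fin T → ℝ) |
      AllLabels p ∧ markError 𝒮 p ∈ Set.Ioi b} :=
    measurableSet_allLabels.inter (measurable_markError 𝒮 measurableSet_Ioi)
  have h1 := map_measureReal_apply (μ := (rowMarkLaw K N).prod
    (Measure.pi fun _ : Fin T => stdNormal)) h.measurable hS
  rw [h.map_eq] at h1
  rw [h1]
  congr 1
  ext p
  simp only [Set.mem_ofPred_eq, Set.mem_preimage, Set.mem_Iio, Set.mem_Ioi, markError, timeMean,
    Prod.map, id, Finset.sum_neg_distrib, mul_neg, lt_neg]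
  rfl

/-- By symmetry each tail carries the same mass, and the two tails and the central event are
disjoint. So each tail has at most half of what the centre leaves, apart from missing labels. Tails
are bounded separately because equal-tailed intervals use both quantiles. -/
lemma errorLaw_tail_le (hN : 0 < N) (hT : 0 < T) {b : ℝ} (hb : 0 ≤ b) {S : Set ℝ}
    (hS : S = Set.Iio (-(b / √((N : ℝ) * T))) ∨ S = Set.Ioi (b / √((N : ℝ) * T))) :
    (errorLaw (shiftDGP M 𝒮 0) 𝒮 N T).real S
      ≤ (1 - ∫ κ, coveredGiven 𝒮 0 b κ ∂(Measure.pi fun _ : Fin N => uniformLabel K)) / 2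
        + missingLabel K N := by
  have hpos : 0 < √((N : ℝ) * T) := Real.sqrt_pos.2 (by positivity)
  have hSm : MeasurableSet S := by
    rcases hS with rfl | rfl <;> measurability
  rw [errorLaw, map_measureReal_apply ((measurable_estimate 𝒮).sub_const _) hSm]
  refine (dataLaw_real_le (M := M) 𝒮 0 hT hSm).trans (add_le_add_left ?_ _)
  rw [← errorProbability 𝒮 0 hN hT, zero_div]
  set β := b / √((N : ℝ) * T) with hβ
  have hβ0 : 0 ≤ β := div_nonneg hb hpos.le
  set μ := (rowMarkLaw K N).prod (Measure.pi fun _ : Fin T => stdNormal)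
  set A := {p : (Fin N → Fin K × ℝ) × (Fin T → ℝ) | AllLabels p ∧ markError 𝒮 p ∈ Set.Iio (-β)}
  set B := {p : (Fin N → Fin K × ℝ) × (Fin T → ℝ) | AllLabels p ∧ markError 𝒮 p ∈ Set.Ioi β}
  set V := {p : (Fin N → Fin K × ℝ) × (Fin T → ℝ) |
    AllLabels p ∧ √((N : ℝ) * T) * |markError 𝒮 p| ≤ b} with hV
  have hBm : MeasurableSet B := measurableSet_allLabels.inter
    (measurable_markError 𝒮 measurableSet_Ioi)
  have hAm : MeasurableSet A := measurableSet_allLabels.inter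
    (measurable_markError 𝒮 measurableSet_Iio)
  have hVβ : ∀ p, p ∈ V → |markError 𝒮 p| ≤ β := fun p hp => (le_div_iff₀' hpos).2 hp.2
  have hAB : Disjoint A B := Set.disjoint_left.2 fun p hA hB => by
    have h1 : markError 𝒮 p < -β := hA.2
    have h2 : β < markError 𝒮 p := hB.2
    linarith
  have hVAB : Disjoint V (A ∪ B) := Set.disjoint_left.2 fun p h hAB => by
    have h0 := abs_le.1 (hVβ p h)
    rcases hAB with hA | hB
    · have h1 : markError 𝒮 p < -β := hA.2
      linarith
    · have h2 : β < markError 𝒮 p := hB.2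
      linarith
  have hsum : μ.real V + (μ.real A + μ.real B) ≤ 1 := by
    rw [← measureReal_union hAB hBm, ← measureReal_union hVAB (hAm.union hBm)]
    exact measureReal_le_one
  have hsymm : μ.real A = μ.real B := errorProbability_symm 𝒮 β
  change μ.real {p | AllLabels p ∧ markError 𝒮 p ∈ S} ≤ (1 - μ.real V) / 2
  rcases hS with rfl | rfl
  · change μ.real A ≤ _
    linarith
  · change μ.real B ≤ _
    linarith

/-! ### Quantiles of laws that are close in Kolmogorov distance -/

/-- Quantiles are real infima, so bounds for them are meaningful only for sets bounded below; this
uses that the distribution function vanishes at `-∞`. -/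
lemma bddBelow_quantile (μ : Measure ℝ) [IsProbabilityMeasure μ] {p : ℝ} (hp : 0 < p) :
    BddBelow {x | p ≤ μ.real (Set.Iic x)} := by
  obtain ⟨x₀, h⟩ := eventually_atBot.1 ((tendsto_cdf_atBot μ).eventually_lt_const hp)
  refine ⟨x₀, fun x hx => le_of_not_gt fun hlt => ?_⟩
  have := h x hlt.le
  rw [cdf_eq_real] at this
  exact this.not_ge hx

lemma nonempty_quantile (μ : Measure ℝ) [IsProbabilityMeasure μ] {p : ℝ} (hp : p < 1) :
    {x | p ≤ μ.real (Set.Iic x)}.Nonempty := by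
  obtain ⟨x, h⟩ := ((tendsto_cdf_atTop μ).eventually_const_lt hp).exists
  rw [cdf_eq_real] at h
  exact ⟨x, h.le⟩

section Quantile

variable {μ E : Measure ℝ} [IsProbabilityMeasure μ] [IsProbabilityMeasure E] {a η β : ℝ}

lemma quantile_upper_le (ha : a < 2) (hk : kolmogorov μ E ≤ η)
    (hu : E.real (Set.Ioi β) ≤ a / 2 - η) : quantile μ (1 - a / 2) ≤ β := by
  refine csInf_le (bddBelow_quantile μ (by linarith)) ?_
  have h1 := abs_le.1 ((abs_sub_le_kolmogorov μ E β).trans hk)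
  have h2 : E.real (Set.Iic β) = 1 - E.real (Set.Ioi β) := by
    rw [← Set.compl_Ioi, probReal_compl_eq_one_sub measurableSet_Ioi]
  simp only [Set.mem_ofPred_eq]
  linarith

/-- Twice `η` is subtracted: one `η` pays for the Kolmogorov distance, the other makes the
inequality strict, so that no point below `-β` can reach the level `a/2`. -/
lemma le_quantile_lower (ha : a < 2) (hη : 0 < η) (hk : kolmogorov μ E ≤ η)
    (hl : E.real (Set.Iio (-β)) ≤ a / 2 - 2 * η) : -β ≤ quantile μ (a / 2) := by
  refine le_csInf (nonempty_quantile μ (by linarith)) fun x hx => le_of_not_gt fun hlt => ?_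
  have h1 := abs_le.1 ((abs_sub_le_kolmogorov μ E x).trans hk)
  have h2 : E.real (Set.Iic x) ≤ E.real (Set.Iio (-β)) :=
    measureReal_mono (Set.Iic_subset_Iio.2 hlt)
  have hx' : a / 2 ≤ μ.real (Set.Iic x) := hx
  linarith

/-- The Kolmogorov distance compares half-lines `Iic` only, so a possible atom at the lower end of
the symmetric interval is not controlled by the open tail there. The slack `β < β'` puts `Iic (-β')`
inside the open tail below `-β`. -/
lemma quantile_abs_le (ha : a < 1) (hk : kolmogorov μ E ≤ η)
    (hu : E.real (Set.Ioi β) ≤ a / 2 - η) (hl : E.real (Set.Iio (-β)) ≤ a / 2 - η) {β' : ℝ}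
    (hβ : β < β') : quantile (μ.map fun x => |x|) (1 - a) ≤ β' := by
  have habs : Measurable fun x : ℝ => |x| := measurable_norm
  have := Measure.isProbabilityMeasure_map (μ := μ) habs.aemeasurable
  refine csInf_le (bddBelow_quantile _ (by linarith)) ?_
  have h1 := abs_le.1 ((abs_sub_le_kolmogorov μ E β).trans hk)
  have h1' := abs_le.1 ((abs_sub_le_kolmogorov μ E (-β')).trans hk)
  have h2 : E.real (Set.Iic β) = 1 - E.real (Set.Ioi β) := by
    rw [← Set.compl_Ioi, probReal_compl_eq_one_sub measurableSet_Ioi]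
  have h3 : E.real (Set.Iic (-β')) ≤ E.real (Set.Iio (-β)) :=
    measureReal_mono (Set.Iic_subset_Iio.2 (by linarith))
  have h4 : μ.real (Set.Iic β) ≤ μ.real (Set.Icc (-β') β') + μ.real (Set.Iic (-β')) := by
    refine (measureReal_mono fun x hx => ?_).trans (measureReal_union_le _ _)
    rcases le_total x (-β') with h | h
    · exact Or.inr h
    · exact Or.inl ⟨h, (Set.mem_Iic.1 hx).trans hβ.le⟩
  simp only [Set.mem_ofPred_eq]
  rw [map_measureReal_apply habs measurableSet_Iic]
  have h5 : (fun x : ℝ => |x|) ⁻¹' Set.Iic β' = Set.Icc (-β') β' := by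
    ext x
    exact abs_le (a := x) (b := β')
  rw [h5]
  linarith

end Quantile

/-! ### Coverage -/

instance (N T : ℕ) : IsProbabilityMeasure (errorLaw (shiftDGP M 𝒮 c) 𝒮 N T) :=
  Measure.isProbabilityMeasure_map ((measurable_estimate 𝒮).sub_const _).aemeasurable

variable {𝒮}

/-- Coverage under shift `1` is split into two events. That the rule misses the error law of shift
`0` has vanishing probability without shift, hence also with shift `1` by contiguity. Otherwise
coverage forces a small error, which has limiting probability `prodNormalCDF 1 y` under shift `1`.
-/
lemma coverageLimit_le {𝒟 : Set (Calibration K M)} {C₁ C₂ : Set (DGP K M)}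
    (h1 : shiftDGP M 𝒮 1 ∈ C₁) (h2 : shiftDGP M 𝒮 0 ∈ C₂) (hex : UniformlyExact 𝒮 𝒟 C₂)
    (ci : Calibration K M → ∀ {N T : ℕ}, Panel K M N T → Set ℝ) {η y q : ℝ} (hη : 0 < η)
    (hq : prodNormalCDF 1 y < q)
    (hci : ∀ᶠ n : ℕ × ℕ in atTop ×ˢ atTop, ∀ (D : Calibration K M) (z : Panel K M n.1 n.2),
      kolmogorov ((D n.1 n.2).1 z) (errorLaw (shiftDGP M 𝒮 0) 𝒮 n.1 n.2) ≤ η →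
      𝒮.target ∈ ci D z →
        |estimate 𝒮 z - 𝒮.target| ≤ √(K : ℝ) * y / √((n.1 : ℝ) * n.2)) :
    coverageLimit 𝒮 𝒟 C₁ ci ≤ ENNReal.ofReal q := by
  have hJ : 0 ≤ prodNormalCDF 1 y := prodNormalCDF_nonneg 1 y
  set s : ℕ × ℕ → ℝ≥0∞ := fun n => ⨆ D ∈ 𝒟, ⨆ g ∈ C₂, g.dataLaw 𝒮 n.1 n.2
    {z | η < kolmogorov ((D n.1 n.2).1 z) (errorLaw g 𝒮 n.1 n.2)}
  have hs : Tendsto s (atTop ×ˢ atTop) (𝓝 0) := hex η hη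
  -- Total variation does not help here, as the shift `1` is not small; contiguity only needs the
  -- probability without shift to vanish, uniformly over the rules.
  have hs' : Tendsto (fun n => ENNReal.ofReal √(Real.exp (1 ^ 2)) * s n ^ (1 / 2 : ℝ))
      (atTop ×ˢ atTop) (𝓝 0) := by
    have h := ENNReal.Tendsto.const_mul (a := ENNReal.ofReal √(Real.exp (1 ^ 2)))
      ((ENNReal.continuous_rpow_const (y := (1 / 2 : ℝ))).tendsto 0 |>.comp hs)
      (Or.inr ENNReal.ofReal_ne_top)
    rw [ENNReal.zero_rpow_of_pos (by norm_num), mul_zero] at h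
    exact h
  have hv := ((tendsto_coveredGiven 𝒮 1 y).add (tendsto_missingLabel (K := K) 𝒮)).comp
    (tendsto_fst (f := atTop) (g := (atTop : Filter ℕ)))
  rw [add_zero] at hv
  have htot := hs'.add (ENNReal.tendsto_ofReal hv)
  rw [zero_add] at htot
  have hlt := htot.eventually_lt_const
    ((ENNReal.ofReal_lt_ofReal_iff (hJ.trans_lt hq)).2 hq)
  refine liminf_le_of_le (by isBoundedDefault) fun x hx => ?_
  obtain ⟨n, hn, hnx, hnci, hn1, hn2⟩ := (hlt.and (hx.and (hci.and
    ((tendsto_fst.eventually (eventually_gt_atTop 0)).and eventually_pos_snd)))).exists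
  refine hnx.trans ((iSup₂_le fun D hD => ?_).trans hn.le)
  refine (iInf₂_le _ h1).trans ?_
  have hsub : {z : Panel K M n.1 n.2 | 𝒮.target ∈ ci D z}
      ⊆ {z | η < kolmogorov ((D n.1 n.2).1 z) (errorLaw (shiftDGP M 𝒮 0) 𝒮 n.1 n.2)}
        ∪ {z | |estimate 𝒮 z - 𝒮.target| ≤ √(K : ℝ) * y / √((n.1 : ℝ) * n.2)} := by
    intro z hz
    rcases lt_or_ge η (kolmogorov ((D n.1 n.2).1 z) (errorLaw (shiftDGP M 𝒮 0) 𝒮 n.1 n.2))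
      with h | h
    · exact Or.inl h
    · exact Or.inr (hnci D z h hz)
  refine (measure_mono hsub).trans ((measure_union_le _ _).trans (add_le_add ?_ ?_))
  · refine (dataLaw_shift_le_sqrt 𝒮 1 hn2 _).trans ?_
    gcongr
    exact le_iSup₂_of_le D hD (le_iSup₂_of_le _ h2 le_rfl)
  · rw [← ofReal_measureReal]
    exact ENNReal.ofReal_le_ofReal (dataLaw_abs_error_le 𝒮 1 hn1 hn2 _)

/-- Rules that are exact under vanishing non-Gaussianity undercover. -/
theorem coverage_lt (M : ℕ) [NeZero M] (𝒮 : Design K) (a : ℝ) (ha0 : 0 < a) (ha1 : a < 1) :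
    ∃ ε₂ : ℝ, 0 < ε₂ ∧ ∃ F₁ F₂ : Set (DGP K M), F₁.Finite ∧ F₂.Finite ∧
      F₁ ⊆ classIN M 𝒮 ∧ F₂ ⊆ classVN M 𝒮 ∧
      ∀ C₁ C₂ : Set (DGP K M), F₁ ⊆ C₁ → C₁ ⊆ classIN M 𝒮 → F₂ ⊆ C₂ → C₂ ⊆ classVN M 𝒮 →
        ∀ 𝒟 : Set (Calibration K M), 𝒟.Nonempty → UniformlyExact 𝒮 𝒟 C₂ →
          coverageLimit 𝒮 𝒟 C₁ (fun D => equalTailedCI 𝒮 D a) ≤ ENNReal.ofReal (1 - a - ε₂) ∧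
          coverageLimit 𝒮 𝒟 C₁ (fun D => symmetricCI 𝒮 D a) ≤ ENNReal.ofReal (1 - a - ε₂) := by
  -- At `y` the limit without shift already exceeds `1 - a`, so rules exact there eventually have
  -- critical values below this scale. The limit with shift `1` is still below `1 - a`, so such
  -- critical values undercover.
  obtain ⟨y, hy, hy1, hy0⟩ := exists_prodNormalCDF_separation (c := 1) (q := 1 - a) one_pos
    (by linarith) (by linarith)
  -- A slightly larger level, still undercovering by continuity, supplies the slack that the
  -- symmetric interval requires in `quantile_abs_le`.
  obtain ⟨y', hyy', hy1'⟩ : ∃ y' > y, prodNormalCDF 1 y' < 1 - a := by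
    have h := ((continuous_prodNormalCDF 1).tendsto y).eventually_lt_const hy1
    obtain ⟨y', h1, h2⟩ := ((h.filter_mono nhdsWithin_le_nhds).and
      (self_mem_nhdsWithin (s := Set.Ioi y))).exists
    exact ⟨y', h2, h1⟩
  have hK : 0 < √(K : ℝ) := Real.sqrt_pos.2 (by exact_mod_cast Nat.pos_of_ne_zero (NeZero.ne K))
  -- With this choice the limiting mass of each tail is `a/2 - 4η`. Eventually both tails are at
  -- most `a/2 - 2η`, which is what the lower quantile bound asks for.
  set η := (prodNormalCDF 0 y - (1 - a)) / 8 with hηdef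
  have hη : 0 < η := by rw [hηdef]; linarith
  set ε := (1 - a - prodNormalCDF 1 y') / 2 with hε
  have htail : ∀ᶠ n : ℕ × ℕ in atTop ×ˢ atTop,
      (errorLaw (shiftDGP M 𝒮 0) 𝒮 n.1 n.2).real
          (Set.Iio (-(√(K : ℝ) * y / √((n.1 : ℝ) * n.2)))) ≤ a / 2 - 2 * η ∧
        (errorLaw (shiftDGP M 𝒮 0) 𝒮 n.1 n.2).real
          (Set.Ioi (√(K : ℝ) * y / √((n.1 : ℝ) * n.2))) ≤ a / 2 - 2 * η := by
    have hv := ((((tendsto_coveredGiven 𝒮 0 y).const_sub 1).div_const 2).add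
      (tendsto_missingLabel (K := K) 𝒮)).comp (tendsto_fst (f := atTop) (g := (atTop : Filter ℕ)))
    have hlt : (1 - prodNormalCDF 0 y) / 2 + 0 < a / 2 - 2 * η := by
      have : prodNormalCDF 0 y = 1 - a + 8 * η := by rw [hηdef]; ring
      rw [this]; linarith
    filter_upwards [hv.eventually_lt_const hlt, tendsto_fst.eventually (eventually_gt_atTop 0),
      eventually_pos_snd] with n hn hn1 hn2
    exact ⟨(errorLaw_tail_le 𝒮 hn1 hn2 (by positivity) (Or.inl rfl)).trans hn.le,
      (errorLaw_tail_le 𝒮 hn1 hn2 (by positivity) (Or.inr rfl)).trans hn.le⟩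
  have hlevel : prodNormalCDF 1 y' < 1 - a - ε := by rw [hε]; linarith
  refine ⟨ε, by rw [hε]; linarith, {shiftDGP M 𝒮 1}, {shiftDGP M 𝒮 0}, Set.finite_singleton _,
    Set.finite_singleton _, Set.singleton_subset_iff.2 (shiftDGP_mem_classIN 𝒮 1 one_ne_zero),
    Set.singleton_subset_iff.2 (shiftDGP_mem_classVN 𝒮),
    fun C₁ C₂ h1 _ h2 _ 𝒟 _ hex => ⟨?_, ?_⟩⟩
  · refine coverageLimit_le (Set.singleton_subset_iff.1 h1) (Set.singleton_subset_iff.1 h2) hex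
      (fun D => equalTailedCI 𝒮 D a) hη hlevel ?_
    filter_upwards [htail] with n hn D z hk hz
    have := (D n.1 n.2).2
    have hle : √(K : ℝ) * y / √((n.1 : ℝ) * n.2) ≤ √(K : ℝ) * y' / √((n.1 : ℝ) * n.2) := by
      gcongr
    have hu := quantile_upper_le (a := a) (by linarith) hk (hn.2.trans (by linarith))
    have hl := le_quantile_lower (by linarith) hη hk hn.1
    exact abs_le.2 ⟨by linarith [hz.1], by linarith [hz.2]⟩
  · refine coverageLimit_le (Set.singleton_subset_iff.1 h1) (Set.singleton_subset_iff.1 h2) hex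
      (fun D => symmetricCI 𝒮 D a) hη hlevel ?_
    filter_upwards [htail, tendsto_fst.eventually (eventually_gt_atTop 0), eventually_pos_snd]
      with n hn hn1 hn2 D z hk hz
    have := (D n.1 n.2).2
    have hpos : 0 < √((n.1 : ℝ) * n.2) := Real.sqrt_pos.2 (by positivity)
    have hlt : √(K : ℝ) * y / √((n.1 : ℝ) * n.2) < √(K : ℝ) * y' / √((n.1 : ℝ) * n.2) := by
      gcongr
    exact le_trans hz (quantile_abs_le ha1 hk (hn.2.trans (by linarith))
      (hn.1.trans (by linarith)) hlt)

end

end TwoWay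

end

theorem mainTheorem5 (K M : ℕ) [NeZero K] [NeZero M] (𝒮 : TwoWay.Design K) :
    (∃ ε₁ : ℝ, 0 < ε₁ ∧ ∃ F₁ : Set (TwoWay.DGP K M), F₁.Finite ∧ F₁ ⊆ TwoWay.classIN M 𝒮 ∧
      ∀ C₁ : Set (TwoWay.DGP K M), F₁ ⊆ C₁ → C₁ ⊆ TwoWay.classIN M 𝒮 →
        0 < TwoWay.estimationRisk 𝒮 C₁ ε₁) ∧
    ((TwoWay.coupledAgreementLimit 𝒮 (TwoWay.classIN M 𝒮) (TwoWay.classVN M 𝒮) = 1 ∧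
      TwoWay.independentAgreementLimit 𝒮 (TwoWay.classIN M 𝒮) (TwoWay.classVN M 𝒮) = 1 / 2) ∧
      ∀ η : ℝ≥0∞, 0 < η → ∃ F₁ F₂ : Set (TwoWay.DGP K M), F₁.Finite ∧ F₂.Finite ∧
        F₁ ⊆ TwoWay.classIN M 𝒮 ∧ F₂ ⊆ TwoWay.classVN M 𝒮 ∧
        ∀ C₁ C₂ : Set (TwoWay.DGP K M), F₁ ⊆ C₁ → C₁ ⊆ TwoWay.classIN M 𝒮 →
          F₂ ⊆ C₂ → C₂ ⊆ TwoWay.classVN M 𝒮 →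
          1 - η ≤ TwoWay.coupledAgreementLimit 𝒮 C₁ C₂ ∧
          1 / 2 - η ≤ TwoWay.independentAgreementLimit 𝒮 C₁ C₂) ∧
    (∀ a : ℝ, 0 < a → a < 1 →
      ∃ ε₂ : ℝ, 0 < ε₂ ∧ ∃ F₁ F₂ : Set (TwoWay.DGP K M), F₁.Finite ∧ F₂.Finite ∧
        F₁ ⊆ TwoWay.classIN M 𝒮 ∧ F₂ ⊆ TwoWay.classVN M 𝒮 ∧
        ∀ C₁ C₂ : Set (TwoWay.DGP K M), F₁ ⊆ C₁ → C₁ ⊆ TwoWay.classIN M 𝒮 →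
          F₂ ⊆ C₂ → C₂ ⊆ TwoWay.classVN M 𝒮 →
          ∀ 𝒟 : Set (TwoWay.Calibration K M), 𝒟.Nonempty → TwoWay.UniformlyExact 𝒮 𝒟 C₂ →
            TwoWay.coverageLimit 𝒮 𝒟 C₁ (fun D => TwoWay.equalTailedCI 𝒮 D a)
              ≤ ENNReal.ofReal (1 - a - ε₂) ∧
            TwoWay.coverageLimit 𝒮 𝒟 C₁ (fun D => TwoWay.symmetricCI 𝒮 D a)
              ≤ ENNReal.ofReal (1 - a - ε₂)) := by
  exact ⟨TwoWay.estimationRisk_pos M 𝒮, TwoWay.agreement_limits M 𝒮, TwoWay.coverage_lt M 𝒮⟩
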